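/- Notation. For $q\ge 1$ let $A_q=\{1\le a\le q:\gcd(a,q)=1\}$, $\varphi(q)=\#A_q$, and for a Dirichlet character $\chi$ modulo $q$ put $G(\chi,n)=\varphi(q)^{-1}\sum_{r\in A_q}\chi(r)e^{2\pi i rn/q}$; $\mathbf 1_q$ is the principal character modulo $q$. For finitely supported $f:\mathbb Z\to\mathbb C$ let $\hat f(\xi)=\sum_n f(n)e^{-2\pi i\xi n}$, and let $\mathcal F^{-1}m(x)=\int_0^1 m(\xi)e^{2\pi i\xi x}\,d\xi$ for $x\in\mathbb Z$. For $\tfrac12\le\beta\le1$ let $M_N^\beta=\frac1N\sum_{n=1}^N\frac{n^\beta-(n-1)^\beta}{\beta}\delta_n$ and $M_N=M_N^1$. Given $c>0$, a quadratic character $\chi$ modulo $q$ (values in $\{-1,0,1\}$, the value $-1$ being attained) is called exceptional, with exceptional zero $\beta\in\mathbb R$, if $L(\beta,\chi)=0$, $1-\frac{c}{\log q}<\beta<1$ and $\beta\ge\frac12$. For $a\in A_q$ let $L_N^{a,q}=G(\mathbf 1_q,a)M_N$ if there is no exceptional character modulo $q$, and $L_N^{a,q}=G(\mathbf 1_q,a)M_N-G(\chi_q,a)M_N^{\beta_q}$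 if $\chi_q$ is the exceptional character modulo $q$ and $\beta_q$ is its exceptional zero. Let $\eta:\mathbb R\to[0,1]$ be smooth with $\eta(\xi)=1$ for $|\xi|\le\frac14$ and $\eta(\xi)=0$ for $|\xi|\ge\frac12$. For $s\ge0$ let $\eta_s$ be the $1$-periodic function with $\eta_s(\xi)=\eta(2^{4s}\xi)$ for $|\xi|\le\frac12$. Let $\mathscr R_s$ be the set of fractions $a/q$ with $a\in A_q$, $2^s\le q<2^{s+1}$, such that $q$ is square-free, or $4\mid q$ and $q/4$ is square-free. For $t>0$ and $n\ge t$ put $$\Pi_n^t(\xi)=\sum_{0\le s\le\sqrt t}\ \sum_{a/q\in\mathscr R_s}\widehat{L_{2^n}^{a,q}}(\xi-a/q)\,\eta_s(\xi-a/q).$$ Theorem. There is $c_0>0$ such that for every $0<c\le c_0$ the following holds. For each $q$ there is at most one exceptional character modulo $q$, and it has at most one exceptional zero (so $L^{a,q}_N$ and $\Pi_n^t$ are well defined). Moreover, for every $\eta$ as above there is $C>0$ such that for all $t>0$ and all finitely supported $f:\mathbb Z\to\mathbb C$, $$\sup_{\lambda>0}\ \lambda\cdot\Big|\Big\{x\in\mathbb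 Z:\ \sup_{n\in\mathbb N,\ n\ge t}\big|\mathcal F^{-1}\big(\Pi_n^t\hat f\big)(x)\big|>\lambda\Big\}\Big|\ \le\ C\max\{1,t\}\,\|f\|_{\ell^1(\mathbb Z)}.$$ In particular the bound is $Ct\|f\|_{\ell^1}$ for all $t\ge1$. -/

import Mathlib

namespace PrimeMultiplier

noncomputable section

/-- The reduced residues `A_q = {1 ≤ a ≤ q : gcd(a, q) = 1}`. -/
def reducedResidues (q : ℕ) : Finset ℕ :=
  (Finset.Icc 1 q).filter fun a => Nat.Coprime a q

/-- The normalized Gauss sum `G(χ, n) = φ(q)⁻¹ ∑_{r ∈ A_q} χ(r) e^{2πi r n / q}`. -/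
def gaussSum {q : ℕ} (χ : DirichletCharacter ℂ q) (n : ℕ) : ℂ :=
  (1 / (Nat.totient q : ℂ)) *
    ∑ r ∈ reducedResidues q,
      χ (r : ZMod q) * Complex.exp (2 * Real.pi * Complex.I * r * n / q)

/-- A quadratic character: its values lie in `{-1, 0, 1}` and `-1` is one of them. -/
def IsQuadraticCharacter {q : ℕ} (χ : DirichletCharacter ℂ q) : Prop :=
  (∀ x, χ x = -1 ∨ χ x = 0 ∨ χ x = 1) ∧ ∃ x, χ x = -1

/-- `χ` is an exceptional character modulo `q`, with exceptional zero `β`, relative to the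
constant `c`: `χ` is quadratic and `L(s, χ)` (analytically continued) vanishes at the real point
`β`, where `1 - c / log q < β < 1` and `1/2 ≤ β`. -/
def IsExceptional (c : ℝ) (q : ℕ) (χ : DirichletCharacter ℂ q) (β : ℝ) : Prop :=
  IsQuadraticCharacter χ ∧ 1 / 2 ≤ β ∧ 1 - c / Real.log q < β ∧ β < 1 ∧
    ∃ _ : NeZero q, DirichletCharacter.LFunction χ (β : ℂ) = 0

/-- The Fourier transform `f̂(ξ) = ∑_n f(n) e^{-2πi ξ n}` of a finitely supported function. -/
def hat (f : ℤ →₀ ℂ) (ξ : ℝ) : ℂ :=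
  ∑ n ∈ f.support, f n * Complex.exp (-(2 * Real.pi * Complex.I * ξ * n))

/-- The `ℓ¹(ℤ)` norm of a finitely supported function. -/
def l1norm (f : ℤ →₀ ℂ) : ℝ :=
  ∑ n ∈ f.support, ‖f n‖

/-- The inverse Fourier transform on the torus `𝕋 = [0, 1)`. -/
def invFourier (m : ℝ → ℂ) (x : ℤ) : ℂ :=
  ∫ ξ in (0 : ℝ)..1, m ξ * Complex.exp (2 * Real.pi * Complex.I * ξ * x)

/-- The kernel `M_N^β = N⁻¹ ∑_{n=1}^N β⁻¹ (n^β - (n-1)^β) δ_n` on `ℤ`. -/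
def avgKernel (β : ℝ) (N : ℕ) : ℤ →₀ ℂ :=
  ∑ n ∈ Finset.Icc 1 N,
    Finsupp.single (n : ℤ)
      (((1 / (N : ℝ)) * (((n : ℝ) ^ β - ((n : ℝ) - 1) ^ β) / β) : ℝ) : ℂ)

open Classical in
/-- The kernel `L_N^{a,q}`: it equals `G(𝟙_q, a) M_N` if there is no exceptional character
modulo `q`, and `G(𝟙_q, a) M_N - G(χ_q, a) M_N^{β_q}` if `χ_q` is the exceptional character
modulo `q` and `β_q` its exceptional zero. -/
def approxKernel (c : ℝ) (a q N : ℕ) : ℤ →₀ ℂ :=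
  if h : ∃ p : DirichletCharacter ℂ q × ℝ, IsExceptional c q p.1 p.2 then
    gaussSum (1 : DirichletCharacter ℂ q) a • avgKernel 1 N
      - gaussSum h.choose.1 a • avgKernel h.choose.2 N
  else
    gaussSum (1 : DirichletCharacter ℂ q) a • avgKernel 1 N

/-- A smooth cutoff `η : ℝ → [0, 1]` equal to `1` for `|ξ| ≤ 1/4` and to `0` for `|ξ| ≥ 1/2`. -/
structure IsCutoff (η : ℝ → ℝ) : Prop where
  smooth : ContDiff ℝ (⊤ : ℕ∞) η
  nonneg : ∀ ξ, 0 ≤ η ξ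
  le_one : ∀ ξ, η ξ ≤ 1
  eq_one : ∀ ξ, |ξ| ≤ 1 / 4 → η ξ = 1
  eq_zero : ∀ ξ, 1 / 2 ≤ |ξ| → η ξ = 0

/-- The function `η_s(ξ) = η(2^{4s} ξ)` as a function on the torus: a point of `ℝ / ℤ` is
represented by the real number `ξ - round ξ ∈ [-1/2, 1/2]`. -/
def cutoffScale (η : ℝ → ℝ) (s : ℕ) (ξ : ℝ) : ℝ :=
  η (2 ^ (4 * s) * (ξ - round ξ))

/-- The denominators of the fractions in `ℛ_s`: `2^s ≤ q < 2^{s+1}`, and `q` is square-free, or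
`4 ∣ q` and `q / 4` is square-free. -/
def denominators (s : ℕ) : Finset ℕ :=
  open Classical in
  (Finset.Ico (2 ^ s) (2 ^ (s + 1))).filter fun q =>
    Squarefree q ∨ (4 ∣ q ∧ Squarefree (q / 4))

/-- The multiplier `ν_n^s(ξ) = ∑_{a/q ∈ ℛ_s} (L_{2^n}^{a,q})^(ξ - a/q) η_s(ξ - a/q)`. -/
def nu (c : ℝ) (η : ℝ → ℝ) (s n : ℕ) (ξ : ℝ) : ℂ :=
  ∑ q ∈ denominators s, ∑ a ∈ reducedResidues q,
    hat (approxKernel c a q (2 ^ n)) (ξ - a / q) * (cutoffScale η s (ξ - a / q) : ℂ)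

/-- The multiplier `Π_n^t = ∑_{0 ≤ s ≤ √t} ν_n^s`. -/
def multiplier (c : ℝ) (η : ℝ → ℝ) (t : ℝ) (n : ℕ) (ξ : ℝ) : ℂ :=
  ∑ s ∈ Finset.range (⌊Real.sqrt t⌋₊ + 1), nu c η s n ξ

/-- The maximal function `sup_{n ≥ t} |𝓕⁻¹(Π_n^t f̂)(x)|`, with values in `[0, ∞]`. -/
def maximalFunction (c : ℝ) (η : ℝ → ℝ) (t : ℝ) (f : ℤ →₀ ℂ) (x : ℤ) : ENNReal :=
  ⨆ (n : ℕ) (_ : t ≤ (n : ℝ)), ‖invFourier (fun ξ => multiplier c η t n ξ * hat f ξ) x‖ₑ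

end

end PrimeMultiplier

/-! ### Dyadic block averages on the integers. -/

namespace PrimeMultiplier

noncomputable section

/-! Put S = ⌊√t⌋. Only fractions a/q with q < 2^(S+1) occur, and every admissible n satisfies n ≥
S², so up to a constant the averaging length 2^n beats any fixed power of the denominators. As
(S+1)² ≤ 4 max(1,t), a weak type bound with loss (S+1)² suffices.

Removing the cutoffs. The convolution kernel of η_s has mass 1 and first moment O(2^(8s)), while an
average of length 2^n with decreasing weight changes by O(2^(-n)) in ℓ¹ under a unit shift. Dropping
all cutoffs therefore costs O(2^(10S-n))‖f‖₁ at scale n, which is summable over n ≥ S²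
(`normOne_sum_cutoffError_le`, `count_exists_lt_norm_le`). What remains are two sums ∑ c_i ζ_i^x
A_n(ζ_i^(-·) f)(x) with ζ_i = e(a/q): one with the principal Gauss sums as coefficients, one with
the exceptional ones.

Coefficients. For a coprime to q one has |G(χ,a)|² ≤ cond(χ)/φ(q)². If all moduli used in a dyadic
range [2^s, 2^(s+1)) carry characters of one conductor f, they are multiples of f, and q ≤ (s+1)φ(q)
gives ∑|G|² ≤ 2(s+1) (`sum_norm_gaussSum_sq_le`). The principal characters have conductor 1. For the
exceptional characters the common conductor, and also a common zero β and hence a common weight,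
come from Landau's repulsion: characters modulo q and r in one dyadic range induce characters modulo
qr with log(qr) ≤ 3 log q, where at most one can be exceptional (`exists_exceptional_common`).
Repulsion follows from (1+χ)(1+ψ) ≥ 0 together with upper bounds for -L'/L just to the right of 1,
where each zero near 1 contributes negatively (`re_logDeriv_ge`).

The weak type bound (`exists_weak_type_bound`). Perform a Calderón–Zygmund decomposition at height α
= λ/(S+1)². Since |ζ_i^(-y) f(y)| = |f(y)|, all i share the same bad blocks, and their enlargement Ω
costs (S+1)². Off Ω only bad blocks of scale at most n are visible at scale n. Two facts then reduce
everything to ℓ² estimates for single i. One is a large sieve inequality: modulations by distinct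
roots of unity of order at most Q are nearly orthogonal on functions constant on blocks longer than
Q⁴ (`IsFareyFamily.normTwoSq_modSum_le`), and averages of length 2^n are nearly constant on blocks
of length 2^(n/2). The other is a pair of square function bounds: the averages of the bad parts, and
the differences between A_n and a multiple of the dyadic expectation E_n on the good parts, are
square summable in n.

The main term ∑ c_i ζ_i^x κ_n E_n g_i is left, κ_n being the mass of the weight. For the first
2^(2S+4) scales a Rademacher–Menshov argument loses the square of the number of dyadic levels,
O((S+1)²). For larger n the length 2^n exceeds a common period of all ζ_i; on each residue class the
sum is E_n of one function, and the dyadic maximal inequality applies without logarithmic loss. -/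

/-- The total `∑ x, F x` of a function on `ℤ`, as an extended nonnegative real. -/
def total (F : ℤ → ℝ) : ENNReal := ∑' x, ENNReal.ofReal (F x)

lemma total_mono {F G : ℤ → ℝ} (h : ∀ x, F x ≤ G x) : total F ≤ total G :=
  ENNReal.tsum_le_tsum fun x => ENNReal.ofReal_le_ofReal (h x)

lemma total_const_mul {c : ℝ} (hc : 0 ≤ c) (F : ℤ → ℝ) :
    total (fun x => c * F x) = ENNReal.ofReal c * total F := by
  simp only [total, ENNReal.ofReal_mul hc, ENNReal.tsum_mul_left]

lemma total_add {F G : ℤ → ℝ} (hF : ∀ x, 0 ≤ F x) (hG : ∀ x, 0 ≤ G x) :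
    total (fun x => F x + G x) = total F + total G := by
  simp only [total, ENNReal.ofReal_add (hF _) (hG _), ENNReal.tsum_add]

lemma total_sum {ι : Type*} (s : Finset ι) {F : ι → ℤ → ℝ} (hF : ∀ i ∈ s, ∀ x, 0 ≤ F i x) :
    total (fun x => ∑ i ∈ s, F i x) = ∑ i ∈ s, total (F i) := by
  unfold total
  rw [← Summable.tsum_finsetSum (fun i _ => ENNReal.summable)]
  congr 1 with x
  rw [ENNReal.ofReal_sum_of_nonneg fun i hi => hF i hi x]

lemma total_sub_right (F : ℤ → ℝ) (h : ℤ) : total (fun x => F (x - h)) = total F :=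
  (Equiv.subRight h).tsum_eq fun x => ENNReal.ofReal (F x)

/-- The dyadic block of length `2 ^ k` containing `x`. -/
def block (k : ℕ) (x : ℤ) : Finset ℤ :=
  Finset.Ico (2 ^ k * (x / 2 ^ k)) (2 ^ k * (x / 2 ^ k) + 2 ^ k)

lemma mem_block {k : ℕ} {x y : ℤ} : y ∈ block k x ↔ y / 2 ^ k = x / 2 ^ k := by
  have h : (0 : ℤ) < 2 ^ k := by positivity
  rw [block, Finset.mem_Ico]
  constructor
  · rintro ⟨h1, h2⟩
    refine le_antisymm ?_ ?_
    · refine Int.lt_add_one_iff.1 (Int.ediv_lt_of_lt_mul h ?_)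
      linarith
    · refine (Int.le_ediv_iff_mul_le h).2 ?_
      linarith
  · intro e
    rw [← e]
    have h1 := Int.mul_ediv_add_emod y (2 ^ k)
    have h2 := Int.emod_nonneg y h.ne'
    have h3 := Int.emod_lt_of_pos y h
    constructor <;> linarith

lemma self_mem_block (k : ℕ) (x : ℤ) : x ∈ block k x := mem_block.2 rfl

lemma card_block (k : ℕ) (x : ℤ) : (block k x).card = 2 ^ k := by
  have : (2 : ℤ) ^ k = ((2 ^ k : ℕ) : ℤ) := by push_cast; rfl
  simp only [block, Int.card_Ico, add_sub_cancel_left]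
  rw [this, Int.toNat_natCast]

lemma block_congr {k : ℕ} {x y : ℤ} (h : x / 2 ^ k = y / 2 ^ k) : block k x = block k y := by
  rw [block, block, h]

lemma block_eq_of_mem {k : ℕ} {x y : ℤ} (h : y ∈ block k x) : block k y = block k x :=
  block_congr (mem_block.1 h)

lemma block_zero (x : ℤ) : block 0 x = {x} := by
  ext y; simp [mem_block]

lemma ediv_congr_of_le {k m : ℕ} (h : k ≤ m) {x y : ℤ} (e : x / 2 ^ k = y / 2 ^ k) :
    x / 2 ^ m = y / 2 ^ m := by
  obtain ⟨j, rfl⟩ := Nat.exists_eq_add_of_le h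
  rw [pow_add, ← Int.ediv_ediv_of_nonneg (by positivity), e, Int.ediv_ediv_of_nonneg (by positivity)]

lemma block_subset_of_le {k m : ℕ} (h : k ≤ m) (x : ℤ) : block k x ⊆ block m x := fun _ hy =>
  mem_block.2 (ediv_congr_of_le h (mem_block.1 hy))

/-- Sharing a block is a symmetric relation, so each y is counted by exactly 2^k points x;
interchange the sums. -/
lemma total_block (k : ℕ) {F : ℤ → ℝ} (hF : ∀ x, 0 ≤ F x) :
    total (fun x => ∑ y ∈ block k x, F y) = ENNReal.ofReal (2 ^ k) * total F := by
  have h1 : ∀ x, ENNReal.ofReal (∑ y ∈ block k x, F y)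
      = ∑' y, if y / 2 ^ k = x / 2 ^ k then ENNReal.ofReal (F y) else 0 := by
    intro x
    rw [ENNReal.ofReal_sum_of_nonneg fun i _ => hF i, tsum_eq_sum (s := block k x)]
    · exact Finset.sum_congr rfl fun y hy => by rw [if_pos (mem_block.1 hy)]
    · intro y hy
      rw [if_neg fun h => hy (mem_block.2 h)]
  unfold total
  simp_rw [h1]
  rw [ENNReal.tsum_comm, ← ENNReal.tsum_mul_left]
  congr 1 with y
  rw [tsum_eq_sum (s := block k y)]
  · rw [Finset.sum_congr rfl fun x hx => if_pos (mem_block.1 hx).symm, Finset.sum_const, card_block,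
      nsmul_eq_mul]
    congr 1
    rw [ENNReal.ofReal_pow (by norm_num)]
    simp
  · intro x hx
    rw [if_neg fun h => hx (mem_block.2 h.symm)]

/-- The average of `u` over the dyadic block of length `2 ^ k` containing `x`. -/
def blockAvg {V : Type*} [AddCommGroup V] [Module ℝ V] (k : ℕ) (u : ℤ → V) (x : ℤ) : V :=
  ((2 : ℝ) ^ k)⁻¹ • ∑ y ∈ block k x, u y

section

variable {V : Type*} [AddCommGroup V] [Module ℝ V]

lemma blockAvg_congr {k : ℕ} (u : ℤ → V) {x y : ℤ} (h : x / 2 ^ k = y / 2 ^ k) :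
    blockAvg k u x = blockAvg k u y := by
  rw [blockAvg, blockAvg, block_congr h]

lemma sum_block_eq {k : ℕ} {u : ℤ → V} {x : ℤ} (h : ∀ y ∈ block k x, u y = u x) :
    ∑ y ∈ block k x, u y = ((2 : ℝ) ^ k) • u x := by
  rw [Finset.sum_congr rfl h, Finset.sum_const, card_block, ← Nat.cast_smul_eq_nsmul ℝ]
  norm_num

lemma blockAvg_of_const {k : ℕ} {u : ℤ → V} {x : ℤ} (h : ∀ y ∈ block k x, u y = u x) :
    blockAvg k u x = u x := by
  rw [blockAvg, sum_block_eq h, smul_smul, inv_mul_cancel₀ (by positivity), one_smul]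

/-- A long block is a disjoint union of short ones, so averaging over the short blocks first
preserves the sum: the tower property of conditional expectations. -/
lemma sum_block_blockAvg {k m : ℕ} (h : k ≤ m) (u : ℤ → V) (x : ℤ) :
    ∑ y ∈ block m x, blockAvg k u y = ∑ y ∈ block m x, u y := by
  have hsub : ∀ y ∈ block m x, block k y = (block m x).filter fun z => z / 2 ^ k = y / 2 ^ k := by
    intro y hy
    ext z
    rw [mem_block, Finset.mem_filter, mem_block]
    exact ⟨fun e => ⟨(ediv_congr_of_le h e).trans (mem_block.1 hy), e⟩, fun e => e.2⟩
  have h1 : ∀ y ∈ block m x, blockAvg k u y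
      = ∑ z ∈ block m x, if z / 2 ^ k = y / 2 ^ k then ((2 : ℝ) ^ k)⁻¹ • u z else 0 := by
    intro y hy
    rw [blockAvg, hsub y hy, Finset.sum_filter, Finset.smul_sum]
    refine Finset.sum_congr rfl fun z _ => ?_
    split_ifs <;> simp
  rw [Finset.sum_congr rfl h1, Finset.sum_comm]
  refine Finset.sum_congr rfl fun z hz => ?_
  have h2 : ∀ y, (z / 2 ^ k = y / 2 ^ k) ↔ (y / 2 ^ k = z / 2 ^ k) := fun y => eq_comm
  simp_rw [h2]
  rw [← Finset.sum_filter, ← hsub z hz, Finset.sum_const, card_block, ← Nat.cast_smul_eq_nsmul ℝ,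
    smul_smul]
  rw [Nat.cast_pow, Nat.cast_ofNat, mul_inv_cancel₀ (by positivity), one_smul]

lemma blockAvg_blockAvg_of_ge {k m : ℕ} (h : k ≤ m) (u : ℤ → V) :
    blockAvg m (blockAvg k u) = blockAvg m u := by
  ext x
  rw [blockAvg, sum_block_blockAvg h, blockAvg]

lemma blockAvg_add (k : ℕ) (u v : ℤ → V) (x : ℤ) :
    blockAvg k (fun y => u y + v y) x = blockAvg k u x + blockAvg k v x := by
  simp only [blockAvg, Finset.sum_add_distrib, smul_add]

lemma blockAvg_sub (k : ℕ) (u v : ℤ → V) (x : ℤ) :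
    blockAvg k (fun y => u y - v y) x = blockAvg k u x - blockAvg k v x := by
  simp only [blockAvg, Finset.sum_sub_distrib, smul_sub]

lemma blockAvg_sum {ι : Type*} (s : Finset ι) (k : ℕ) (u : ι → ℤ → V) (x : ℤ) :
    blockAvg k (fun y => ∑ i ∈ s, u i y) x = ∑ i ∈ s, blockAvg k (u i) x := by
  simp only [blockAvg]
  rw [Finset.sum_comm, Finset.smul_sum]

end

lemma blockAvg_mono {k : ℕ} {u v : ℤ → ℝ} {x : ℤ} (h : ∀ y ∈ block k x, u y ≤ v y) :
    blockAvg k u x ≤ blockAvg k v x := by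
  simp only [blockAvg, smul_eq_mul]
  gcongr with y hy
  exact h y hy

lemma blockAvg_nonneg {k : ℕ} {u : ℤ → ℝ} (h : ∀ y, 0 ≤ u y) (x : ℤ) : 0 ≤ blockAvg k u x := by
  simp only [blockAvg, smul_eq_mul]
  exact mul_nonneg (by positivity) (Finset.sum_nonneg fun y _ => h y)

lemma blockAvg_const_real (k : ℕ) (c : ℝ) (x : ℤ) : blockAvg k (fun _ => c) x = c :=
  blockAvg_of_const fun _ _ => rfl

lemma norm_blockAvg_le (k : ℕ) (u : ℤ → ℂ) (x : ℤ) :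
    ‖blockAvg k u x‖ ≤ blockAvg k (fun y => ‖u y‖) x := by
  simp only [blockAvg, norm_smul, smul_eq_mul]
  rw [Real.norm_of_nonneg (by positivity)]
  gcongr
  exact norm_sum_le _ _

lemma sq_blockAvg_le (k : ℕ) (u : ℤ → ℝ) (x : ℤ) :
    blockAvg k u x ^ 2 ≤ blockAvg k (fun y => u y ^ 2) x := by
  simp only [blockAvg, smul_eq_mul, mul_pow]
  have := sq_sum_le_card_mul_sum_sq (s := block k x) (f := u)
  rw [card_block] at this
  push_cast at this
  have h0 : (0 : ℝ) < 2 ^ k := by positivity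
  calc (((2 : ℝ) ^ k)⁻¹) ^ 2 * (∑ y ∈ block k x, u y) ^ 2
      ≤ (((2 : ℝ) ^ k)⁻¹) ^ 2 * (2 ^ k * ∑ y ∈ block k x, u y ^ 2) := by gcongr
    _ = _ := by field_simp

lemma total_blockAvg (k : ℕ) {F : ℤ → ℝ} (hF : ∀ x, 0 ≤ F x) :
    total (blockAvg k F) = total F := by
  have : blockAvg k F = fun x => ((2 : ℝ) ^ k)⁻¹ * ∑ y ∈ block k x, F y := by
    ext x; simp [blockAvg]
  rw [this, total_const_mul (by positivity), total_block k hF, ← mul_assoc,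
    ← ENNReal.ofReal_mul (by positivity), inv_mul_cancel₀ (by positivity)]
  simp

/-- The `ℓ¹` norm. -/
def normOne (u : ℤ → ℂ) : ENNReal := total fun x => ‖u x‖

/-- The square of the `ℓ²` norm. -/
def normTwoSq (u : ℤ → ℂ) : ENNReal := total fun x => ‖u x‖ ^ 2

/-- Pythagoras for the orthogonal projection onto functions constant on blocks. It is checked block
by block, where the cross term is the inner product of the mean `c` with the block sum. -/
lemma normTwoSq_blockAvg_add (k : ℕ) (u : ℤ → ℂ) :
    normTwoSq (fun x => u x - blockAvg k u x) + normTwoSq (blockAvg k u) = normTwoSq u := by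
  unfold normTwoSq
  rw [← total_add (fun _ => by positivity) (fun _ => by positivity),
    ← total_blockAvg k (fun _ => by positivity),
    ← total_blockAvg k (F := fun x => ‖u x‖ ^ 2) (fun _ => by positivity)]
  congr 1
  ext x
  simp only [blockAvg, smul_eq_mul]
  congr 1
  set c := blockAvg k u x with hc
  have hconst : ∀ y ∈ block k x, ((2 : ℝ) ^ k)⁻¹ • ∑ z ∈ block k y, u z = c := by
    intro y hy
    rw [block_eq_of_mem hy, hc, blockAvg]
  have hsum : ∑ y ∈ block k x, u y = ((2 : ℝ) ^ k) • c := by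
    rw [hc, blockAvg, smul_smul, mul_inv_cancel₀ (by positivity), one_smul]
  have h1 : ∀ y ∈ block k x, ‖u y - ((2 : ℝ) ^ k)⁻¹ • ∑ z ∈ block k y, u z‖ ^ 2
      + ‖((2 : ℝ) ^ k)⁻¹ • ∑ z ∈ block k y, u z‖ ^ 2
      = ‖u y‖ ^ 2 + 2 * ‖c‖ ^ 2 - 2 * (u y * (starRingEnd ℂ) c).re := by
    intro y hy
    rw [hconst y hy]
    simp only [← Complex.normSq_eq_norm_sq, Complex.normSq_sub]
    ring
  rw [Finset.sum_congr rfl h1, Finset.sum_sub_distrib, Finset.sum_add_distrib, ← Finset.mul_sum,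
    ← Finset.mul_sum, ← Complex.re_sum, ← Finset.sum_mul, hsum, Finset.sum_const, card_block]
  have : ((2 ^ k : ℝ) • c * (starRingEnd ℂ) c).re = 2 ^ k * ‖c‖ ^ 2 := by
    rw [smul_mul_assoc, Complex.mul_conj, Complex.smul_re, Complex.ofReal_re, Complex.normSq_eq_norm_sq,
      smul_eq_mul]
  rw [this]
  simp

lemma normTwoSq_blockAvg_le (k : ℕ) (u : ℤ → ℂ) : normTwoSq (blockAvg k u) ≤ normTwoSq u := by
  rw [← normTwoSq_blockAvg_add k u]
  exact le_add_self

lemma normTwoSq_blockAvg_sub_add {k m : ℕ} (h : k ≤ m) (u : ℤ → ℂ) :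
    normTwoSq (fun x => blockAvg k u x - blockAvg m u x) + normTwoSq (blockAvg m u)
      = normTwoSq (blockAvg k u) := by
  have := normTwoSq_blockAvg_add m (blockAvg k u)
  rwa [blockAvg_blockAvg_of_ge h] at this

/-- Averages over growing blocks form a reverse martingale; its increments are orthogonal and their
energies telescope. -/
lemma sum_normTwoSq_blockAvg_sub_le {n : ℕ → ℕ} (hn : Monotone n) (u : ℤ → ℂ) (J : ℕ) :
    ∑ j ∈ Finset.range J, normTwoSq (fun x => blockAvg (n j) u x - blockAvg (n (j + 1)) u x)
      ≤ normTwoSq u := by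
  have : ∑ j ∈ Finset.range J, normTwoSq (fun x => blockAvg (n j) u x - blockAvg (n (j + 1)) u x)
      + normTwoSq (blockAvg (n J) u) = normTwoSq (blockAvg (n 0) u) := by
    induction J with
    | zero => simp
    | succ J ih =>
      rw [Finset.sum_range_succ, add_assoc, normTwoSq_blockAvg_sub_add (hn (Nat.le_succ J)), ih]
  exact (le_self_add.trans this.le).trans (normTwoSq_blockAvg_le _ _)

end

end PrimeMultiplier

/-! ### One-sided averages with decreasing weights. -/

namespace PrimeMultiplier

noncomputable section

/-- The backward difference operator. -/
def backDiff (u : ℤ → ℂ) (x : ℤ) : ℂ := u x - u (x - 1)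

/-- A weight on the positive integers that is nonincreasing with values in `[0, 2]`. -/
structure IsDecreasingWeight (w : ℕ → ℝ) : Prop where
  nonneg : ∀ m, 1 ≤ m → 0 ≤ w m
  le_two : ∀ m, 1 ≤ m → w m ≤ 2
  anti : ∀ m, 1 ≤ m → w (m + 1) ≤ w m

/-- The weighted one-sided average `2⁻ⁿ ∑_{m=1}^{2ⁿ} w(m) u(x - m)`. -/
def wAvg (w : ℕ → ℝ) (n : ℕ) (u : ℤ → ℂ) (x : ℤ) : ℂ :=
  ((2 : ℝ) ^ n)⁻¹ • ∑ m ∈ Finset.Icc 1 (2 ^ n), w m • u (x - m)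

/-- The total mass `2⁻ⁿ ∑_{m=1}^{2ⁿ} w(m)`. -/
def mass (w : ℕ → ℝ) (n : ℕ) : ℝ := ((2 : ℝ) ^ n)⁻¹ * ∑ m ∈ Finset.Icc 1 (2 ^ n), w m

lemma wAvg_sum {ι : Type*} (s : Finset ι) (w : ℕ → ℝ) (n : ℕ) (u : ι → ℤ → ℂ) (x : ℤ) :
    wAvg w n (fun y => ∑ i ∈ s, u i y) x = ∑ i ∈ s, wAvg w n (u i) x := by
  simp only [wAvg, Finset.smul_sum]
  rw [Finset.sum_comm]

lemma wAvg_add (w : ℕ → ℝ) (n : ℕ) (u v : ℤ → ℂ) (x : ℤ) :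
    wAvg w n (fun y => u y + v y) x = wAvg w n u x + wAvg w n v x := by
  simp only [wAvg, smul_add, Finset.sum_add_distrib]

lemma wAvg_sub (w : ℕ → ℝ) (n : ℕ) (u v : ℤ → ℂ) (x : ℤ) :
    wAvg w n (fun y => u y - v y) x = wAvg w n u x - wAvg w n v x := by
  simp only [wAvg, smul_sub, Finset.sum_sub_distrib]

lemma wAvg_congr (w : ℕ → ℝ) (n : ℕ) {u v : ℤ → ℂ} {x : ℤ}
    (h : ∀ m ∈ Finset.Icc 1 (2 ^ n), u (x - (m : ℕ)) = v (x - (m : ℕ))) :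
    wAvg w n u x = wAvg w n v x := by
  rw [wAvg, wAvg]
  congr 1
  exact Finset.sum_congr rfl fun m hm => by rw [h m hm]

lemma mass_nonneg {w : ℕ → ℝ} (hw : IsDecreasingWeight w) (n : ℕ) : 0 ≤ mass w n :=
  mul_nonneg (by positivity) (Finset.sum_nonneg fun m hm => hw.nonneg m (Finset.mem_Icc.1 hm).1)

lemma mass_le_two {w : ℕ → ℝ} (hw : IsDecreasingWeight w) (n : ℕ) : mass w n ≤ 2 := by
  have : ∑ m ∈ Finset.Icc 1 (2 ^ n), w m ≤ ∑ m ∈ Finset.Icc 1 (2 ^ n), (2 : ℝ) :=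
    Finset.sum_le_sum fun m hm => hw.le_two m (Finset.mem_Icc.1 hm).1
  rw [Finset.sum_const, Nat.card_Icc] at this
  simp only [add_tsub_cancel_right, nsmul_eq_mul, Nat.cast_pow, Nat.cast_ofNat] at this
  calc mass w n ≤ ((2 : ℝ) ^ n)⁻¹ * (2 ^ n * 2) := by unfold mass; gcongr
    _ = 2 := by field_simp

lemma weight_anti {w : ℕ → ℝ} (hw : IsDecreasingWeight w) {m m' : ℕ} (h1 : 1 ≤ m) (h : m ≤ m') :
    w m' ≤ w m := by
  induction m', h using Nat.le_induction with
  | base => exact le_rfl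
  | succ k hk ih => exact (hw.anti k (h1.trans hk)).trans ih

/-- The second half of the longer sum is dominated termwise by the first. Monotone masses in [0, 2]
have total variation at most 2, which is needed when scales are compared. -/
lemma mass_succ_le {w : ℕ → ℝ} (hw : IsDecreasingWeight w) (n : ℕ) : mass w (n + 1) ≤ mass w n := by
  have h1 : ∑ m ∈ Finset.Icc 1 (2 ^ (n + 1)), w m
      = ∑ m ∈ Finset.Icc 1 (2 ^ n), w m + ∑ m ∈ Finset.Icc 1 (2 ^ n), w (2 ^ n + m) := by
    have e1 : ∀ N, ∀ f : ℕ → ℝ, ∑ m ∈ Finset.Icc 1 N, f m = ∑ m ∈ Finset.range N, f (m + 1) := by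
      intro N f
      rw [Finset.range_eq_Ico, Finset.sum_Ico_add' f 0 N 1]
      congr 1
    rw [e1, e1, e1, pow_succ, mul_two, Finset.sum_range_add]
    rfl
  have h2 : ∑ m ∈ Finset.Icc 1 (2 ^ n), w (2 ^ n + m) ≤ ∑ m ∈ Finset.Icc 1 (2 ^ n), w m :=
    Finset.sum_le_sum fun m hm => weight_anti hw (Finset.mem_Icc.1 hm).1 (Nat.le_add_left _ _)
  have h3 : (0 : ℝ) < 2 ^ n := by positivity
  unfold mass
  rw [h1, pow_succ]
  calc ((2 : ℝ) ^ n * 2)⁻¹ * _ ≤ ((2 : ℝ) ^ n * 2)⁻¹ * (∑ m ∈ Finset.Icc 1 (2 ^ n), w m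
        + ∑ m ∈ Finset.Icc 1 (2 ^ n), w m) := by gcongr
    _ = _ := by field_simp; ring

lemma antitone_mass {w : ℕ → ℝ} (hw : IsDecreasingWeight w) : Antitone (mass w) :=
  antitone_nat_of_succ_le (mass_succ_le hw)

/-! ### Convolution bounds -/

lemma normOne_sub_right (u : ℤ → ℂ) (h : ℤ) : normOne (fun y => u (y - h)) = normOne u :=
  total_sub_right (fun x => ‖u x‖) h

lemma normTwoSq_sub_right (u : ℤ → ℂ) (h : ℤ) : normTwoSq (fun y => u (y - h)) = normTwoSq u :=
  total_sub_right (fun x => ‖u x‖ ^ 2) h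

lemma normOne_conv_le (s : Finset ℕ) (k : ℕ → ℝ) (u : ℤ → ℂ) :
    normOne (fun x => ∑ m ∈ s, k m • u (x - m))
      ≤ ENNReal.ofReal (∑ m ∈ s, |k m|) * normOne u := by
  calc normOne (fun x => ∑ m ∈ s, k m • u (x - m))
      ≤ total (fun x => ∑ m ∈ s, |k m| * ‖u (x - m)‖) := by
        refine total_mono fun x => (norm_sum_le _ _).trans (le_of_eq ?_)
        exact Finset.sum_congr rfl fun m _ => by rw [norm_smul, Real.norm_eq_abs]
    _ = ∑ m ∈ s, ENNReal.ofReal |k m| * normOne u := by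
        rw [total_sum s fun m _ x => by positivity]
        refine Finset.sum_congr rfl fun m _ => ?_
        rw [total_const_mul (abs_nonneg _), total_sub_right (fun x => ‖u x‖)]
        rfl
    _ = _ := by
        rw [← Finset.sum_mul, ENNReal.ofReal_sum_of_nonneg fun _ _ => abs_nonneg _]

lemma normTwoSq_conv_le (s : Finset ℕ) (k : ℕ → ℝ) (u : ℤ → ℂ) :
    normTwoSq (fun x => ∑ m ∈ s, k m • u (x - m))
      ≤ ENNReal.ofReal ((∑ m ∈ s, |k m|) ^ 2) * normTwoSq u := by
  have h0 : 0 ≤ ∑ m ∈ s, |k m| := Finset.sum_nonneg fun _ _ => abs_nonneg _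
  calc normTwoSq (fun x => ∑ m ∈ s, k m • u (x - m))
      ≤ total (fun x => (∑ m ∈ s, |k m|) * ∑ m ∈ s, |k m| * ‖u (x - m)‖ ^ 2) := by
        refine total_mono fun x => ?_
        have h1 : ‖∑ m ∈ s, k m • u (x - m)‖ ≤ ∑ m ∈ s, |k m| * ‖u (x - m)‖ := by
          refine (norm_sum_le _ _).trans (le_of_eq ?_)
          exact Finset.sum_congr rfl fun m _ => by rw [norm_smul, Real.norm_eq_abs]
        calc _ ≤ (∑ m ∈ s, |k m| * ‖u (x - m)‖) ^ 2 := by gcongr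
          _ ≤ _ := Finset.sum_sq_le_sum_mul_sum_of_sq_le_mul _ (fun _ _ => abs_nonneg _)
              (fun _ _ => by positivity) (fun _ _ => le_of_eq (by ring))
    _ = ENNReal.ofReal (∑ m ∈ s, |k m|) * ∑ m ∈ s, ENNReal.ofReal |k m| * normTwoSq u := by
        rw [total_const_mul h0, total_sum s fun m _ x => by positivity]
        congr 1
        refine Finset.sum_congr rfl fun m _ => ?_
        rw [total_const_mul (abs_nonneg _), total_sub_right (fun x => ‖u x‖ ^ 2)]
        rfl
    _ = _ := by
        rw [← Finset.sum_mul, ← ENNReal.ofReal_sum_of_nonneg fun _ _ => abs_nonneg _, ← mul_assoc,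
          ← ENNReal.ofReal_mul h0, sq]

/-- The kernel of `wAvg`, as a function on `ℕ`. -/
def wKernel (w : ℕ → ℝ) (n m : ℕ) : ℝ := if 1 ≤ m ∧ m ≤ 2 ^ n then ((2 : ℝ) ^ n)⁻¹ * w m else 0

lemma wAvg_eq_conv (w : ℕ → ℝ) (n : ℕ) (u : ℤ → ℂ) (x : ℤ) :
    wAvg w n u x = ∑ m ∈ Finset.range (2 ^ n + 2), wKernel w n m • u (x - m) := by
  rw [wAvg, Finset.smul_sum]
  have hsub : Finset.Icc 1 (2 ^ n) ⊆ Finset.range (2 ^ n + 2) := by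
    intro m hm
    rw [Finset.mem_Icc] at hm
    rw [Finset.mem_range]; omega
  rw [← Finset.sum_subset hsub]
  · refine Finset.sum_congr rfl fun m hm => ?_
    rw [wKernel, if_pos (Finset.mem_Icc.1 hm), smul_smul]
  · intro m _ hm
    rw [wKernel, if_neg fun h => hm (Finset.mem_Icc.2 h), zero_smul]

/-- The kernel jumps up from 0 and then descends to 0, so its variation is twice its first value,
which is at most 2·2^(-n). -/
lemma sum_abs_wKernel_sub_le {w : ℕ → ℝ} (hw : IsDecreasingWeight w) (n : ℕ) :
    ∑ m ∈ Finset.range (2 ^ n + 1), |wKernel w n (m + 1) - wKernel w n m|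
      ≤ 4 * ((2 : ℝ) ^ n)⁻¹ := by
  have hpos : (0 : ℝ) < (2 ^ n)⁻¹ := by positivity
  obtain ⟨N, hN⟩ : ∃ N, 2 ^ n = N + 1 := Nat.exists_eq_add_one.2 (by positivity)
  have h1 : ∀ m ∈ Finset.range N, |wKernel w n (m + 1 + 1) - wKernel w n (m + 1)|
      = wKernel w n (m + 1) - wKernel w n (m + 1 + 1) := by
    intro m hm
    rw [Finset.mem_range] at hm
    rw [abs_sub_comm, abs_of_nonneg]
    rw [wKernel, wKernel, if_pos (by omega), if_pos (by omega)]
    nlinarith [hw.anti (m + 1) (by omega)]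
  have e0 : wKernel w n 0 = 0 := by rw [wKernel, if_neg (by omega)]
  have eN : wKernel w n (N + 1 + 1) = 0 := by rw [wKernel, if_neg (by omega)]
  have n1 : 0 ≤ wKernel w n (0 + 1) ∧ wKernel w n (0 + 1) ≤ 2 * (2 ^ n)⁻¹ := by
    rw [wKernel, if_pos (by omega)]
    constructor
    · nlinarith [hw.nonneg 1 le_rfl]
    · nlinarith [hw.le_two 1 le_rfl]
  have n2 : 0 ≤ wKernel w n (N + 1) := by
    rw [wKernel, if_pos (by omega)]
    nlinarith [hw.nonneg (N + 1) (by omega)]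
  have h2 := Finset.sum_range_sub' (fun m => wKernel w n (m + 1)) N
  rw [hN, Finset.sum_range_succ', Finset.sum_range_succ, Finset.sum_congr rfl h1, h2, e0, eN,
    sub_zero, zero_sub, abs_neg, abs_of_nonneg n2, abs_of_nonneg n1.1]
  linarith [n1.2]

/-- Summation by parts: the difference moves to the kernel, whose values at 0 and 2^n + 1 vanish, so
there are no boundary terms. -/
lemma backDiff_wAvg (w : ℕ → ℝ) (n : ℕ) (u : ℤ → ℂ) (x : ℤ) :
    backDiff (wAvg w n u) x
      = ∑ m ∈ Finset.range (2 ^ n + 1), (wKernel w n (m + 1) - wKernel w n m) • u (x - m - 1) := by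
  rw [backDiff, wAvg_eq_conv, wAvg_eq_conv, Finset.sum_range_succ', Finset.sum_range_succ _ (2 ^ n + 1)]
  have e0 : wKernel w n 0 = 0 := by rw [wKernel, if_neg (by omega)]
  have e1 : wKernel w n (2 ^ n + 1) = 0 := by rw [wKernel, if_neg (by omega)]
  rw [e0, e1, zero_smul, zero_smul, add_zero, add_zero, ← Finset.sum_sub_distrib]
  refine Finset.sum_congr rfl fun m _ => ?_
  rw [sub_smul]
  congr 2
  · congr 1; push_cast; ring
  · congr 1; ring

lemma normOne_backDiff_wAvg_le {w : ℕ → ℝ} (hw : IsDecreasingWeight w) (n : ℕ) (u : ℤ → ℂ) :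
    normOne (backDiff (wAvg w n u)) ≤ ENNReal.ofReal (4 * ((2 : ℝ) ^ n)⁻¹) * normOne u := by
  have h : backDiff (wAvg w n u) = fun x => ∑ m ∈ Finset.range (2 ^ n + 1),
      (wKernel w n (m + 1) - wKernel w n m) • (fun y => u (y - 1)) (x - m) :=
    funext fun x => backDiff_wAvg w n u x
  have h2 := normOne_conv_le (Finset.range (2 ^ n + 1))
    (fun m => wKernel w n (m + 1) - wKernel w n m) (fun y => u (y - 1))
  rw [← h, normOne_sub_right] at h2
  refine h2.trans (mul_le_mul_left (ENNReal.ofReal_le_ofReal ?_) _)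
  exact sum_abs_wKernel_sub_le hw n

lemma normTwoSq_backDiff_wAvg_le {w : ℕ → ℝ} (hw : IsDecreasingWeight w) (n : ℕ) (u : ℤ → ℂ) :
    normTwoSq (backDiff (wAvg w n u))
      ≤ ENNReal.ofReal ((4 * ((2 : ℝ) ^ n)⁻¹) ^ 2) * normTwoSq u := by
  have h : backDiff (wAvg w n u) = fun x => ∑ m ∈ Finset.range (2 ^ n + 1),
      (wKernel w n (m + 1) - wKernel w n m) • (fun y => u (y - 1)) (x - m) :=
    funext fun x => backDiff_wAvg w n u x
  have h2 := normTwoSq_conv_le (Finset.range (2 ^ n + 1))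
    (fun m => wKernel w n (m + 1) - wKernel w n m) (fun y => u (y - 1))
  rw [← h, normTwoSq_sub_right] at h2
  refine h2.trans (mul_le_mul_left (ENNReal.ofReal_le_ofReal ?_) _)
  have := sum_abs_wKernel_sub_le hw n
  gcongr

/-! ### Nearly constant functions -/

lemma norm_sub_le_sum_backDiff (H : ℤ → ℂ) {l : ℕ} {x y : ℤ} (hy : y ∈ block l x) :
    ‖H x - H y‖ ≤ ∑ z ∈ block l x, ‖backDiff H z‖ := by
  have key : ∀ a b : ℤ, a ≤ b → a ∈ block l x → b ∈ block l x →
      ‖H b - H a‖ ≤ ∑ z ∈ block l x, ‖backDiff H z‖ := by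
    intro a b hab ha hb
    have h1 : H b - H a = ∑ z ∈ Finset.Ioc a b, backDiff H z := by
      clear ha hb
      obtain ⟨j, rfl⟩ := Int.le.dest hab
      induction j with
      | zero => simp
      | succ j ih =>
        have : Finset.Ioc a (a + (j + 1 : ℕ)) = insert (a + (j + 1 : ℕ)) (Finset.Ioc a (a + j)) := by
          ext z; simp only [Finset.mem_Ioc, Finset.mem_insert]; push_cast; omega
        rw [this, Finset.sum_insert (by simp), ← ih (by omega), backDiff]
        rw [show a + ((j + 1 : ℕ) : ℤ) - 1 = a + j by push_cast; ring]
        ring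
    rw [h1]
    refine (norm_sum_le _ _).trans (Finset.sum_le_sum_of_subset_of_nonneg ?_ fun _ _ _ => norm_nonneg _)
    intro z hz
    rw [block, Finset.mem_Ico] at *
    rw [Finset.mem_Ioc] at hz
    omega
  rcases le_total y x with h | h
  · exact key y x h hy (self_mem_block l x)
  · rw [norm_sub_rev]
    exact key x y h (self_mem_block l x) hy

/-- Two values in one block differ by a telescoping sum of differences inside the block, and so does
a value from the mean. -/
lemma norm_sub_blockAvg_le (H : ℤ → ℂ) (l : ℕ) (x : ℤ) :
    ‖H x - blockAvg l H x‖ ≤ ∑ z ∈ block l x, ‖backDiff H z‖ := by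
  have h1 : H x - blockAvg l H x = blockAvg l (fun y => H x - H y) x := by
    rw [blockAvg_sub, blockAvg_of_const (u := fun _ => H x) fun _ _ => rfl]
  rw [h1]
  refine (norm_blockAvg_le _ _ _).trans ?_
  refine (blockAvg_mono fun y hy => norm_sub_le_sum_backDiff H hy).trans ?_
  rw [blockAvg_const_real]

lemma normOne_sub_blockAvg_le (H : ℤ → ℂ) (l : ℕ) :
    normOne (fun x => H x - blockAvg l H x) ≤ ENNReal.ofReal (2 ^ l) * normOne (backDiff H) := by
  rw [normOne, normOne, ← total_block l fun _ => norm_nonneg _]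
  exact total_mono fun x => norm_sub_blockAvg_le H l x

lemma normTwoSq_le_of_block {v u : ℤ → ℂ} {l : ℕ}
    (h : ∀ x, ‖v x‖ ≤ ∑ z ∈ block l x, ‖u z‖) :
    normTwoSq v ≤ ENNReal.ofReal ((2 ^ l) ^ 2) * normTwoSq u := by
  have h0 : (0 : ℝ) ≤ 2 ^ l := by positivity
  rw [normTwoSq, normTwoSq, sq, ENNReal.ofReal_mul h0, mul_assoc,
    ← total_block l (F := fun x => ‖u x‖ ^ 2) fun _ => by positivity, ← total_const_mul h0]
  refine total_mono fun x => ?_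
  calc ‖v x‖ ^ 2 ≤ (∑ z ∈ block l x, ‖u z‖) ^ 2 := by gcongr; exact h x
    _ ≤ _ := by
      have := sq_sum_le_card_mul_sum_sq (s := block l x) (f := fun z => ‖u z‖)
      rw [card_block] at this
      exact_mod_cast this

lemma normTwoSq_sub_blockAvg_le (H : ℤ → ℂ) (l : ℕ) :
    normTwoSq (fun x => H x - blockAvg l H x)
      ≤ ENNReal.ofReal ((2 ^ l) ^ 2) * normTwoSq (backDiff H) :=
  normTwoSq_le_of_block fun x => norm_sub_blockAvg_le H l x

/-! ### Cancellation -/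

/-- The partial sums of `d` inside the dyadic blocks of length `2 ^ k`. -/
def blockPrefix (k : ℕ) (d : ℤ → ℂ) (x : ℤ) : ℂ :=
  ∑ y ∈ (block k x).filter (· ≤ x), d y

lemma norm_blockPrefix_le (k : ℕ) (d : ℤ → ℂ) (x : ℤ) :
    ‖blockPrefix k d x‖ ≤ ∑ y ∈ block k x, ‖d y‖ :=
  (norm_sum_le _ _).trans
    (Finset.sum_le_sum_of_subset_of_nonneg (Finset.filter_subset _ _) fun _ _ _ => norm_nonneg _)

/-- A zero block sum makes the partial sums return to 0 at the end of every block, so restarting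
them in the next block creates no jump. A function with cancellation is thus a difference of a
function of controlled size. -/
lemma backDiff_blockPrefix {k : ℕ} {d : ℤ → ℂ} (hd : ∀ x, blockAvg k d x = 0) :
    backDiff (blockPrefix k d) = d := by
  ext x
  have hs : ∀ x, ∑ y ∈ block k x, d y = 0 := by
    intro x
    have := hd x
    rw [blockAvg, smul_eq_zero] at this
    exact this.resolve_left (by positivity)
  rw [backDiff, blockPrefix, blockPrefix]
  by_cases h : x - 1 ∈ block k x
  · rw [block_eq_of_mem h]
    have : (block k x).filter (· ≤ x) = insert x ((block k x).filter (· ≤ x - 1)) := by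
      ext z
      simp only [Finset.mem_filter, Finset.mem_insert]
      constructor
      · rintro ⟨h1, h2⟩
        rcases h2.eq_or_lt with e | e
        · exact Or.inl e
        · exact Or.inr ⟨h1, by omega⟩
      · rintro (rfl | ⟨h1, h2⟩)
        · exact ⟨self_mem_block k z, le_rfl⟩
        · exact ⟨h1, by omega⟩
    rw [this, Finset.sum_insert (by simp)]
    ring
  · have hx : x = 2 ^ k * (x / 2 ^ k) := by
      have := self_mem_block k x
      simp only [block, Finset.mem_Ico] at h this
      omega
    have e1 : (block k x).filter (· ≤ x) = {x} := by
      ext z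
      simp only [Finset.mem_filter, Finset.mem_singleton]
      constructor
      · rintro ⟨h1, h2⟩
        simp only [block, Finset.mem_Ico] at h1
        omega
      · rintro rfl
        exact ⟨self_mem_block k z, le_rfl⟩
    have e2 : (block k (x - 1)).filter (· ≤ x - 1) = block k (x - 1) := by
      refine Finset.filter_true_of_mem fun z hz => ?_
      by_contra hlt
      apply h
      have hm : x ∈ block k (x - 1) := by
        have := self_mem_block k (x - 1)
        simp only [block, Finset.mem_Ico] at hz this ⊢
        omega
      rw [block_eq_of_mem hm]
      exact self_mem_block k _
    rw [e1, e2, hs, Finset.sum_singleton, sub_zero]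

lemma wAvg_backDiff (w : ℕ → ℝ) (n : ℕ) (D : ℤ → ℂ) :
    wAvg w n (backDiff D) = backDiff (wAvg w n D) := by
  ext x
  have h1 : backDiff D = fun y => D y - D (y - 1) := rfl
  rw [h1, wAvg_sub, backDiff]
  congr 1
  simp only [wAvg]
  congr 1
  refine Finset.sum_congr rfl fun m _ => ?_
  congr 2
  ring

/-- Write d as the difference of its block partial sums and let the kernel absorb the difference:
the primitive costs 2^k and the smoothness of the kernel gains 2^(-n). -/
lemma normOne_wAvg_of_blockAvg_eq_zero {w : ℕ → ℝ} (hw : IsDecreasingWeight w) (n : ℕ) {k : ℕ}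
    {d : ℤ → ℂ} (hd : ∀ x, blockAvg k d x = 0) :
    normOne (wAvg w n d) ≤ ENNReal.ofReal (4 * ((2 : ℝ) ^ n)⁻¹ * 2 ^ k) * normOne d := by
  conv_lhs => rw [← backDiff_blockPrefix hd, wAvg_backDiff]
  refine (normOne_backDiff_wAvg_le hw n _).trans ?_
  rw [ENNReal.ofReal_mul (p := 4 * ((2 : ℝ) ^ n)⁻¹) (by positivity), mul_assoc]
  refine mul_le_mul_right ?_ _
  rw [normOne, normOne, ← total_block k fun _ => norm_nonneg _]
  exact total_mono fun x => norm_blockPrefix_le k d x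

lemma normTwoSq_wAvg_of_blockAvg_eq_zero {w : ℕ → ℝ} (hw : IsDecreasingWeight w) (n : ℕ) {k : ℕ}
    {d : ℤ → ℂ} (hd : ∀ x, blockAvg k d x = 0) :
    normTwoSq (wAvg w n d) ≤ ENNReal.ofReal ((4 * ((2 : ℝ) ^ n)⁻¹ * 2 ^ k) ^ 2) * normTwoSq d := by
  conv_lhs => rw [← backDiff_blockPrefix hd, wAvg_backDiff]
  refine (normTwoSq_backDiff_wAvg_le hw n _).trans ?_
  rw [mul_pow (4 * ((2 : ℝ) ^ n)⁻¹), ENNReal.ofReal_mul (p := (4 * ((2 : ℝ) ^ n)⁻¹) ^ 2)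
    (by positivity), mul_assoc]
  refine mul_le_mul_right ?_ _
  exact normTwoSq_le_of_block fun x => norm_blockPrefix_le k d x

/-! ### Pointwise bound and functions constant on large blocks -/

/-- The points x - m with 1 ≤ m ≤ 2^n lie in the block of x or in its left neighbour. -/
lemma norm_wAvg_le {w : ℕ → ℝ} (hw : IsDecreasingWeight w) (n : ℕ) (u : ℤ → ℂ) (x : ℤ) :
    ‖wAvg w n u x‖ ≤ 2 * (blockAvg n (fun y => ‖u y‖) x + blockAvg n (fun y => ‖u y‖) (x - 2 ^ n)) := by
  have h1 : ‖∑ m ∈ Finset.Icc 1 (2 ^ n), w m • u (x - m)‖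
      ≤ 2 * ∑ m ∈ Finset.Icc 1 (2 ^ n), ‖u (x - (m : ℕ))‖ := by
    rw [Finset.mul_sum]
    refine (norm_sum_le _ _).trans (Finset.sum_le_sum fun m hm => ?_)
    have hm := (Finset.mem_Icc.1 hm).1
    rw [norm_smul, Real.norm_of_nonneg (hw.nonneg m hm)]
    gcongr
    exact hw.le_two m hm
  have h2 : ∑ m ∈ Finset.Icc 1 (2 ^ n), ‖u (x - (m : ℕ))‖
      ≤ ∑ y ∈ block n x ∪ block n (x - 2 ^ n), ‖u y‖ := by
    rw [← Finset.sum_image (f := fun y => ‖u y‖) (g := fun m : ℕ => x - (m : ℤ))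
      (by intro a _ b _ h; simpa using h)]
    refine Finset.sum_le_sum_of_subset_of_nonneg ?_ fun _ _ _ => norm_nonneg _
    intro y hy
    obtain ⟨m, hm, rfl⟩ := Finset.mem_image.1 hy
    rw [Finset.mem_Icc] at hm
    have hm2 : (m : ℤ) ≤ 2 ^ n := by exact_mod_cast hm.2
    have e : (x - 2 ^ n) / 2 ^ n = x / 2 ^ n - 1 := by
      rw [Int.sub_ediv_of_dvd _ dvd_rfl, Int.ediv_self (by positivity)]
    have := self_mem_block n x
    simp only [Finset.mem_union, block, Finset.mem_Ico, e, mul_sub] at this ⊢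
    omega
  have h3 : ∑ y ∈ block n x ∪ block n (x - 2 ^ n), ‖u y‖
      ≤ ∑ y ∈ block n x, ‖u y‖ + ∑ y ∈ block n (x - 2 ^ n), ‖u y‖ := by
    rw [← Finset.sum_union_inter]
    exact le_add_of_nonneg_right (Finset.sum_nonneg fun _ _ => norm_nonneg _)
  simp only [wAvg, blockAvg, norm_smul, smul_eq_mul]
  rw [Real.norm_of_nonneg (by positivity)]
  calc ((2 : ℝ) ^ n)⁻¹ * ‖∑ m ∈ Finset.Icc 1 (2 ^ n), w m • u (x - m)‖
      ≤ ((2 : ℝ) ^ n)⁻¹ * (2 * (∑ y ∈ block n x, ‖u y‖ + ∑ y ∈ block n (x - 2 ^ n), ‖u y‖)) := by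
        gcongr; exact h1.trans (by gcongr; exact h2.trans h3)
    _ = _ := by ring

lemma card_block_filter_emod {n k : ℕ} (h : n ≤ k) (x : ℤ) :
    ((block k x).filter fun y => y % 2 ^ k < 2 ^ n).card = 2 ^ n := by
  have : (block k x).filter (fun y => y % 2 ^ k < 2 ^ n)
      = Finset.Ico (2 ^ k * (x / 2 ^ k)) (2 ^ k * (x / 2 ^ k) + 2 ^ n) := by
    have hnk : (2 : ℤ) ^ n ≤ 2 ^ k := pow_le_pow_right₀ (by norm_num) h
    ext y
    rw [Finset.mem_filter, Finset.mem_Ico]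
    constructor
    · rintro ⟨h1, h2⟩
      have := Int.mul_ediv_add_emod y (2 ^ k)
      have h4 := Int.emod_nonneg y (b := 2 ^ k) (by positivity)
      rw [mem_block.1 h1] at this
      omega
    · intro h1
      have hy : y ∈ block k x := by rw [block, Finset.mem_Ico]; omega
      have := Int.mul_ediv_add_emod y (2 ^ k)
      rw [mem_block.1 hy] at this
      exact ⟨hy, by omega⟩
  rw [this, Int.card_Ico, add_sub_cancel_left]
  have : (2 : ℤ) ^ n = ((2 ^ n : ℕ) : ℤ) := by push_cast; rfl
  rw [this, Int.toNat_natCast]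

lemma total_filter_emod {n k : ℕ} (h : n ≤ k) {F : ℤ → ℝ} (hF : ∀ x, 0 ≤ F x)
    (hc : ∀ x y, x / 2 ^ k = y / 2 ^ k → F x = F y) :
    total (fun x => if x % 2 ^ k < 2 ^ n then F x else 0)
      = ENNReal.ofReal (2 ^ n * ((2 : ℝ) ^ k)⁻¹) * total F := by
  rw [← total_blockAvg k fun x => by split_ifs; exacts [hF x, le_rfl],
    ← total_const_mul (by positivity)]
  congr 1
  ext x
  simp only [blockAvg, smul_eq_mul]
  rw [← Finset.sum_filter, Finset.sum_congr rfl fun y hy =>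
    hc y x (mem_block.1 (Finset.mem_filter.1 hy).1), Finset.sum_const, card_block_filter_emod h]
  simp
  ring

/-- On a function constant on longer blocks the average acts as multiplication by the mass, except
where it reaches into the previous block. That happens only for the first 2^n points of a block, a
proportion 2^(n-k). -/
lemma normTwoSq_wAvg_sub_mass_le {w : ℕ → ℝ} (hw : IsDecreasingWeight w) {n k : ℕ} (h : n ≤ k)
    {d : ℤ → ℂ} (hd : ∀ x y, x / 2 ^ k = y / 2 ^ k → d x = d y) :
    normTwoSq (fun x => wAvg w n d x - mass w n • d x)
      ≤ ENNReal.ofReal (16 * (2 ^ n * ((2 : ℝ) ^ k)⁻¹)) * normTwoSq d := by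
  have hnk : (2 : ℤ) ^ n ≤ 2 ^ k := pow_le_pow_right₀ (by norm_num) h
  have hk : (0 : ℤ) < 2 ^ k := by positivity
  have e : ∀ x : ℤ, (x - 2 ^ k) / 2 ^ k = x / 2 ^ k - 1 := fun x => by
    rw [Int.sub_ediv_of_dvd _ dvd_rfl, Int.ediv_self (by positivity)]
  have hval : ∀ x : ℤ, ∀ m ∈ Finset.Icc 1 (2 ^ n), d (x - (m : ℕ)) = d x ∨
      (x % 2 ^ k < 2 ^ n ∧ d (x - (m : ℕ)) = d (x - 2 ^ k)) := by
    intro x m hm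
    rw [Finset.mem_Icc] at hm
    have hm2 : (m : ℤ) ≤ 2 ^ n := by exact_mod_cast hm.2
    have hx := Int.mul_ediv_add_emod x (2 ^ k)
    have hx0 := Int.emod_nonneg x hk.ne'
    have hx1 := Int.emod_lt_of_pos x hk
    by_cases hlt : (m : ℤ) ≤ x % 2 ^ k
    · left
      apply hd
      apply mem_block.1
      rw [block, Finset.mem_Ico]
      omega
    · right
      refine ⟨by omega, hd _ _ (mem_block.1 ?_)⟩
      rw [block, Finset.mem_Ico, e, mul_sub]
      omega
  have hdiff : ∀ x, wAvg w n d x - mass w n • d x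
      = ((2 : ℝ) ^ n)⁻¹ • ∑ m ∈ Finset.Icc 1 (2 ^ n), w m • (d (x - (m : ℕ)) - d x) := by
    intro x
    simp only [wAvg, mass, smul_sub, Finset.sum_sub_distrib]
    rw [← Finset.sum_smul, smul_smul]
  have hpt : ∀ x, ‖wAvg w n d x - mass w n • d x‖ ^ 2
      ≤ 8 * (if x % 2 ^ k < 2 ^ n then ‖d x‖ ^ 2 + ‖d (x - 2 ^ k)‖ ^ 2 else 0) := by
    intro x
    split_ifs with hx
    · have h1 : ‖wAvg w n d x - mass w n • d x‖ ≤ 2 * (‖d x‖ + ‖d (x - 2 ^ k)‖) := by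
        rw [hdiff, norm_smul, Real.norm_of_nonneg (by positivity)]
        calc _ ≤ ((2 : ℝ) ^ n)⁻¹ * ∑ m ∈ Finset.Icc 1 (2 ^ n), w m * (‖d x‖ + ‖d (x - 2 ^ k)‖) := by
              gcongr
              refine (norm_sum_le _ _).trans (Finset.sum_le_sum fun m hm => ?_)
              have hm1 := (Finset.mem_Icc.1 hm).1
              rw [norm_smul, Real.norm_of_nonneg (hw.nonneg m hm1)]
              refine mul_le_mul_of_nonneg_left ?_ (hw.nonneg m hm1)
              rcases hval x m hm with e1 | ⟨_, e1⟩
              · rw [e1, sub_self, norm_zero]; positivity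
              · rw [e1, add_comm]; exact norm_sub_le _ _
          _ = mass w n * (‖d x‖ + ‖d (x - 2 ^ k)‖) := by
              rw [mass, ← Finset.sum_mul, mul_assoc]
          _ ≤ _ := by gcongr; exact mass_le_two hw n
      have h2 := norm_nonneg (wAvg w n d x - mass w n • d x)
      nlinarith [sq_nonneg (‖d x‖ - ‖d (x - 2 ^ k)‖)]
    · have : wAvg w n d x - mass w n • d x = 0 := by
        rw [hdiff, Finset.sum_eq_zero, smul_zero]
        intro m hm
        rcases hval x m hm with e1 | ⟨e1, _⟩
        · rw [e1, sub_self, smul_zero]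
        · exact absurd e1 hx
      rw [this]; simp
  refine (total_mono hpt).trans ?_
  rw [total_const_mul (by norm_num), total_filter_emod h (fun _ => by positivity),
    total_add (fun _ => by positivity) (fun _ => by positivity),
    total_sub_right (fun x => ‖d x‖ ^ 2) (2 ^ k), ← two_mul, ← mul_assoc, ← mul_assoc,
    ← ENNReal.ofReal_mul (by norm_num)]
  refine le_of_eq ?_
  rw [normTwoSq]
  congr 1
  rw [show (2 : ENNReal) = ENNReal.ofReal 2 by simp, ← ENNReal.ofReal_mul (by positivity)]
  congr 1; ring
  · intro x y hxy
    rw [hd x y hxy, hd (x - 2 ^ k) (y - 2 ^ k) (by rw [e, e, hxy])]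

end

end PrimeMultiplier

/-! ### Dyadic maximal inequality and almost orthogonality of modulations. -/

namespace PrimeMultiplier

noncomputable section

open MeasureTheory

/-! ### Counting -/

lemma normTwoSq_add_le (u v : ℤ → ℂ) :
    normTwoSq (fun x => u x + v x) ≤ 2 * (normTwoSq u + normTwoSq v) := by
  rw [normTwoSq, normTwoSq, normTwoSq, ← total_add (fun _ => by positivity) (fun _ => by positivity),
    show (2 : ENNReal) = ENNReal.ofReal 2 by simp, ← total_const_mul (by norm_num)]
  refine total_mono fun x => ?_
  have h1 := norm_add_le (u x) (v x)
  have h2 := norm_nonneg (u x + v x)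
  nlinarith [sq_nonneg (‖u x‖ - ‖v x‖)]

lemma normTwoSq_sum_le {ι : Type*} (s : Finset ι) (u : ι → ℤ → ℂ) :
    normTwoSq (fun x => ∑ i ∈ s, u i x) ≤ s.card * ∑ i ∈ s, normTwoSq (u i) := by
  simp only [normTwoSq]
  rw [← total_sum s fun i _ x => by positivity, ← ENNReal.ofReal_natCast,
    ← total_const_mul (by positivity)]
  refine total_mono fun x => ?_
  calc ‖∑ i ∈ s, u i x‖ ^ 2 ≤ (∑ i ∈ s, ‖u i x‖) ^ 2 := by gcongr; exact norm_sum_le _ _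
    _ ≤ _ := sq_sum_le_card_mul_sum_sq

lemma normTwoSq_const_mul (c : ℂ) (u : ℤ → ℂ) :
    normTwoSq (fun x => c * u x) = ENNReal.ofReal (‖c‖ ^ 2) * normTwoSq u := by
  simp only [normTwoSq, norm_mul, mul_pow]
  exact total_const_mul (by positivity) _

lemma normTwoSq_congr_norm {u v : ℤ → ℂ} (h : ∀ x, ‖u x‖ = ‖v x‖) : normTwoSq u = normTwoSq v := by
  simp only [normTwoSq, h]

lemma count_le_total {D : Set ℤ} {F : ℤ → ℝ} {a : ℝ} (h : ∀ x ∈ D, a ≤ F x) :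
    ENNReal.ofReal a * Measure.count D ≤ total F := by
  classical
  have hD : MeasurableSet D := D.to_countable.measurableSet
  rw [total, ← lintegral_count]
  calc ENNReal.ofReal a * Measure.count D = ∫⁻ x in D, ENNReal.ofReal a ∂Measure.count := by simp
    _ ≤ ∫⁻ x in D, ENNReal.ofReal (F x) ∂Measure.count :=
        setLIntegral_mono (by fun_prop) fun x hx => ENNReal.ofReal_le_ofReal (h x hx)
    _ ≤ _ := setLIntegral_le_lintegral _ _

open Classical in
lemma count_eq_total (D : Set ℤ) : Measure.count D = total (fun x => if x ∈ D then 1 else 0) := by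
  have hD : MeasurableSet D := D.to_countable.measurableSet
  rw [total, ← lintegral_count, ← lintegral_indicator_one hD]
  congr 1
  ext x
  by_cases hx : x ∈ D <;> simp [hx]

/-! ### The dyadic maximal inequality -/

/-- The union of the dyadic blocks on which the average of `u` exceeds `α` and of their right
neighbours. -/
def exceptionalSet (α : ℝ) (u : ℤ → ℝ) : Set ℤ :=
  {x | ∃ k, α < blockAvg k u x ∨ α < blockAvg k u (x - 2 ^ k)}

lemma blockAvg_le_total {u : ℤ → ℝ} (hu : ∀ x, 0 ≤ u x) (k : ℕ) (x : ℤ) :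
    ENNReal.ofReal (blockAvg k u x) ≤ ENNReal.ofReal ((2 : ℝ) ^ k)⁻¹ * total u := by
  simp only [blockAvg, smul_eq_mul]
  rw [ENNReal.ofReal_mul (by positivity), ENNReal.ofReal_sum_of_nonneg fun _ _ => hu _]
  gcongr
  exact ENNReal.sum_le_tsum _

/-- A block average is at most 2^(-k) times the total mass. Hence bad blocks have bounded length,
and maximal ones exist. -/
lemma exists_blockAvg_le {u : ℤ → ℝ} (hu : ∀ x, 0 ≤ u x) (hfin : total u ≠ ⊤) {α : ℝ} (hα : 0 < α) :
    ∃ K, ∀ k ≥ K, ∀ x, blockAvg k u x ≤ α := by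
  obtain ⟨K, hK⟩ := pow_unbounded_of_one_lt ((total u).toReal / α) (by norm_num : (1 : ℝ) < 2)
  refine ⟨K, fun k hk x => ?_⟩
  have h1 := blockAvg_le_total hu k x
  rw [← ENNReal.ofReal_toReal hfin, ← ENNReal.ofReal_mul (by positivity)] at h1
  rw [ENNReal.ofReal_le_ofReal_iff (by positivity)] at h1
  have h2 : (2 : ℝ) ^ K ≤ 2 ^ k := pow_le_pow_right₀ (by norm_num) hk
  have h3 : (total u).toReal < 2 ^ k * α := by
    rw [div_lt_iff₀ hα] at hK
    nlinarith
  refine h1.trans ?_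
  rw [inv_mul_le_iff₀ (by positivity)]
  exact h3.le

open Classical in
/-- The indicator of the maximal dyadic blocks of length `2 ^ k` on which the average of `u`
exceeds `α`. -/
def maxBad (α : ℝ) (u : ℤ → ℝ) (k : ℕ) (x : ℤ) : ℝ :=
  if α < blockAvg k u x ∧ ∀ j > k, blockAvg j u x ≤ α then 1 else 0

lemma maxBad_congr {α : ℝ} {u : ℤ → ℝ} {k : ℕ} {x y : ℤ} (h : x / 2 ^ k = y / 2 ^ k) :
    maxBad α u k x = maxBad α u k y := by
  have h1 : ∀ j, k ≤ j → blockAvg j u x = blockAvg j u y := fun j hj =>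
    blockAvg_congr u (ediv_congr_of_le hj h)
  have : (α < blockAvg k u x ∧ ∀ j > k, blockAvg j u x ≤ α) ↔
      (α < blockAvg k u y ∧ ∀ j > k, blockAvg j u y ≤ α) := by
    rw [h1 k le_rfl]
    refine and_congr_right fun _ => forall₂_congr fun j hj => ?_
    rw [h1 j (le_of_lt hj)]
  rw [maxBad, maxBad]
  classical exact if_congr this rfl rfl

lemma maxBad_nonneg (α : ℝ) (u : ℤ → ℝ) (k : ℕ) (x : ℤ) : 0 ≤ maxBad α u k x := by
  unfold maxBad; split_ifs <;> norm_num

lemma maxBad_eq_one {α : ℝ} {u : ℤ → ℝ} {k : ℕ} {x : ℤ} (h : maxBad α u k x ≠ 0) :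
    α < blockAvg k u x ∧ (∀ j > k, blockAvg j u x ≤ α) ∧ maxBad α u k x = 1 := by
  unfold maxBad at h ⊢
  split_ifs at h ⊢ with h1
  · exact ⟨h1.1, h1.2, rfl⟩
  · exact absurd rfl h

lemma total_maxBad_le {α : ℝ} (hα : 0 < α) {u : ℤ → ℝ} (hu : ∀ x, 0 ≤ u x) (k : ℕ) :
    ENNReal.ofReal α * total (maxBad α u k) ≤ total (fun x => maxBad α u k x * u x) := by
  rw [← total_const_mul hα.le,
    ← total_blockAvg k (F := fun x => maxBad α u k x * u x) fun x =>
      mul_nonneg (maxBad_nonneg _ _ _ _) (hu x)]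
  refine total_mono fun x => ?_
  have h1 : blockAvg k (fun x => maxBad α u k x * u x) x = maxBad α u k x * blockAvg k u x := by
    simp only [blockAvg, smul_eq_mul]
    rw [Finset.sum_congr rfl fun y hy => by rw [maxBad_congr (mem_block.1 hy)], ← Finset.mul_sum]
    ring
  rw [h1]
  by_cases h : maxBad α u k x = 0
  · rw [h]; simp
  · obtain ⟨h2, _, h3⟩ := maxBad_eq_one h
    rw [h3]; linarith

/-- Maximal blocks are disjoint: for each x at most one k contributes. -/
lemma tsum_total_maxBad_mul_le (α : ℝ) (u : ℤ → ℝ) :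
    ∑' k, total (fun x => maxBad α u k x * u x) ≤ total u := by
  unfold total
  rw [ENNReal.tsum_comm]
  refine ENNReal.tsum_le_tsum fun x => ?_
  by_cases h : ∃ k, maxBad α u k x ≠ 0
  · obtain ⟨k, hk⟩ := h
    obtain ⟨h1, h2, h3⟩ := maxBad_eq_one hk
    rw [tsum_eq_single k]
    · simp only [h3, one_mul]; exact le_rfl
    intro j hj
    have : maxBad α u j x = 0 := by
      by_contra hne
      obtain ⟨h4, h5, _⟩ := maxBad_eq_one hne
      rcases lt_or_gt_of_ne hj with h | h
      · exact absurd (h5 k h) (not_le.2 h1)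
      · exact absurd (h2 j h) (not_le.2 h4)
    simp [this]
  · push Not at h
    simp [h]

lemma exists_maxBad {α : ℝ} (hα : 0 < α) {u : ℤ → ℝ} (hu : ∀ x, 0 ≤ u x) (hfin : total u ≠ ⊤)
    {k : ℕ} {x : ℤ} (h : α < blockAvg k u x) : ∃ j ≥ k, maxBad α u j x = 1 := by
  classical
  obtain ⟨K, hK⟩ := exists_blockAvg_le hu hfin hα
  have hkK : k ≤ K := by
    by_contra hlt
    exact absurd (hK k (by omega) x) (not_le.2 h)
  set j := Nat.findGreatest (fun j => α < blockAvg j u x) K with hj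
  have hj1 : α < blockAvg j u x := Nat.findGreatest_spec (P := fun j => α < blockAvg j u x) hkK h
  have hj2 : k ≤ j := Nat.le_findGreatest hkK h
  refine ⟨j, hj2, if_pos ⟨hj1, fun i hi => ?_⟩⟩
  by_cases hiK : i ≤ K
  · exact not_lt.1 (Nat.findGreatest_is_greatest hi hiK)
  · exact hK i (by omega) x

/-- A bad block lies in a maximal one, and its right neighbour lies in that maximal block or in the
right neighbour of it. So the set is covered by the maximal blocks and their right neighbours, which
gives the factor 2. -/
lemma count_exceptionalSet_le {α : ℝ} (hα : 0 < α) {u : ℤ → ℝ} (hu : ∀ x, 0 ≤ u x)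
    (hfin : total u ≠ ⊤) :
    ENNReal.ofReal α * Measure.count (exceptionalSet α u) ≤ 2 * total u := by
  set A : ℕ → Set ℤ := fun k => {x | maxBad α u k x = 1} with hA
  set B : ℕ → Set ℤ := fun k => {x | maxBad α u k (x - 2 ^ k) = 1} with hB
  have hsub : exceptionalSet α u ⊆ ⋃ k, (A k ∪ B k) := by
    rintro x ⟨k, hx | hx⟩
    · obtain ⟨j, _, hj⟩ := exists_maxBad hα hu hfin hx
      exact Set.mem_iUnion.2 ⟨j, Or.inl hj⟩
    · obtain ⟨j, hkj, hj⟩ := exists_maxBad hα hu hfin hx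
      refine Set.mem_iUnion.2 ⟨j, ?_⟩
      have hp : (2 : ℤ) ^ k ≤ 2 ^ j := pow_le_pow_right₀ (by norm_num) hkj
      have hp0 : (0 : ℤ) < 2 ^ k := by positivity
      have hm := self_mem_block j (x - 2 ^ k)
      by_cases hin : x ∈ block j (x - 2 ^ k)
      · left
        change maxBad α u j x = 1
        rw [← hj]
        exact maxBad_congr (mem_block.1 hin)
      · right
        have : x - 2 ^ j ∈ block j (x - 2 ^ k) := by
          rw [block, Finset.mem_Ico] at hm hin ⊢
          omega
        change maxBad α u j (x - 2 ^ j) = 1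
        rw [← hj]
        exact maxBad_congr (mem_block.1 this)
  have hAle : ∀ k, Measure.count (A k) ≤ total (maxBad α u k) := fun k => by
    have := count_le_total (D := A k) (F := maxBad α u k) (a := 1) fun x hx => by
      rw [show maxBad α u k x = 1 from hx]
    simpa using this
  have hBle : ∀ k, Measure.count (B k) ≤ total (maxBad α u k) := fun k => by
    have := count_le_total (D := B k) (F := fun x => maxBad α u k (x - 2 ^ k)) (a := 1)
      fun x hx => by rw [show maxBad α u k (x - 2 ^ k) = 1 from hx]
    rw [total_sub_right] at this
    simpa using this
  calc ENNReal.ofReal α * Measure.count (exceptionalSet α u)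
      ≤ ENNReal.ofReal α * ∑' k, 2 * total (maxBad α u k) := by
        gcongr
        refine (measure_mono hsub).trans ((measure_iUnion_le _).trans ?_)
        refine ENNReal.tsum_le_tsum fun k => (measure_union_le _ _).trans ?_
        rw [two_mul]
        exact add_le_add (hAle k) (hBle k)
    _ = 2 * ∑' k, ENNReal.ofReal α * total (maxBad α u k) := by
        rw [ENNReal.tsum_mul_left, ENNReal.tsum_mul_left]; ring
    _ ≤ 2 * total u := by
        gcongr
        exact (ENNReal.tsum_le_tsum fun k => total_maxBad_le hα hu k).trans
          (tsum_total_maxBad_mul_le α u)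

/-! ### Families of roots of unity -/

/-- A family of distinct roots of unity of orders at most `Q`, with at most `Q ^ 2` members. -/
structure IsFareyFamily {ι : Type*} (Q : ℕ) (I : Finset ι) (ζ : ι → ℂ) : Prop where
  root : ∀ i ∈ I, ∃ q, 1 ≤ q ∧ q ≤ Q ∧ ζ i ^ q = 1
  inj : Set.InjOn ζ I
  card_le : I.card ≤ Q ^ 2

section Farey

variable {ι : Type*} {Q : ℕ} {I : Finset ι} {ζ : ι → ℂ}

lemma IsFareyFamily.norm_eq_one (h : IsFareyFamily Q I ζ) {i : ι} (hi : i ∈ I) : ‖ζ i‖ = 1 := by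
  obtain ⟨q, hq, _, hz⟩ := h.root i hi
  exact Complex.norm_eq_one_of_pow_eq_one hz (by omega)

lemma IsFareyFamily.ne_zero (h : IsFareyFamily Q I ζ) {i : ι} (hi : i ∈ I) : ζ i ≠ 0 := by
  intro h0
  have := h.norm_eq_one hi
  rw [h0, norm_zero] at this
  norm_num at this

lemma IsFareyFamily.norm_zpow (h : IsFareyFamily Q I ζ) {i : ι} (hi : i ∈ I) (x : ℤ) :
    ‖ζ i ^ x‖ = 1 := by
  rw [_root_.norm_zpow, h.norm_eq_one hi, one_zpow]

lemma IsFareyFamily.subset (h : IsFareyFamily Q I ζ) {J : Finset ι} (hJ : J ⊆ I) :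
    IsFareyFamily Q J ζ :=
  ⟨fun i hi => h.root i (hJ hi), h.inj.mono (by exact_mod_cast hJ),
    (Finset.card_le_card hJ).trans h.card_le⟩

/-- Complete periods cancel, and fewer than r terms of modulus one remain. -/
lemma norm_sum_zpow_le {ω : ℂ} (hω : ω ≠ 1) {r : ℕ} (hr : 1 ≤ r) (h : ω ^ r = 1) (a : ℤ) (L : ℕ) :
    ‖∑ x ∈ Finset.Ico a (a + L), ω ^ x‖ ≤ r := by
  have hn : ‖ω‖ = 1 := Complex.norm_eq_one_of_pow_eq_one h (by omega)
  have h0 : ω ≠ 0 := by rintro rfl; simp at hn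
  have h1 : ∑ x ∈ Finset.Ico a (a + L), ω ^ x = ω ^ a * ∑ m ∈ Finset.range L, ω ^ m := by
    induction L with
    | zero => simp
    | succ L ih =>
      have : Finset.Ico a (a + (L + 1 : ℕ)) = insert (a + (L : ℤ)) (Finset.Ico a (a + L)) := by
        ext z; simp only [Finset.mem_Ico, Finset.mem_insert]; push_cast; omega
      rw [this, Finset.sum_insert (by simp), ih, Finset.sum_range_succ, zpow_add₀ h0, zpow_natCast]
      ring
  have h2 : ∑ m ∈ Finset.range L, ω ^ m = ∑ m ∈ Finset.range (L % r), ω ^ m := by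
    have e : ω ^ L = ω ^ (L % r) := by
      conv_lhs => rw [← Nat.div_add_mod L r, pow_add, pow_mul, h, one_pow, one_mul]
    rw [geom_sum_eq hω, geom_sum_eq hω, e]
  rw [h1, norm_mul, _root_.norm_zpow, hn, one_zpow, one_mul, h2]
  refine (norm_sum_le _ _).trans ?_
  simp only [norm_pow, hn, one_pow, Finset.sum_const, Finset.card_range, nsmul_eq_mul, mul_one]
  exact_mod_cast (Nat.mod_lt L (by omega)).le

/-- A large sieve inequality. Expand the square: the diagonal gives L, and off the diagonal ζ_i/ζ_j
≠ 1 is a root of unity of order at most Q², so its geometric sum is at most Q². Cauchy–Schwarz over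
at most Q² indices turns this into Q⁴. -/
lemma IsFareyFamily.sum_norm_sq_le (h : IsFareyFamily Q I ζ) (z : ι → ℂ) (a : ℤ) (L : ℕ) :
    ∑ x ∈ Finset.Ico a (a + L), ‖∑ i ∈ I, z i * ζ i ^ x‖ ^ 2
      ≤ (L + Q ^ 4) * ∑ i ∈ I, ‖z i‖ ^ 2 := by
  classical
  have hQ : (0 : ℝ) ≤ Q := by positivity
  have hexp : ∀ x : ℤ, ((‖∑ i ∈ I, z i * ζ i ^ x‖ ^ 2 : ℝ) : ℂ)
      = ∑ i ∈ I, ∑ j ∈ I, z i * (starRingEnd ℂ) (z j) * (ζ i / ζ j) ^ x := by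
    intro x
    rw [← Complex.normSq_eq_norm_sq, ← Complex.mul_conj, map_sum, Finset.sum_mul_sum]
    refine Finset.sum_congr rfl fun i hi => Finset.sum_congr rfl fun j hj => ?_
    rw [map_mul, map_zpow₀, ← Complex.inv_eq_conj (h.norm_eq_one hj), div_zpow, inv_zpow]
    field_simp
  have hij : ∀ i ∈ I, ∀ j ∈ I, ‖∑ x ∈ Finset.Ico a (a + L), (ζ i / ζ j) ^ x‖
      ≤ (if i = j then (L : ℝ) else 0) + Q ^ 2 := by
    intro i hi j hj
    split_ifs with e
    · subst e
      simp only [div_self (h.ne_zero hi), one_zpow, Finset.sum_const, Int.card_Ico]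
      simp
    · obtain ⟨q, hq1, hq2, hq3⟩ := h.root i hi
      obtain ⟨q', hq1', hq2', hq3'⟩ := h.root j hj
      have hne : ζ i / ζ j ≠ 1 := by
        intro h1
        rw [div_eq_one_iff_eq (h.ne_zero hj)] at h1
        exact e (h.inj hi hj h1)
      have := norm_sum_zpow_le hne (r := q * q') (Nat.mul_pos hq1 hq1')
        (by rw [div_pow, pow_mul, hq3, one_pow, mul_comm, pow_mul, hq3', one_pow, div_one]) a L
      refine this.trans ?_
      push_cast
      have h1 : (q : ℝ) ≤ Q := by exact_mod_cast hq2
      have h2 : (q' : ℝ) ≤ Q := by exact_mod_cast hq2'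
      nlinarith [show (0 : ℝ) ≤ q by positivity, show (0 : ℝ) ≤ q' by positivity]
  have hC : ((∑ x ∈ Finset.Ico a (a + L), ‖∑ i ∈ I, z i * ζ i ^ x‖ ^ 2 : ℝ) : ℂ)
      = ∑ i ∈ I, ∑ j ∈ I, z i * (starRingEnd ℂ) (z j)
          * ∑ x ∈ Finset.Ico a (a + L), (ζ i / ζ j) ^ x := by
    rw [Complex.ofReal_sum, Finset.sum_congr rfl fun x _ => hexp x, Finset.sum_comm]
    refine Finset.sum_congr rfl fun i _ => ?_
    rw [Finset.sum_comm]
    exact Finset.sum_congr rfl fun j _ => by rw [Finset.mul_sum]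
  have hnn : 0 ≤ ∑ x ∈ Finset.Ico a (a + L), ‖∑ i ∈ I, z i * ζ i ^ x‖ ^ 2 :=
    Finset.sum_nonneg fun _ _ => by positivity
  rw [← Real.norm_of_nonneg hnn, ← Complex.norm_real, hC]
  calc _ ≤ ∑ i ∈ I, ∑ j ∈ I, ‖z i‖ * ‖z j‖ * ((if i = j then (L : ℝ) else 0) + Q ^ 2) := by
        refine (norm_sum_le _ _).trans (Finset.sum_le_sum fun i hi => (norm_sum_le _ _).trans
          (Finset.sum_le_sum fun j hj => ?_))
        rw [norm_mul, norm_mul, RCLike.norm_conj]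
        gcongr
        exact hij i hi j hj
    _ = L * ∑ i ∈ I, ‖z i‖ ^ 2 + Q ^ 2 * (∑ i ∈ I, ‖z i‖) ^ 2 := by
        simp only [mul_add, Finset.sum_add_distrib, mul_ite, mul_zero]
        congr 1
        · rw [Finset.mul_sum]
          refine Finset.sum_congr rfl fun i hi => ?_
          rw [Finset.sum_ite_eq, if_pos hi]; ring
        · rw [sq (∑ i ∈ I, ‖z i‖), Finset.sum_mul_sum, Finset.mul_sum]
          refine Finset.sum_congr rfl fun i _ => ?_
          rw [Finset.mul_sum]
          exact Finset.sum_congr rfl fun j _ => by ring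
    _ ≤ L * ∑ i ∈ I, ‖z i‖ ^ 2 + Q ^ 2 * (Q ^ 2 * ∑ i ∈ I, ‖z i‖ ^ 2) := by
        gcongr
        refine (sq_sum_le_card_mul_sum_sq).trans ?_
        gcongr
        exact_mod_cast h.card_le
    _ = _ := by ring

/-- The combination `∑ i, c i ζ i ^ x H i x` of modulated functions. -/
def modSum (I : Finset ι) (c ζ : ι → ℂ) (H : ι → ℤ → ℂ) (x : ℤ) : ℂ :=
  ∑ i ∈ I, c i * ζ i ^ x * H i x

lemma modSum_add (c : ι → ℂ) (H H' : ι → ℤ → ℂ) (x : ℤ) :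
    modSum I c ζ (fun i y => H i y + H' i y) x = modSum I c ζ H x + modSum I c ζ H' x := by
  simp only [modSum, mul_add, Finset.sum_add_distrib]

lemma modSum_sub (c : ι → ℂ) (H H' : ι → ℤ → ℂ) (x : ℤ) :
    modSum I c ζ (fun i y => H i y - H' i y) x = modSum I c ζ H x - modSum I c ζ H' x := by
  simp only [modSum, mul_sub, Finset.sum_sub_distrib]

/-- The sum `∑ i, |c i| ^ 2 ‖H i‖ ^ 2`. -/
def energy (I : Finset ι) (c : ι → ℂ) (H : ι → ℤ → ℂ) : ENNReal :=
  ∑ i ∈ I, ENNReal.ofReal (‖c i‖ ^ 2) * normTwoSq (H i)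

lemma energy_eq_total (c : ι → ℂ) (H : ι → ℤ → ℂ) :
    energy I c H = total (fun x => ∑ i ∈ I, ‖c i‖ ^ 2 * ‖H i x‖ ^ 2) := by
  rw [total_sum I fun i _ x => by positivity, energy]
  exact Finset.sum_congr rfl fun i _ => (total_const_mul (by positivity) _).symm

/-- On each block the H i are constants and become coefficients in the large sieve inequality with L
= 2^l. -/
lemma IsFareyFamily.normTwoSq_modSum_le_of_const (h : IsFareyFamily Q I ζ) (c : ι → ℂ) {l : ℕ}
    {H : ι → ℤ → ℂ} (hH : ∀ i x y, x / 2 ^ l = y / 2 ^ l → H i x = H i y) :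
    normTwoSq (modSum I c ζ H) ≤ ENNReal.ofReal (1 + Q ^ 4 * ((2 : ℝ) ^ l)⁻¹) * energy I c H := by
  rw [energy_eq_total, ← total_const_mul (by positivity), normTwoSq,
    ← total_blockAvg l fun _ => by positivity]
  refine total_mono fun x => ?_
  have h1 := h.sum_norm_sq_le (fun i => c i * H i x) (2 ^ l * (x / 2 ^ l)) (2 ^ l)
  have hb : Finset.Ico (2 ^ l * (x / 2 ^ l)) (2 ^ l * (x / 2 ^ l) + ((2 ^ l : ℕ) : ℤ))
      = block l x := by
    rw [block]; push_cast; rfl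
  rw [hb] at h1
  push_cast at h1
  simp only [blockAvg, smul_eq_mul]
  have h2 : ∑ y ∈ block l x, ‖modSum I c ζ H y‖ ^ 2
      = ∑ y ∈ block l x, ‖∑ i ∈ I, c i * H i x * ζ i ^ y‖ ^ 2 := by
    refine Finset.sum_congr rfl fun y hy => ?_
    rw [modSum]
    congr 2
    refine Finset.sum_congr rfl fun i _ => ?_
    rw [hH i y x (mem_block.1 hy)]; ring
  rw [h2]
  have h3 : (0 : ℝ) < 2 ^ l := by positivity
  calc _ ≤ ((2 : ℝ) ^ l)⁻¹ * ((2 ^ l + Q ^ 4) * ∑ i ∈ I, ‖c i * H i x‖ ^ 2) := by gcongr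
    _ = _ := by
      simp only [norm_mul, mul_pow]
      field_simp

/-- Block means are handled by almost orthogonality; the deviations only by Cauchy–Schwarz over at
most Q² indices, which is affordable when H i is nearly constant on blocks. -/
lemma IsFareyFamily.normTwoSq_modSum_le (h : IsFareyFamily Q I ζ) (c : ι → ℂ) (l : ℕ)
    (H : ι → ℤ → ℂ) :
    normTwoSq (modSum I c ζ H)
      ≤ 2 * (ENNReal.ofReal (1 + Q ^ 4 * ((2 : ℝ) ^ l)⁻¹) * energy I c H
        + ENNReal.ofReal (Q ^ 2) * energy I c (fun i x => H i x - blockAvg l (H i) x)) := by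
  have e : modSum I c ζ H = fun x => modSum I c ζ (fun i => blockAvg l (H i)) x
      + modSum I c ζ (fun i x => H i x - blockAvg l (H i) x) x := by
    ext x
    rw [← modSum_add]
    simp
  have h1 := h.normTwoSq_modSum_le_of_const c (l := l) (H := fun i => blockAvg l (H i))
    fun i x y hxy => blockAvg_congr _ hxy
  have h2 : energy I c (fun i => blockAvg l (H i)) ≤ energy I c H :=
    Finset.sum_le_sum fun i _ => mul_le_mul_right (normTwoSq_blockAvg_le _ _) _
  have h3 := normTwoSq_sum_le I fun i x => c i * ζ i ^ x * (H i x - blockAvg l (H i) x)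
  have h4 : ∑ i ∈ I, normTwoSq (fun x => c i * ζ i ^ x * (H i x - blockAvg l (H i) x))
      = energy I c (fun i x => H i x - blockAvg l (H i) x) := by
    refine Finset.sum_congr rfl fun i hi => ?_
    rw [← normTwoSq_const_mul]
    refine normTwoSq_congr_norm fun x => ?_
    rw [norm_mul, norm_mul, norm_mul, h.norm_zpow hi, mul_one]
  have h5 : (I.card : ENNReal) ≤ ENNReal.ofReal (Q ^ 2) := by
    rw [← ENNReal.ofReal_natCast]
    exact ENNReal.ofReal_le_ofReal (by exact_mod_cast h.card_le)
  rw [h4] at h3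
  rw [e]
  refine (normTwoSq_add_le _ _).trans (mul_le_mul_right (add_le_add ?_ ?_) _)
  · exact h1.trans (mul_le_mul_right h2 _)
  · exact h3.trans (mul_le_mul_left h5 _)

end Farey

end

end PrimeMultiplier

/-! ### Maximal bounds for modulated martingales. -/

namespace PrimeMultiplier

noncomputable section

open MeasureTheory

/-! ### A Rademacher–Menshov inequality -/

/-- Chaining along binary digits: n is reached from 0 by at most one dyadic step of each length 2^k.
The induction passes to the even indices. -/
lemma norm_sub_le_sum_of_dyadic (K : ℕ) (X : ℕ → ℂ) (a : ℕ → ℝ)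
    (h : ∀ k < K, ∀ j < 2 ^ (K - k), ‖X ((j + 1) * 2 ^ k) - X (j * 2 ^ k)‖ ≤ a k)
    {n : ℕ} (hn : n < 2 ^ K) : ‖X n - X 0‖ ≤ ∑ k ∈ Finset.range K, a k := by
  induction K generalizing X a n with
  | zero => simp at hn; simp [hn]
  | succ K ih =>
    have h1 := ih (fun j => X (2 * j)) (fun k => a (k + 1)) (fun k hk j hj => by
      have := h (k + 1) (by omega) j (by rwa [Nat.succ_sub_succ])
      rw [pow_succ] at this
      convert this using 4 <;> ring) (n := n / 2) (by rw [pow_succ] at hn; omega)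
    rw [Finset.sum_range_succ']
    have h2 : ‖X n - X (2 * (n / 2))‖ ≤ a 0 := by
      have h0 : 0 ≤ a 0 := (norm_nonneg _).trans (h 0 (by omega) 0 (by positivity))
      rcases Nat.mod_two_eq_zero_or_one n with e | e
      · rw [show 2 * (n / 2) = n by omega, sub_self, norm_zero]; exact h0
      · have := h 0 (by omega) (2 * (n / 2)) (by rw [Nat.sub_zero]; omega)
        rw [pow_zero, mul_one, mul_one] at this
        rwa [show 2 * (n / 2) + 1 = n by omega] at this
    calc ‖X n - X 0‖ = ‖(X n - X (2 * (n / 2))) + (X (2 * (n / 2)) - X 0)‖ := by congr 1; ring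
      _ ≤ a 0 + ∑ k ∈ Finset.range K, a (k + 1) :=
        (norm_add_le _ _).trans (add_le_add h2 (by simpa using h1))
      _ = _ := by ring

lemma normTwoSq_real_smul (c : ℝ) (u : ℤ → ℂ) :
    normTwoSq (fun x => c • u x) = ENNReal.ofReal (c ^ 2) * normTwoSq u := by
  simp only [normTwoSq, norm_smul, mul_pow, Real.norm_eq_abs, sq_abs]
  exact total_const_mul (by positivity) _

/-- With κ, E at one scale and κ', E' at the next, κ'E' - κE = -κ'(E - E') + (κ' - κ)E. The first
parts sum by martingale orthogonality. The second do because (κ - κ')² ≤ 2(κ - κ') telescopes. -/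
lemma sum_normTwoSq_mass_blockAvg_le {w : ℕ → ℝ} (hw : IsDecreasingWeight w) {n : ℕ → ℕ}
    (hn : Monotone n) (u : ℤ → ℂ) (J : ℕ) :
    ∑ j ∈ Finset.range J, normTwoSq (fun x => mass w (n (j + 1)) • blockAvg (n (j + 1)) u x
      - mass w (n j) • blockAvg (n j) u x) ≤ 16 * normTwoSq u := by
  have hterm : ∀ j, normTwoSq (fun x => mass w (n (j + 1)) • blockAvg (n (j + 1)) u x
      - mass w (n j) • blockAvg (n j) u x)
      ≤ 8 * normTwoSq (fun x => blockAvg (n j) u x - blockAvg (n (j + 1)) u x)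
        + ENNReal.ofReal (4 * (mass w (n j) - mass w (n (j + 1)))) * normTwoSq u := by
    intro j
    have e : (fun x => mass w (n (j + 1)) • blockAvg (n (j + 1)) u x
        - mass w (n j) • blockAvg (n j) u x)
        = fun x => (-mass w (n (j + 1))) • (blockAvg (n j) u x - blockAvg (n (j + 1)) u x)
          + (mass w (n (j + 1)) - mass w (n j)) • blockAvg (n j) u x := by
      ext x
      simp only [smul_sub, sub_smul, neg_smul]
      ring
    have hle := antitone_mass hw (hn (Nat.le_succ j))
    have h0 := mass_nonneg hw (n (j + 1))
    have h2 := mass_le_two hw (n j)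
    have h2' := mass_le_two hw (n (j + 1))
    rw [e]
    refine (normTwoSq_add_le _ _).trans ?_
    rw [normTwoSq_real_smul, normTwoSq_real_smul, mul_add]
    refine add_le_add ?_ ?_
    · rw [← mul_assoc]
      gcongr
      rw [show (2 : ENNReal) = ENNReal.ofReal 2 by simp, show (8 : ENNReal) = ENNReal.ofReal 8 by simp,
        ← ENNReal.ofReal_mul (by norm_num)]
      apply ENNReal.ofReal_le_ofReal
      nlinarith
    · rw [← mul_assoc]
      gcongr
      · rw [show (2 : ENNReal) = ENNReal.ofReal 2 by simp, ← ENNReal.ofReal_mul (by norm_num)]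
        apply ENNReal.ofReal_le_ofReal
        nlinarith
      · exact normTwoSq_blockAvg_le _ _
  refine (Finset.sum_le_sum fun j _ => hterm j).trans ?_
  rw [Finset.sum_add_distrib, ← Finset.mul_sum, ← Finset.sum_mul,
    ← ENNReal.ofReal_sum_of_nonneg fun j _ => by
      have := antitone_mass hw (hn (Nat.le_succ j)); linarith, ← Finset.mul_sum,
    Finset.sum_range_sub' (fun j => mass w (n j))]
  have h1 := sum_normTwoSq_blockAvg_sub_le hn u J
  have h2 : ENNReal.ofReal (4 * (mass w (n 0) - mass w (n J))) ≤ 8 := by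
    rw [show (8 : ENNReal) = ENNReal.ofReal 8 by simp]
    apply ENNReal.ofReal_le_ofReal
    linarith [mass_nonneg hw (n J), mass_le_two hw (n 0)]
  calc _ ≤ 8 * normTwoSq u + 8 * normTwoSq u := by gcongr
    _ = 16 * normTwoSq u := by rw [← add_mul]; norm_num

section Martingale

variable {ι : Type*} {Q : ℕ} {I : Finset ι} {ζ : ι → ℂ}

/-- The main term `∑ i, c i ζ i ^ x κ_n(w i) E_n(g i)(x)`. -/
def mainTerm (I : Finset ι) (c ζ : ι → ℂ) (w : ι → ℕ → ℝ) (g : ι → ℤ → ℂ) (n : ℕ) : ℤ → ℂ :=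
  modSum I c ζ fun i x => mass (w i) n • blockAvg n (g i) x

lemma blockAvg_congr_of_le {V : Type*} [AddCommGroup V] [Module ℝ V] {k m : ℕ} (h : k ≤ m)
    (u : ℤ → V) {x y : ℤ} (e : x / 2 ^ k = y / 2 ^ k) : blockAvg m u x = blockAvg m u y :=
  blockAvg_congr u (ediv_congr_of_le h e)

/-- Rademacher–Menshov. Chaining bounds the maximal increment by the sum over K levels of √(V k),
and Cauchy–Schwarz costs one factor K. Each level is bounded by the energy, through almost
orthogonality in i and the variation bound in the scale; summing K levels costs the other factor. -/
lemma IsFareyFamily.exists_majorant_mainTerm (h : IsFareyFamily Q I ζ) (c : ι → ℂ)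
    {w : ι → ℕ → ℝ} (hw : ∀ i, IsDecreasingWeight (w i)) (g : ι → ℤ → ℂ) (n₀ K : ℕ) :
    ∃ M : ℤ → ℝ, (∀ m < 2 ^ K, ∀ x, ‖mainTerm I c ζ w g (n₀ + m) x‖ ^ 2 ≤ M x) ∧
      total M ≤ ENNReal.ofReal (40 * (K + 1) ^ 2 * (1 + Q ^ 4 * ((2 : ℝ) ^ n₀)⁻¹)) * energy I c g := by
  set Y := fun m => mainTerm I c ζ w g (n₀ + m) with hY
  set V : ℕ → ℤ → ℝ := fun k x =>
    ∑ j ∈ Finset.range (2 ^ (K - k)), ‖Y ((j + 1) * 2 ^ k) x - Y (j * 2 ^ k) x‖ ^ 2 with hV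
  have hV0 : ∀ k x, 0 ≤ V k x := fun k x => Finset.sum_nonneg fun _ _ => by positivity
  set B : ℝ := 1 + Q ^ 4 * ((2 : ℝ) ^ n₀)⁻¹ with hB
  have hB0 : 0 ≤ B := by positivity
  refine ⟨fun x => 2 * ‖Y 0 x‖ ^ 2 + 2 * (K * ∑ k ∈ Finset.range K, V k x), ?_, ?_⟩
  · intro m hm x
    have h1 := norm_sub_le_sum_of_dyadic K (fun m => Y m x) (fun k => √(V k x)) (fun k _ j hj => by
      refine Real.le_sqrt_of_sq_le ?_
      exact Finset.single_le_sum
        (f := fun j => ‖Y ((j + 1) * 2 ^ k) x - Y (j * 2 ^ k) x‖ ^ 2)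
        (fun _ _ => by positivity) (Finset.mem_range.2 hj)) hm
    have h2 : (∑ k ∈ Finset.range K, √(V k x)) ^ 2 ≤ K * ∑ k ∈ Finset.range K, V k x := by
      have := sq_sum_le_card_mul_sum_sq (s := Finset.range K) (f := fun k => √(V k x))
      simp only [Finset.card_range, Real.sq_sqrt (hV0 _ x)] at this
      exact this
    have h3 : ‖Y m x‖ ≤ ‖Y 0 x‖ + ‖Y m x - Y 0 x‖ := by
      have := norm_add_le (Y 0 x) (Y m x - Y 0 x)
      rwa [add_sub_cancel] at this
    have h4 : ‖Y m x - Y 0 x‖ ^ 2 ≤ K * ∑ k ∈ Finset.range K, V k x :=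
      (pow_le_pow_left₀ (norm_nonneg _) h1 2).trans h2
    change ‖Y m x‖ ^ 2 ≤ _
    nlinarith [norm_nonneg (Y m x), sq_nonneg (‖Y 0 x‖ - ‖Y m x - Y 0 x‖)]
  · have hY0 : normTwoSq (Y 0) ≤ ENNReal.ofReal B * (4 * energy I c g) := by
      have h1 := h.normTwoSq_modSum_le_of_const c (l := n₀)
        (H := fun i x => mass (w i) (n₀ + 0) • blockAvg (n₀ + 0) (g i) x)
        fun i x y hxy => by simp only [blockAvg_congr_of_le (Nat.le_add_right n₀ 0) (g i) hxy]
      refine h1.trans (mul_le_mul_right ?_ _)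
      unfold energy
      rw [Finset.mul_sum]
      refine Finset.sum_le_sum fun i _ => ?_
      rw [normTwoSq_real_smul, mul_left_comm]
      refine mul_le_mul' ?_ (mul_le_mul_right (normTwoSq_blockAvg_le _ _) _)
      rw [show (4 : ENNReal) = ENNReal.ofReal 4 by simp]
      apply ENNReal.ofReal_le_ofReal
      nlinarith [mass_nonneg (hw i) (n₀ + 0), mass_le_two (hw i) (n₀ + 0)]
    have hVk : ∀ k, total (V k) ≤ ENNReal.ofReal B * (16 * energy I c g) := by
      intro k
      rw [hV, total_sum _ fun _ _ _ => by positivity]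
      have hj : ∀ j ∈ Finset.range (2 ^ (K - k)),
          total (fun x => ‖Y ((j + 1) * 2 ^ k) x - Y (j * 2 ^ k) x‖ ^ 2)
          ≤ ENNReal.ofReal B * energy I c (fun i x =>
            mass (w i) (n₀ + (j + 1) * 2 ^ k) • blockAvg (n₀ + (j + 1) * 2 ^ k) (g i) x
            - mass (w i) (n₀ + j * 2 ^ k) • blockAvg (n₀ + j * 2 ^ k) (g i) x) := by
        intro j _
        have h1 := h.normTwoSq_modSum_le_of_const c (l := n₀) (H := fun i x =>
            mass (w i) (n₀ + (j + 1) * 2 ^ k) • blockAvg (n₀ + (j + 1) * 2 ^ k) (g i) x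
            - mass (w i) (n₀ + j * 2 ^ k) • blockAvg (n₀ + j * 2 ^ k) (g i) x)
            fun i x y hxy => by
              simp only [blockAvg_congr_of_le (Nat.le_add_right n₀ _) (g i) hxy]
        refine le_trans (le_of_eq ?_) h1
        rw [normTwoSq]
        congr 1
        ext x
        rw [modSum_sub]
        rfl
      refine (Finset.sum_le_sum hj).trans ?_
      rw [← Finset.mul_sum]
      refine mul_le_mul_right ?_ _
      simp only [energy]
      rw [Finset.sum_comm, Finset.mul_sum]
      refine Finset.sum_le_sum fun i _ => ?_
      rw [← Finset.mul_sum, mul_left_comm]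
      refine mul_le_mul_right ?_ _
      exact sum_normTwoSq_mass_blockAvg_le (hw i) (n := fun j => n₀ + j * 2 ^ k)
        (fun a b hab => Nat.add_le_add_left (Nat.mul_le_mul_right _ hab) _) (g i) _
    rw [total_add (fun _ => by positivity) (fun x => by
        have := Finset.sum_nonneg fun k (_ : k ∈ Finset.range K) => hV0 k x
        positivity), total_const_mul (by norm_num), total_const_mul (by norm_num),
      total_const_mul (by positivity), total_sum _ fun k _ x => hV0 k x]
    calc _ ≤ ENNReal.ofReal 2 * (ENNReal.ofReal B * (4 * energy I c g))
          + ENNReal.ofReal 2 * (ENNReal.ofReal K * ∑ k ∈ Finset.range K,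
            ENNReal.ofReal B * (16 * energy I c g)) := by
          refine add_le_add (mul_le_mul_right hY0 _) (mul_le_mul_right (mul_le_mul_right
            (Finset.sum_le_sum fun k _ => hVk k) _) _)
      _ = ENNReal.ofReal ((8 + 32 * K ^ 2) * B) * energy I c g := by
          rw [Finset.sum_const, Finset.card_range, nsmul_eq_mul, ← ENNReal.ofReal_natCast,
            show (4 : ENNReal) = ENNReal.ofReal 4 by simp,
            show (16 : ENNReal) = ENNReal.ofReal 16 by simp]
          simp only [← mul_assoc, ← ENNReal.ofReal_mul, Nat.cast_nonneg, hB0,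
            Nat.ofNat_nonneg]
          rw [← add_mul, ← ENNReal.ofReal_add (by positivity) (by positivity)]
          congr 2; ring
      _ ≤ _ := by
          gcongr
          have : (0 : ℝ) ≤ K := by positivity
          nlinarith

/-! ### Large scales -/

lemma card_filter_emod_le (n P : ℕ) (hP : 1 ≤ P) (hPn : P ≤ 2 ^ n) (r x : ℤ) :
    (((block n x).filter fun y => y % P = r % P).card : ℝ) ≤ 2 * 2 ^ n / P := by
  have hP0 : (0 : ℤ) < P := by exact_mod_cast hP
  have h1 := Int.Ico_filter_modEq_card (2 ^ n * (x / 2 ^ n)) (2 ^ n * (x / 2 ^ n) + 2 ^ n) hP0 r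
  have e : (block n x).filter (fun y => y % P = r % P)
      = {y ∈ Finset.Ico (2 ^ n * (x / 2 ^ n)) (2 ^ n * (x / 2 ^ n) + 2 ^ n) | y ≡ r [ZMOD P]} := rfl
  rw [e]
  have hPr : (0 : ℝ) < P := by exact_mod_cast hP
  have hPn' : (P : ℝ) ≤ 2 ^ n := by exact_mod_cast hPn
  have h3 : (1 : ℝ) ≤ 2 ^ n / P := by rwa [one_le_div hPr]
  have h4 : ((({y ∈ Finset.Ico (2 ^ n * (x / 2 ^ n)) (2 ^ n * (x / 2 ^ n) + 2 ^ n) |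
      y ≡ r [ZMOD P]}.card : ℤ) : ℝ)) ≤ 2 * 2 ^ n / P := by
    rw [h1]
    push_cast
    refine max_le ?_ (by positivity)
    set A : ℚ := (((2 ^ n * (x / 2 ^ n) : ℤ) : ℚ) - r) / P with hA
    have h5 : (((2 ^ n * (x / 2 ^ n) + 2 ^ n : ℤ) : ℚ) - r) / (P : ℤ) = A + 2 ^ n / P := by
      rw [hA]; push_cast; ring
    have hc1 := Int.ceil_lt_add_one (A + 2 ^ n / P)
    have hc2 := Int.le_ceil A
    have hA' : (((2 ^ n * (x / 2 ^ n) : ℤ) : ℚ) - r) / (P : ℤ) = A := by rw [hA]; push_cast; ring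
    push_cast at h5 hA'
    rw [h5, hA']
    have : ((⌈A + 2 ^ n / P⌉ : ℚ) - ⌈A⌉) ≤ 2 ^ n / P + 1 := by linarith
    have h6 : ((⌈A + 2 ^ n / P⌉ : ℝ) - ⌈A⌉) ≤ 2 ^ n / P + 1 := by
      have := (Rat.cast_le (K := ℝ)).2 this
      push_cast at this
      exact this
    refine h6.trans ?_
    rw [mul_div_assoc]; linarith
  exact_mod_cast h4

/-- On the class x ≡ r mod P the phases ζ_i^x are constant, so the modulated sum at x equals E_n of
the single function `v r`. The dyadic maximal inequality for |v r|² treats all n ≥ n₁ at once, and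
averaging over r recovers the energy. -/
lemma IsFareyFamily.count_modSum_blockAvg_le (h : IsFareyFamily Q I ζ) (c : ι → ℂ)
    (g : ι → ℤ → ℂ) (hg : energy I c g ≠ ⊤) {P n₁ : ℕ} (hP : 1 ≤ P) (hQP : Q ^ 4 ≤ P)
    (hPn : P ≤ 2 ^ n₁) (hroot : ∀ i ∈ I, ζ i ^ P = 1) {lam : ℝ} (hlam : 0 < lam) :
    ENNReal.ofReal (lam ^ 2) *
        Measure.count {x | ∃ n ≥ n₁, lam < ‖modSum I c ζ (fun i => blockAvg n (g i)) x‖}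
      ≤ 8 * energy I c g := by
  classical
  have hP0 : (0 : ℝ) < P := by exact_mod_cast hP
  set v : ℤ → ℤ → ℂ := fun r y => ∑ i ∈ I, c i * ζ i ^ r * blockAvg n₁ (g i) y with hv
  have hvavg : ∀ n ≥ n₁, ∀ r x, ∑ i ∈ I, c i * ζ i ^ r * blockAvg n (g i) x
      = blockAvg n (v r) x := by
    intro n hn r x
    rw [hv]
    simp only
    rw [blockAvg_sum]
    refine Finset.sum_congr rfl fun i _ => ?_
    conv_lhs => rw [← blockAvg_blockAvg_of_ge hn (g i)]
    simp only [blockAvg, Finset.mul_sum, Finset.smul_sum, mul_smul_comm]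
  set D : ℤ → Set ℤ := fun r => {x | ∃ n ≥ n₁, lam ^ 2 < blockAvg n (fun y => ‖v r y‖ ^ 2) x} with hD
  -- `D r` is a union of blocks of length 2^n₁ ≥ P, so the class of r occupies at most a proportion
  -- 2/P of it. This factor compensates the sum over the P classes.
  have hDc : ∀ r x y, x / 2 ^ n₁ = y / 2 ^ n₁ → (x ∈ D r ↔ y ∈ D r) := by
    intro r x y hxy
    simp only [hD, Set.mem_ofPred_eq]
    refine exists_congr fun n => and_congr_right fun hn => ?_
    rw [blockAvg_congr_of_le hn _ hxy]
  have hsub : {x | ∃ n ≥ n₁, lam < ‖modSum I c ζ (fun i => blockAvg n (g i)) x‖}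
      ⊆ ⋃ r ∈ Finset.Ico (0 : ℤ) (0 + P), {x | x ∈ D r ∧ x % P = r % P} := by
    rintro x ⟨n, hn, hx⟩
    have hPz : (0 : ℤ) < P := by exact_mod_cast hP
    simp only [Set.mem_iUnion]
    refine ⟨x % P, ?_, ⟨n, hn, ?_⟩, ?_⟩
    · rw [Finset.mem_Ico, zero_add]
      exact ⟨Int.emod_nonneg _ hPz.ne', Int.emod_lt_of_pos _ hPz⟩
    · have e : modSum I c ζ (fun i => blockAvg n (g i)) x = blockAvg n (v (x % P)) x := by
        rw [← hvavg n hn, modSum]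
        refine Finset.sum_congr rfl fun i hi => ?_
        congr 2
        have h0 := h.ne_zero hi
        conv_lhs => rw [← Int.mul_ediv_add_emod x P, zpow_add₀ h0, zpow_mul, zpow_natCast,
          hroot i hi, one_zpow, one_mul]
      rw [e] at hx
      calc lam ^ 2 < ‖blockAvg n (v (x % P)) x‖ ^ 2 := by gcongr
        _ ≤ (blockAvg n (fun y => ‖v (x % P) y‖) x) ^ 2 := by
            gcongr; exact norm_blockAvg_le _ _ _
        _ ≤ _ := sq_blockAvg_le _ _ _
    · rw [Int.emod_emod_of_dvd _ dvd_rfl]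
  have hcnt : ∀ r, Measure.count {x | x ∈ D r ∧ x % P = r % P}
      ≤ ENNReal.ofReal (2 / P) * Measure.count (D r) := by
    intro r
    rw [count_eq_total, count_eq_total, ← total_blockAvg n₁ (fun x => by split_ifs <;> norm_num),
      ← total_const_mul (by positivity)]
    refine total_mono fun x => ?_
    simp only [blockAvg, smul_eq_mul, Set.mem_ofPred_eq]
    split_ifs with hx
    · calc _ ≤ ((2 : ℝ) ^ n₁)⁻¹ * ∑ y ∈ block n₁ x, if y % P = r % P then (1 : ℝ) else 0 := by
            gcongr with y hy
            split_ifs with h1 h2 h2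
            · exact le_rfl
            · exact absurd h1.2 h2
            · norm_num
            · norm_num
        _ ≤ ((2 : ℝ) ^ n₁)⁻¹ * (2 * 2 ^ n₁ / P) := by
            gcongr
            rw [Finset.sum_boole]
            exact card_filter_emod_le n₁ P hP hPn r x
        _ = _ := by field_simp
    · rw [Finset.sum_eq_zero, mul_zero, mul_zero]
      intro y hy
      rw [if_neg]
      rintro ⟨h1, _⟩
      exact hx ((hDc r y x (mem_block.1 hy)).1 h1)
  -- For fixed y, summing over one period of r is the large sieve inequality with L = P, and Q⁴ ≤ P
  -- gives the factor 2P.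
  have hsum : ∑ r ∈ Finset.Ico (0 : ℤ) (0 + P), normTwoSq (v r)
      ≤ ENNReal.ofReal (2 * P) * energy I c g := by
    have h1 : energy I c (fun i => blockAvg n₁ (g i)) ≤ energy I c g :=
      Finset.sum_le_sum fun i _ => mul_le_mul_right (normTwoSq_blockAvg_le _ _) _
    refine le_trans ?_ (mul_le_mul_right h1 _)
    simp only [normTwoSq]
    rw [← total_sum _ fun _ _ _ => by positivity, energy_eq_total, ← total_const_mul (by positivity)]
    refine total_mono fun y => ?_
    have h2 := h.sum_norm_sq_le (fun i => c i * blockAvg n₁ (g i) y) 0 P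
    simp only [norm_mul, mul_pow] at h2
    calc _ = ∑ r ∈ Finset.Ico (0 : ℤ) (0 + P), ‖∑ i ∈ I, c i * blockAvg n₁ (g i) y * ζ i ^ r‖ ^ 2 := by
          refine Finset.sum_congr rfl fun r _ => ?_
          congr 2
          exact Finset.sum_congr rfl fun i _ => by ring
      _ ≤ _ := h2
      _ ≤ _ := by
        have : (Q : ℝ) ^ 4 ≤ P := by exact_mod_cast hQP
        have h3 : 0 ≤ ∑ i ∈ I, ‖c i‖ ^ 2 * ‖blockAvg n₁ (g i) y‖ ^ 2 :=
          Finset.sum_nonneg fun _ _ => by positivity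
        nlinarith
  have hfin : ∀ r ∈ Finset.Ico (0 : ℤ) (0 + P), normTwoSq (v r) ≠ ⊤ := by
    intro r hr
    refine ne_top_of_le_ne_top (ENNReal.mul_ne_top ENNReal.ofReal_ne_top hg)
      ((Finset.single_le_sum (f := fun r => normTwoSq (v r)) (fun _ _ => zero_le) hr).trans hsum)
  have hDle : ∀ r ∈ Finset.Ico (0 : ℤ) (0 + P),
      ENNReal.ofReal (lam ^ 2) * Measure.count (D r) ≤ 2 * normTwoSq (v r) := by
    intro r hr
    refine le_trans ?_ (count_exceptionalSet_le (α := lam ^ 2) (by positivity)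
      (u := fun y => ‖v r y‖ ^ 2) (fun _ => by positivity) (hfin r hr))
    gcongr
    rintro x ⟨n, _, hx⟩
    exact ⟨n, Or.inl hx⟩
  calc _ ≤ ENNReal.ofReal (lam ^ 2) * ∑ r ∈ Finset.Ico (0 : ℤ) (0 + P),
          ENNReal.ofReal (2 / P) * Measure.count (D r) := by
        gcongr
        exact (measure_mono hsub).trans ((measure_biUnion_finset_le _ _).trans
          (Finset.sum_le_sum fun r _ => hcnt r))
    _ = ENNReal.ofReal (2 / P) * ∑ r ∈ Finset.Ico (0 : ℤ) (0 + P),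
          ENNReal.ofReal (lam ^ 2) * Measure.count (D r) := by
        rw [← Finset.mul_sum, ← Finset.mul_sum]; ring
    _ ≤ ENNReal.ofReal (2 / P) * ∑ r ∈ Finset.Ico (0 : ℤ) (0 + P), 2 * normTwoSq (v r) := by
        exact mul_le_mul_right (Finset.sum_le_sum hDle) _
    _ ≤ ENNReal.ofReal (2 / P) * (2 * (ENNReal.ofReal (2 * P) * energy I c g)) := by
        rw [← Finset.mul_sum]; gcongr
    _ = 8 * energy I c g := by
        rw [show (2 : ENNReal) = ENNReal.ofReal 2 by simp, show (8 : ENNReal) = ENNReal.ofReal 8 by simp,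
          ← mul_assoc, ← mul_assoc, ← ENNReal.ofReal_mul (by positivity),
          ← ENNReal.ofReal_mul (by positivity)]
        congr 2
        field_simp; norm_num

end Martingale

end

end PrimeMultiplier

/-! ### Square functions and the Calderón–Zygmund decomposition. -/

namespace PrimeMultiplier

noncomputable section

open MeasureTheory

/-! ### Summation with off-diagonal decay -/

lemma geom_sum_range_le {r : ℝ} (h0 : 0 ≤ r) (h1 : r < 1) (N : ℕ) :
    ∑ j ∈ Finset.range N, r ^ j ≤ (1 - r)⁻¹ := by
  rw [← tsum_geometric_of_lt_one h0 h1]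
  exact (summable_geometric_of_lt_one h0 h1).sum_le_tsum _ fun _ _ => by positivity

/-- With truncated subtraction the exponent is the distance |n - k|. -/
lemma sum_pow_dist_le {r : ℝ} (h0 : 0 ≤ r) (h1 : r < 1) (N k : ℕ) :
    ∑ n ∈ Finset.range N, r ^ ((n - k) + (k - n)) ≤ 2 * (1 - r)⁻¹ := by
  calc ∑ n ∈ Finset.range N, r ^ ((n - k) + (k - n))
      ≤ ∑ n ∈ Finset.range (k + N), r ^ ((n - k) + (k - n)) :=
        Finset.sum_le_sum_of_subset_of_nonneg
          (Finset.range_subset_range.2 (Nat.le_add_left _ _)) fun _ _ _ => by positivity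
    _ = ∑ n ∈ Finset.range k, r ^ ((n - k) + (k - n)) + ∑ j ∈ Finset.range N, r ^ j := by
        rw [Finset.sum_range_add]
        congr 1
        refine Finset.sum_congr rfl fun j _ => ?_
        congr 1; omega
    _ ≤ ∑ j ∈ Finset.range k, r ^ j + ∑ j ∈ Finset.range N, r ^ j := by
        gcongr ?_ + _
        rw [← Finset.sum_range_reflect (fun j => r ^ j)]
        refine Finset.sum_le_sum fun j hj => ?_
        rw [Finset.mem_range] at hj
        exact pow_le_pow_of_le_one h0 h1.le (by omega)
    _ ≤ _ := by linarith [geom_sum_range_le h0 h1 k, geom_sum_range_le h0 h1 N]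

lemma normTwoSq_sum_le_geom (M n : ℕ) (z : ℕ → ℤ → ℂ) :
    normTwoSq (fun x => ∑ k ∈ Finset.range M, z k x)
      ≤ ∑ k ∈ Finset.range M, ENNReal.ofReal (8 * (4 / 3) ^ ((n - k) + (k - n))) * normTwoSq (z k) := by
  simp only [normTwoSq]
  simp_rw [← total_const_mul (show (0 : ℝ) ≤ 8 * (4 / 3) ^ ((n - _) + (_ - n)) by positivity)]
  rw [← total_sum _ fun _ _ _ => by positivity]
  refine total_mono fun x => ?_
  calc ‖∑ k ∈ Finset.range M, z k x‖ ^ 2 ≤ (∑ k ∈ Finset.range M, ‖z k x‖) ^ 2 := by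
        gcongr; exact norm_sum_le _ _
    _ ≤ (∑ k ∈ Finset.range M, (3 / 4 : ℝ) ^ ((n - k) + (k - n)))
        * ∑ k ∈ Finset.range M, (4 / 3 : ℝ) ^ ((n - k) + (k - n)) * ‖z k x‖ ^ 2 := by
        refine Finset.sum_sq_le_sum_mul_sum_of_sq_le_mul _ (fun _ _ => by positivity)
          (fun _ _ => by positivity) fun k _ => le_of_eq ?_
        rw [← mul_assoc, ← mul_pow]; norm_num
    _ ≤ 8 * ∑ k ∈ Finset.range M, (4 / 3 : ℝ) ^ ((n - k) + (k - n)) * ‖z k x‖ ^ 2 := by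
        refine mul_le_mul_of_nonneg_right ?_ (Finset.sum_nonneg fun _ _ => by positivity)
        have := sum_pow_dist_le (r := 3 / 4) (by norm_num) (by norm_num) M n
        simp_rw [add_comm] at this ⊢
        exact this.trans (by norm_num)
    _ = _ := by rw [Finset.mul_sum]; exact Finset.sum_congr rfl fun _ _ => by ring

/-- A Schur test. Cauchy–Schwarz with weights (3/4)^|n-k| costs (4/3)^|n-k|; against the decay
(1/2)^|n-k| this leaves (2/3)^|n-k|, summable in n. -/
lemma sum_normTwoSq_le_of_decay {N M : ℕ} {z : ℕ → ℕ → ℤ → ℂ} {A : ℝ} (hA : 0 ≤ A)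
    {T : ℕ → ENNReal} (h : ∀ n < N, ∀ k < M,
      normTwoSq (z n k) ≤ ENNReal.ofReal (A * (1 / 2) ^ ((n - k) + (k - n))) * T k) :
    ∑ n ∈ Finset.range N, normTwoSq (fun x => ∑ k ∈ Finset.range M, z n k x)
      ≤ ENNReal.ofReal (48 * A) * ∑ k ∈ Finset.range M, T k := by
  calc _ ≤ ∑ n ∈ Finset.range N, ∑ k ∈ Finset.range M,
          ENNReal.ofReal (8 * A * (2 / 3) ^ ((n - k) + (k - n))) * T k := by
        refine Finset.sum_le_sum fun n hn => (normTwoSq_sum_le_geom M n (z n)).trans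
          (Finset.sum_le_sum fun k hk => ?_)
        refine (mul_le_mul_right (h n (Finset.mem_range.1 hn) k (Finset.mem_range.1 hk)) _).trans
          (le_of_eq ?_)
        rw [← mul_assoc, ← ENNReal.ofReal_mul (by positivity)]
        congr 2
        rw [show (2 / 3 : ℝ) = 4 / 3 * (1 / 2) by norm_num, mul_pow]
        ring
    _ = ∑ k ∈ Finset.range M, ENNReal.ofReal (8 * A * ∑ n ∈ Finset.range N,
          (2 / 3) ^ ((n - k) + (k - n))) * T k := by
        rw [Finset.sum_comm]
        refine Finset.sum_congr rfl fun k _ => ?_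
        rw [← Finset.sum_mul, ← ENNReal.ofReal_sum_of_nonneg fun _ _ => by positivity,
          Finset.mul_sum]
    _ ≤ _ := by
        rw [Finset.mul_sum]
        refine Finset.sum_le_sum fun k _ => mul_le_mul_left (ENNReal.ofReal_le_ofReal ?_) _
        have := sum_pow_dist_le (r := 2 / 3) (by norm_num) (by norm_num) N k
        norm_num at this ⊢
        nlinarith

/-! ### The square function estimate -/

/-- Split u into martingale differences d_k. For k < n, d_k has mean zero on blocks of length
2^(k+1), so E_n kills it and the average is small by cancellation. For k ≥ n, d_k is constant on
blocks of length 2^k, so the average nearly equals the mass times E_n d_k = d_k. Both cases decay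
like 2^(-|n-k|). -/
lemma sum_normTwoSq_wAvg_sub_blockAvg_le {w : ℕ → ℝ} (hw : IsDecreasingWeight w) (N : ℕ)
    (u : ℤ → ℂ) :
    ∑ n ∈ Finset.range N, normTwoSq (fun x => wAvg w n u x - mass w n • blockAvg n u x)
      ≤ ENNReal.ofReal 3072 * normTwoSq u := by
  -- The last term keeps the whole of E_N u, so the finite family sums to u and its energies sum
  -- exactly to that of u.
  set d : ℕ → ℤ → ℂ := fun k x =>
    if k < N then blockAvg k u x - blockAvg (k + 1) u x else blockAvg N u x with hd
  have hu : ∀ x, u x = ∑ k ∈ Finset.range (N + 1), d k x := by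
    intro x
    have h1 : ∑ k ∈ Finset.range N, d k x
        = ∑ k ∈ Finset.range N, (blockAvg k u x - blockAvg (k + 1) u x) :=
      Finset.sum_congr rfl fun k hk => if_pos (Finset.mem_range.1 hk)
    rw [Finset.sum_range_succ, h1, Finset.sum_range_sub' (fun k => blockAvg k u x)]
    have : blockAvg 0 u x = u x := by simp [blockAvg, block_zero]
    simp [hd, this]
  have hnorm : ∑ k ∈ Finset.range (N + 1), normTwoSq (d k) = normTwoSq u := by
    have h1 : ∀ J, ∑ k ∈ Finset.range J, normTwoSq (fun x => blockAvg k u x - blockAvg (k + 1) u x)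
        + normTwoSq (blockAvg J u) = normTwoSq (blockAvg 0 u) := by
      intro J
      induction J with
      | zero => simp
      | succ J ih =>
        rw [Finset.sum_range_succ, add_assoc, normTwoSq_blockAvg_sub_add (Nat.le_succ J), ih]
    have h0 : blockAvg 0 u = u := by ext x; simp [blockAvg, block_zero]
    rw [h0] at h1
    rw [← h1 N, Finset.sum_range_succ]
    congr 1
    · refine Finset.sum_congr rfl fun k hk => ?_
      congr 1
      ext x
      exact if_pos (Finset.mem_range.1 hk)
    · congr 1
      ext x
      exact if_neg (lt_irrefl N)
  have hdc : ∀ k ≤ N, ∀ x y, x / 2 ^ k = y / 2 ^ k → d k x = d k y := by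
    intro k hk x y hxy
    simp only [hd]
    split_ifs with h
    · rw [blockAvg_congr u hxy, blockAvg_congr_of_le (Nat.le_succ k) u hxy]
    · exact blockAvg_congr_of_le hk u hxy
  have hd0 : ∀ k < N, ∀ n, k < n → ∀ x, blockAvg n (d k) x = 0 := by
    intro k hk n hn x
    have : d k = fun x => blockAvg k u x - blockAvg (k + 1) u x := by
      ext x; exact if_pos hk
    rw [this, blockAvg_sub, blockAvg_blockAvg_of_ge hn.le, blockAvg_blockAvg_of_ge hn, sub_self]
  have hz := sum_normTwoSq_le_of_decay (N := N) (M := N + 1)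
    (z := fun n k x => wAvg w n (d k) x - mass w n • blockAvg n (d k) x) (A := 64) (by norm_num)
    (T := fun k => normTwoSq (d k)) fun n hn k hk => by
      rcases lt_or_ge k n with hlt | hge
      · have e : (fun x => wAvg w n (d k) x - mass w n • blockAvg n (d k) x) = wAvg w n (d k) := by
          ext x
          rw [hd0 k (by omega) n hlt, smul_zero, sub_zero]
        rw [e]
        refine (normTwoSq_wAvg_of_blockAvg_eq_zero hw n (k := k + 1)
          (hd0 k (by omega) (k + 1) (Nat.lt_succ_self k))).trans ?_
        gcongr
        obtain ⟨j, rfl⟩ := Nat.exists_eq_add_of_lt hlt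
        rw [show k + j + 1 - k + (k - (k + j + 1)) = j + 1 by omega]
        have h1 : 4 * ((2 : ℝ) ^ (k + j + 1))⁻¹ * 2 ^ (k + 1) = 4 * (1 / 2) ^ j := by
          rw [pow_add, pow_add, pow_add, one_div, inv_pow]
          field_simp
        rw [h1, mul_pow, ← pow_mul, pow_succ ((1 : ℝ) / 2) j]
        have : ((1 : ℝ) / 2) ^ (j * 2) ≤ (1 / 2) ^ j :=
          pow_le_pow_of_le_one (by norm_num) (by norm_num) (by omega)
        have h0 : (0 : ℝ) ≤ (1 / 2) ^ j := by positivity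
        linarith
      · have e : (fun x => wAvg w n (d k) x - mass w n • blockAvg n (d k) x)
            = fun x => wAvg w n (d k) x - mass w n • d k x := by
          ext x
          rw [blockAvg_of_const fun y hy =>
            hdc k (by omega) y x (ediv_congr_of_le hge (mem_block.1 hy))]
        rw [e]
        refine (normTwoSq_wAvg_sub_mass_le hw hge (hdc k (by omega))).trans ?_
        refine mul_le_mul_left (ENNReal.ofReal_le_ofReal ?_) _
        obtain ⟨j, rfl⟩ := Nat.exists_eq_add_of_le hge
        rw [show n - (n + j) + (n + j - n) = j by omega]
        have h1 : (2 : ℝ) ^ n * (2 ^ (n + j))⁻¹ = (1 / 2) ^ j := by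
          rw [pow_add, one_div, inv_pow]; field_simp
        rw [h1]
        have : (0 : ℝ) ≤ (1 / 2) ^ j := by positivity
        linarith
  rw [hnorm] at hz
  refine le_trans (le_of_eq ?_) (hz.trans (le_of_eq (by norm_num)))
  refine Finset.sum_congr rfl fun n _ => ?_
  congr 1
  ext x
  have hu' : u = fun x => ∑ k ∈ Finset.range (N + 1), d k x := funext hu
  conv_lhs => rw [hu']
  rw [wAvg_sum, blockAvg_sum, Finset.smul_sum, ← Finset.sum_sub_distrib]

/-! ### The Calderón–Zygmund decomposition -/

section CZ

variable {α : ℝ} {f G : ℤ → ℂ}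

/-- The part of `G` in the maximal bad blocks of scale in `s`, with the averages removed. -/
def badPart (α : ℝ) (f G : ℤ → ℂ) (s : Finset ℕ) (x : ℤ) : ℂ :=
  ∑ k ∈ s, maxBad α (fun y => ‖f y‖) k x • (G x - blockAvg k G x)

lemma blockAvg_le_two_mul_succ {u : ℤ → ℝ} (hu : ∀ x, 0 ≤ u x) (k : ℕ) (x : ℤ) :
    blockAvg k u x ≤ 2 * blockAvg (k + 1) u x := by
  simp only [blockAvg, smul_eq_mul]
  have h1 : ∑ y ∈ block k x, u y ≤ ∑ y ∈ block (k + 1) x, u y :=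
    Finset.sum_le_sum_of_subset_of_nonneg (block_subset_of_le (Nat.le_succ k) x) fun _ _ _ => hu _
  calc ((2 : ℝ) ^ k)⁻¹ * ∑ y ∈ block k x, u y ≤ ((2 : ℝ) ^ k)⁻¹ * ∑ y ∈ block (k + 1) x, u y := by
        gcongr
    _ = _ := by rw [pow_succ]; field_simp

/-- By maximality the block of scale n + 1 has average at most α, and a block average is at most
twice that of its parent. -/
lemma maxBad_blockAvg_le {u : ℤ → ℝ} (hu : ∀ x, 0 ≤ u x) {k n : ℕ} (hk : k ≤ n) {x : ℤ}
    (h : maxBad α u k x ≠ 0) : blockAvg n u x ≤ 2 * α := by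
  have := (maxBad_eq_one h).2.1 (n + 1) (by omega)
  linarith [blockAvg_le_two_mul_succ hu n x]

lemma maxBad_unique {u : ℤ → ℝ} {j k : ℕ} {x : ℤ} (hj : maxBad α u j x ≠ 0)
    (hk : maxBad α u k x ≠ 0) : j = k := by
  obtain ⟨h1, h2, _⟩ := maxBad_eq_one hj
  obtain ⟨h4, h5, _⟩ := maxBad_eq_one hk
  by_contra hne
  rcases lt_or_gt_of_ne hne with h | h
  · exact absurd (h2 k h) (not_le.2 h4)
  · exact absurd (h5 j h) (not_le.2 h1)

lemma sum_maxBad_le_one (u : ℤ → ℝ) (s : Finset ℕ) (x : ℤ) : ∑ k ∈ s, maxBad α u k x ≤ 1 := by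
  by_cases h : ∃ k ∈ s, maxBad α u k x ≠ 0
  · obtain ⟨k, hks, hk⟩ := h
    rw [Finset.sum_eq_single_of_mem k hks, (maxBad_eq_one hk).2.2]
    intro j _ hj
    by_contra hne
    exact hj (maxBad_unique hne hk)
  · push Not at h
    rw [Finset.sum_eq_zero h]
    norm_num

lemma blockAvg_maxBad_mul (u v : ℤ → ℝ) (k : ℕ) (x : ℤ) :
    blockAvg k (fun y => maxBad α u k y * v y) x = maxBad α u k x * blockAvg k v x := by
  simp only [blockAvg, smul_eq_mul]
  rw [Finset.sum_congr rfl fun y hy => by rw [maxBad_congr (mem_block.1 hy)], ← Finset.mul_sum]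
  ring

lemma norm_badPart_le (hG : ∀ x, ‖G x‖ = ‖f x‖) (s : Finset ℕ) (x : ℤ) :
    ‖badPart α f G s x‖ ≤ ∑ k ∈ s, (maxBad α (fun y => ‖f y‖) k x * ‖f x‖
      + blockAvg k (fun y => maxBad α (fun y => ‖f y‖) k y * ‖f y‖) x) := by
  refine (norm_sum_le _ _).trans (Finset.sum_le_sum fun k _ => ?_)
  rw [norm_smul, Real.norm_of_nonneg (maxBad_nonneg _ _ _ _), blockAvg_maxBad_mul, ← mul_add]
  refine mul_le_mul_of_nonneg_left ?_ (maxBad_nonneg _ _ _ _)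
  refine (norm_sub_le _ _).trans ?_
  rw [hG]
  have := norm_blockAvg_le k G x
  simp only [hG] at this
  linarith

lemma normOne_badPart_le (hG : ∀ x, ‖G x‖ = ‖f x‖) (s : Finset ℕ) :
    normOne (badPart α f G s)
      ≤ 2 * ∑ k ∈ s, total (fun x => maxBad α (fun y => ‖f y‖) k x * ‖f x‖) := by
  have h0 : ∀ k x, 0 ≤ maxBad α (fun y => ‖f y‖) k x * ‖f x‖ := fun k x =>
    mul_nonneg (maxBad_nonneg _ _ _ _) (norm_nonneg _)
  refine (total_mono (norm_badPart_le hG s)).trans (le_of_eq ?_)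
  rw [total_sum s fun k _ x => add_nonneg (h0 k x) (blockAvg_nonneg (h0 k) x), Finset.mul_sum]
  refine Finset.sum_congr rfl fun k _ => ?_
  rw [total_add (h0 k) (blockAvg_nonneg (h0 k)), total_blockAvg k (h0 k), two_mul]

lemma sum_total_maxBad_le (s : Finset ℕ) :
    ∑ k ∈ s, total (fun x => maxBad α (fun y => ‖f y‖) k x * ‖f x‖) ≤ normOne f :=
  (ENNReal.sum_le_tsum s).trans (tsum_total_maxBad_mul_le α fun y => ‖f y‖)

/-- If the block of scale n contains a maximal bad block of scale in s, the average of |f| over it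
is at most 2α; otherwise the bad part vanishes there. Subtracting means at most doubles the mass. -/
lemma blockAvg_norm_badPart_le (hα : 0 < α) (hG : ∀ x, ‖G x‖ = ‖f x‖) {n : ℕ} {s : Finset ℕ}
    (hs : ∀ k ∈ s, k ≤ n) (x : ℤ) : blockAvg n (fun y => ‖badPart α f G s y‖) x ≤ 4 * α := by
  set F : ℤ → ℝ := fun y => ‖f y‖ with hF
  have hF0 : ∀ y, 0 ≤ F y := fun y => norm_nonneg _
  have h1 : blockAvg n (fun y => ‖badPart α f G s y‖) x
      ≤ 2 * blockAvg n (fun y => (∑ k ∈ s, maxBad α F k y) * F y) x := by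
    refine (blockAvg_mono fun y _ => norm_badPart_le hG s y).trans (le_of_eq ?_)
    rw [blockAvg_sum]
    simp only [Finset.sum_mul]
    rw [blockAvg_sum, Finset.mul_sum]
    refine Finset.sum_congr rfl fun k hk => ?_
    rw [blockAvg_add, blockAvg_blockAvg_of_ge (hs k hk), two_mul]
  have h2 : blockAvg n (fun y => (∑ k ∈ s, maxBad α F k y) * F y) x ≤ 2 * α := by
    by_cases h : ∃ y ∈ block n x, ∃ k ∈ s, maxBad α F k y ≠ 0
    · obtain ⟨y, hy, k, hk, hne⟩ := h
      have h3 := maxBad_blockAvg_le hF0 (hs k hk) hne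
      rw [blockAvg_congr F (mem_block.1 hy)] at h3
      refine (blockAvg_mono fun y _ => ?_).trans h3
      exact mul_le_of_le_one_left (hF0 y) (sum_maxBad_le_one _ _ _)
    · push Not at h
      have h3 : blockAvg n (fun y => (∑ k ∈ s, maxBad α F k y) * F y) x
          ≤ blockAvg n (fun _ => (0 : ℝ)) x := by
        refine blockAvg_mono fun y hy => ?_
        rw [Finset.sum_eq_zero (h y hy), zero_mul]
      rw [blockAvg_const_real] at h3
      linarith
  linarith

lemma norm_wAvg_badPart_le {w : ℕ → ℝ} (hw : IsDecreasingWeight w) (hα : 0 < α)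
    (hG : ∀ x, ‖G x‖ = ‖f x‖) {n : ℕ} {s : Finset ℕ} (hs : ∀ k ∈ s, k ≤ n) (x : ℤ) :
    ‖wAvg w n (badPart α f G s) x‖ ≤ 16 * α := by
  have := norm_wAvg_le hw n (badPart α f G s) x
  have h1 := blockAvg_norm_badPart_le hα hG hs x
  have h2 := blockAvg_norm_badPart_le hα hG hs (x - 2 ^ n)
  linarith

lemma normTwoSq_le_of_norm_le {u : ℤ → ℂ} {A : ℝ} (hA : 0 ≤ A) (h : ∀ x, ‖u x‖ ≤ A) :
    normTwoSq u ≤ ENNReal.ofReal A * normOne u := by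
  rw [normTwoSq, normOne, ← total_const_mul hA]
  refine total_mono fun x => ?_
  rw [sq]
  exact mul_le_mul_of_nonneg_right (h x) (norm_nonneg _)

lemma blockAvg_badPart_singleton (k : ℕ) (x : ℤ) : blockAvg k (badPart α f G {k}) x = 0 := by
  have h1 : ∀ y ∈ block k x, badPart α f G {k} y
      = maxBad α (fun y => ‖f y‖) k x • (G y - blockAvg k G x) := by
    intro y hy
    rw [badPart, Finset.sum_singleton, maxBad_congr (mem_block.1 hy),
      blockAvg_congr G (mem_block.1 hy)]
  rw [blockAvg, Finset.sum_congr rfl h1, ← Finset.smul_sum, Finset.sum_sub_distrib]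
  have h2 : ∑ _y ∈ block k x, blockAvg k G x = ∑ y ∈ block k x, G y := by
    rw [sum_block_eq (u := fun _ => blockAvg k G x) fun _ _ => rfl, blockAvg, smul_smul,
      mul_inv_cancel₀ (by positivity), one_smul]
  rw [h2, sub_self, smul_zero, smul_zero]

/-- For one scale k ≤ n, interpolate between the sup bound 16α and the ℓ¹ bound with gain 2^(k-n)
from cancellation. The product is an ℓ² bound decaying in n - k, and the masses of f on the maximal
blocks sum to at most ‖f‖₁. -/
lemma sum_normTwoSq_wAvg_badPart_le {w : ℕ → ℝ} (hw : IsDecreasingWeight w) (hα : 0 < α)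
    (hG : ∀ x, ‖G x‖ = ‖f x‖) (N K : ℕ) :
    ∑ n ∈ Finset.range N, normTwoSq (wAvg w n (badPart α f G ((Finset.range K).filter (· ≤ n))))
      ≤ ENNReal.ofReal (6144 * α) * normOne f := by
  have hz := sum_normTwoSq_le_of_decay (N := N) (M := K)
    (z := fun n k x => if k ≤ n then wAvg w n (badPart α f G {k}) x else 0) (A := 128 * α)
    (by positivity) (T := fun k => total (fun x => maxBad α (fun y => ‖f y‖) k x * ‖f x‖))
    fun n hn k hk => by
      split_ifs with hkn
      · have h1 := normTwoSq_le_of_norm_le (by positivity)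
          (norm_wAvg_badPart_le hw hα hG (n := n) (s := {k}) (by simpa using hkn))
        have h2 := normOne_wAvg_of_blockAvg_eq_zero hw n (k := k)
          (blockAvg_badPart_singleton (α := α) (f := f) (G := G) k)
        have h3 := normOne_badPart_le (α := α) hG {k}
        rw [Finset.sum_singleton] at h3
        refine h1.trans ((mul_le_mul_right (h2.trans (mul_le_mul_right h3 _)) _).trans (le_of_eq ?_))
        rw [show (2 : ENNReal) = ENNReal.ofReal 2 by simp, ← mul_assoc, ← mul_assoc,
          ← ENNReal.ofReal_mul (by positivity), ← ENNReal.ofReal_mul (by positivity)]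
        congr 2
        obtain ⟨j, rfl⟩ := Nat.exists_eq_add_of_le hkn
        rw [show k + j - k + (k - (k + j)) = j by omega, pow_add, one_div, inv_pow]
        field_simp
        norm_num
      · have : normTwoSq (fun _ => (0 : ℂ)) = 0 := by simp [normTwoSq, total]
        rw [this]; exact zero_le
  refine le_trans (le_of_eq ?_) (hz.trans ?_)
  · refine Finset.sum_congr rfl fun n _ => ?_
    congr 1
    ext x
    rw [← Finset.sum_filter, ← wAvg_sum]
    congr 1
    ext y
    simp only [badPart, Finset.sum_singleton]
  · rw [show 48 * (128 * α) = 6144 * α by ring]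
    exact mul_le_mul_right (sum_total_maxBad_le _) _

/-- The same interpolation: the deviation from the block mean is at most 32α pointwise, and small in
ℓ¹ because the average varies slowly. -/
lemma normTwoSq_wAvg_badPart_sub_blockAvg_le {w : ℕ → ℝ} (hw : IsDecreasingWeight w) (hα : 0 < α)
    (hG : ∀ x, ‖G x‖ = ‖f x‖) {n : ℕ} {s : Finset ℕ} (hs : ∀ k ∈ s, k ≤ n) (l : ℕ) :
    normTwoSq (fun x => wAvg w n (badPart α f G s) x - blockAvg l (wAvg w n (badPart α f G s)) x)
      ≤ ENNReal.ofReal (256 * α * (2 ^ l * ((2 : ℝ) ^ n)⁻¹)) * normOne f := by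
  set H := wAvg w n (badPart α f G s) with hH
  have hsup : ∀ x, ‖H x‖ ≤ 16 * α := norm_wAvg_badPart_le hw hα hG hs
  have hsup2 : ∀ x, ‖H x - blockAvg l H x‖ ≤ 32 * α := by
    intro x
    have h1 : ‖blockAvg l H x‖ ≤ 16 * α := by
      refine (norm_blockAvg_le l H x).trans ((blockAvg_mono fun y _ => hsup y).trans ?_)
      rw [blockAvg_const_real]
    have := norm_sub_le (H x) (blockAvg l H x)
    linarith [hsup x]
  have h1 := normTwoSq_le_of_norm_le (by positivity) hsup2
  have h2 := normOne_sub_blockAvg_le H l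
  have h3 := normOne_backDiff_wAvg_le hw n (badPart α f G s)
  have h4 := (normOne_badPart_le (α := α) hG s).trans
    (mul_le_mul_right (sum_total_maxBad_le s) _)
  refine h1.trans ((mul_le_mul_right (h2.trans (mul_le_mul_right (h3.trans
    (mul_le_mul_right h4 _)) _)) _).trans (le_of_eq ?_))
  rw [show (2 : ENNReal) = ENNReal.ofReal 2 by simp, ← mul_assoc, ← mul_assoc, ← mul_assoc,
    ← ENNReal.ofReal_mul (by positivity), ← ENNReal.ofReal_mul (by positivity),
    ← ENNReal.ofReal_mul (by positivity)]
  congr 2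
  ring

lemma normTwoSq_wAvg_sub_blockAvg_le {w : ℕ → ℝ} (hw : IsDecreasingWeight w) (n l : ℕ)
    (u : ℤ → ℂ) :
    normTwoSq (fun x => wAvg w n u x - blockAvg l (wAvg w n u) x)
      ≤ ENNReal.ofReal (16 * (2 ^ l * ((2 : ℝ) ^ n)⁻¹) ^ 2) * normTwoSq u := by
  refine (normTwoSq_sub_blockAvg_le _ l).trans ((mul_le_mul_right
    (normTwoSq_backDiff_wAvg_le hw n u) _).trans (le_of_eq ?_))
  rw [← mul_assoc, ← ENNReal.ofReal_mul (by positivity)]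
  congr 2
  ring

/-- The good part of the Calderón–Zygmund decomposition. -/
def goodPart (α : ℝ) (f G : ℤ → ℂ) (K : ℕ) (x : ℤ) : ℂ := G x - badPart α f G (Finset.range K) x

lemma badPart_eq_single {s : Finset ℕ} {k : ℕ} (hks : k ∈ s) {x : ℤ}
    (h : maxBad α (fun y => ‖f y‖) k x ≠ 0) : badPart α f G s x = G x - blockAvg k G x := by
  rw [badPart, Finset.sum_eq_single_of_mem k hks, (maxBad_eq_one h).2.2, one_smul]
  intro j _ hj
  have : maxBad α (fun y => ‖f y‖) j x = 0 := by
    by_contra hne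
    exact hj (maxBad_unique hne h)
  rw [this, zero_smul]

/-- On a maximal bad block the good part is the mean of G there, at most 2α. Elsewhere it is G, and
|f(x)| > α would make {x} a bad block of scale 0, contained in a maximal one. -/
lemma norm_goodPart_le (hα : 0 < α) (hG : ∀ x, ‖G x‖ = ‖f x‖) (hf : normOne f ≠ ⊤) {K : ℕ}
    (hK : ∀ k ≥ K, ∀ x, blockAvg k (fun y => ‖f y‖) x ≤ α) (x : ℤ) :
    ‖goodPart α f G K x‖ ≤ 2 * α := by
  have hF0 : ∀ y, 0 ≤ ‖f y‖ := fun y => norm_nonneg _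
  by_cases h : ∃ k ∈ Finset.range K, maxBad α (fun y => ‖f y‖) k x ≠ 0
  · obtain ⟨k, hk, hne⟩ := h
    rw [goodPart, badPart_eq_single hk hne, sub_sub_cancel]
    have h1 := norm_blockAvg_le k G x
    simp only [hG] at h1
    exact h1.trans (maxBad_blockAvg_le hF0 le_rfl hne)
  · push Not at h
    have h0 : badPart α f G (Finset.range K) x = 0 :=
      Finset.sum_eq_zero fun k hk => by rw [h k hk, zero_smul]
    rw [goodPart, h0, sub_zero, hG]
    have h1 : blockAvg 0 (fun y => ‖f y‖) x = ‖f x‖ := by simp [blockAvg, block_zero]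
    by_contra hlt
    have h2 : α < blockAvg 0 (fun y => ‖f y‖) x := by rw [h1]; linarith
    obtain ⟨j, _, hj⟩ := exists_maxBad hα hF0 hf h2
    have hj1 : maxBad α (fun y => ‖f y‖) j x ≠ 0 := by rw [hj]; norm_num
    have hjK : j < K := by
      by_contra hge
      exact absurd (hK j (by omega) x) (not_le.2 (maxBad_eq_one hj1).1)
    exact hj1 (h j (Finset.mem_range.2 hjK))

lemma normOne_goodPart_le (hG : ∀ x, ‖G x‖ = ‖f x‖) (K : ℕ) :
    normOne (goodPart α f G K) ≤ 3 * normOne f := by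
  have h1 : normOne (goodPart α f G K)
      ≤ normOne G + normOne (badPart α f G (Finset.range K)) := by
    rw [normOne, normOne, normOne, ← total_add (fun _ => norm_nonneg _) fun _ => norm_nonneg _]
    exact total_mono fun x => norm_sub_le _ _
  have h2 : normOne G = normOne f := by simp only [normOne, hG]
  have h3 := (normOne_badPart_le (α := α) hG (Finset.range K)).trans
    (mul_le_mul_right (sum_total_maxBad_le _) _)
  refine h1.trans ((add_le_add h2.le h3).trans (le_of_eq ?_))
  ring

lemma normTwoSq_goodPart_le (hα : 0 < α) (hG : ∀ x, ‖G x‖ = ‖f x‖) (hf : normOne f ≠ ⊤) {K : ℕ}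
    (hK : ∀ k ≥ K, ∀ x, blockAvg k (fun y => ‖f y‖) x ≤ α) :
    normTwoSq (goodPart α f G K) ≤ ENNReal.ofReal (6 * α) * normOne f := by
  refine (normTwoSq_le_of_norm_le (by positivity) (norm_goodPart_le hα hG hf hK)).trans
    ((mul_le_mul_right (normOne_goodPart_le hG K) _).trans (le_of_eq ?_))
  rw [show (3 : ENNReal) = ENNReal.ofReal 3 by simp, ← mul_assoc,
    ← ENNReal.ofReal_mul (by positivity)]
  congr 2
  ring

/-- If x - m with 1 ≤ m ≤ 2^n lay in a bad block of scale k > n, then x would lie in that block or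
in its right neighbour, hence in the exceptional set. Right neighbours are enough because the
averages look only to the left. -/
lemma wAvg_eq_of_notMem_exceptionalSet (w : ℕ → ℝ) (n K : ℕ) {x : ℤ}
    (hx : x ∉ exceptionalSet α fun y => ‖f y‖) :
    wAvg w n G x = wAvg w n (badPart α f G ((Finset.range K).filter (· ≤ n))) x
      + wAvg w n (goodPart α f G K) x := by
  rw [← wAvg_add]
  refine wAvg_congr w n fun m hm => ?_
  rw [Finset.mem_Icc] at hm
  have hzero : ∀ k, n < k → maxBad α (fun y => ‖f y‖) k (x - (m : ℤ)) = 0 := by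
    intro k hk
    by_contra hne
    have hbad := (maxBad_eq_one hne).1
    apply hx
    refine ⟨k, ?_⟩
    have hm2 : (m : ℤ) ≤ 2 ^ n := by exact_mod_cast hm.2
    have hp : (2 : ℤ) ^ n ≤ 2 ^ k := pow_le_pow_right₀ (by norm_num) hk.le
    have hself := self_mem_block k (x - (m : ℤ))
    by_cases hin : x ∈ block k (x - (m : ℤ))
    · left
      rwa [blockAvg_congr _ (mem_block.1 hin)]
    · right
      have : x - 2 ^ k ∈ block k (x - (m : ℤ)) := by
        rw [block, Finset.mem_Ico] at hself hin ⊢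
        omega
      rwa [blockAvg_congr _ (mem_block.1 this)]
  have e : badPart α f G ((Finset.range K).filter (· ≤ n)) (x - (m : ℤ))
      = badPart α f G (Finset.range K) (x - (m : ℤ)) := by
    rw [badPart, badPart, Finset.sum_filter]
    refine Finset.sum_congr rfl fun k _ => ?_
    split_ifs with h
    · rfl
    · rw [hzero k (by omega), zero_smul]
  rw [e, goodPart]
  ring

end CZ

end

end PrimeMultiplier

/-! ### The weak type bound for modulated averages. -/

namespace PrimeMultiplier

noncomputable section

open MeasureTheory

section WeakType

variable {ι : Type*} {S : ℕ} {I : Finset ι} {ζ : ι → ℂ}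

/-- With Q = 2^(S+1), blocks of length 2^(n/2) are longer than Q⁴ up to a constant, since 8S ≤ S² +
16. This makes the large sieve constant bounded at all admissible scales. -/
lemma pow_div_pow_half_le {S n : ℕ} (h : S ^ 2 ≤ n) :
    ((2 ^ (S + 1) : ℕ) : ℝ) ^ 4 * ((2 : ℝ) ^ (n / 2))⁻¹ ≤ 4096 := by
  have h1 : 4 * S ≤ n / 2 + 8 := by
    have : 2 * (4 * S) ≤ S ^ 2 + 16 := by
      zify; nlinarith [sq_nonneg ((S : ℤ) - 4)]
    omega
  rw [← div_eq_mul_inv, div_le_iff₀ (by positivity)]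
  push_cast
  calc ((2 : ℝ) ^ (S + 1)) ^ 4 = 2 ^ (4 * S + 4) := by rw [← pow_mul]; congr 1; ring
    _ ≤ 2 ^ (n / 2 + 12) := pow_le_pow_right₀ (by norm_num) (by omega)
    _ = _ := by rw [pow_add]; ring

/-- The Cauchy–Schwarz loss Q² is absorbed by 2^(-n/2) because 4S ≤ S² + 4, with geometric decay in
n - S² left over: 2^(-1/2) < 3/4. -/
lemma sq_mul_pow_half_le {S n : ℕ} (h : S ^ 2 ≤ n) :
    ((2 ^ (S + 1) : ℕ) : ℝ) ^ 2 * (2 ^ (n / 2) * ((2 : ℝ) ^ n)⁻¹) ≤ 22 * (3 / 4) ^ (n - S ^ 2) := by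
  obtain ⟨m, rfl⟩ := Nat.exists_eq_add_of_le h
  rw [Nat.add_sub_cancel_left]
  have h1 : 2 * S + m / 2 + (S ^ 2 + m) / 2 ≤ S ^ 2 + m + 2 := by
    have : 4 * S ≤ S ^ 2 + 4 := by zify; nlinarith [sq_nonneg ((S : ℤ) - 2)]
    omega
  have h2 : (1 : ℝ) ≤ (4 / 3) * 2 ^ (m / 2) * (3 / 4) ^ m := by
    rcases Nat.even_or_odd' m with ⟨j, rfl | rfl⟩
    · rw [Nat.mul_div_cancel_left j (by norm_num), pow_mul, mul_assoc, ← mul_pow]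
      have : (1 : ℝ) ≤ (2 * (3 / 4) ^ 2) ^ j := one_le_pow₀ (by norm_num)
      linarith
    · rw [show (2 * j + 1) / 2 = j by omega, pow_succ, pow_mul]
      have : (1 : ℝ) ≤ (2 * (3 / 4) ^ 2) ^ j := one_le_pow₀ (by norm_num)
      rw [mul_pow] at this
      linarith
  rw [← mul_assoc, ← div_eq_mul_inv, div_le_iff₀ (by positivity)]
  push_cast
  calc ((2 : ℝ) ^ (S + 1)) ^ 2 * 2 ^ ((S ^ 2 + m) / 2)
      ≤ ((2 : ℝ) ^ (S + 1)) ^ 2 * 2 ^ ((S ^ 2 + m) / 2) * ((4 / 3) * 2 ^ (m / 2) * (3 / 4) ^ m) :=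
        le_mul_of_one_le_right (by positivity) h2
    _ = (16 / 3) * (3 / 4) ^ m * 2 ^ (2 * S + m / 2 + (S ^ 2 + m) / 2) := by
        rw [pow_add 2 (2 * S + m / 2), pow_add 2 (2 * S), two_mul S, pow_add 2 S S,
          pow_succ 2 S]; ring
    _ ≤ (16 / 3) * (3 / 4) ^ m * 2 ^ (S ^ 2 + m + 2) := by gcongr; norm_num
    _ ≤ _ := by rw [pow_add 2 (S ^ 2 + m)]; nlinarith [show (0 : ℝ) < (3 / 4) ^ m * 2 ^ (S ^ 2 + m) by positivity]

lemma energy_le_of_le {c : ι → ℂ} {H : ι → ℤ → ℂ} {X : ENNReal} (h : ∀ i ∈ I, normTwoSq (H i) ≤ X) :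
    energy I c H ≤ ENNReal.ofReal (∑ i ∈ I, ‖c i‖ ^ 2) * X := by
  rw [ENNReal.ofReal_sum_of_nonneg fun _ _ => by positivity, Finset.sum_mul]
  exact Finset.sum_le_sum fun i hi => mul_le_mul_right (h i hi) _

lemma sum_energy_le_of_le {c : ι → ℂ} {H : ℕ → ι → ℤ → ℂ} {X : ENNReal} (s : Finset ℕ)
    (h : ∀ i ∈ I, ∑ n ∈ s, normTwoSq (H n i) ≤ X) :
    ∑ n ∈ s, energy I c (H n) ≤ ENNReal.ofReal (∑ i ∈ I, ‖c i‖ ^ 2) * X := by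
  simp only [energy]
  rw [Finset.sum_comm, ENNReal.ofReal_sum_of_nonneg fun _ _ => by positivity, Finset.sum_mul]
  refine Finset.sum_le_sum fun i hi => ?_
  rw [← Finset.mul_sum]
  exact mul_le_mul_right (h i hi) _

/-- Chebyshev at each n, then summation over n. Almost orthogonality on blocks of length 2^(n/2)
reduces the main part to the square function bound `h1`; `h2` makes the deviations geometrically
summable. -/
lemma IsFareyFamily.count_sup_modSum_le (h : IsFareyFamily (2 ^ (S + 1)) I ζ) (c : ι → ℂ)
    {H : ℕ → ι → ℤ → ℂ} {A : ℝ} (hA : 0 ≤ A) {X : ENNReal}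
    (h1 : ∀ N, ∀ i ∈ I, ∑ n ∈ Finset.range N, normTwoSq (H n i) ≤ ENNReal.ofReal A * X)
    (h2 : ∀ n, ∀ i ∈ I, normTwoSq (fun x => H n i x - blockAvg (n / 2) (H n i) x)
      ≤ ENNReal.ofReal (A * (2 ^ (n / 2) * ((2 : ℝ) ^ n)⁻¹)) * X) {μ : ℝ} (hμ : 0 < μ) :
    ENNReal.ofReal (μ ^ 2) * Measure.count {x | ∃ n ≥ S ^ 2, μ < ‖modSum I c ζ (H n) x‖}
      ≤ ENNReal.ofReal (10000 * A * ∑ i ∈ I, ‖c i‖ ^ 2) * X := by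
  classical
  set C2 : ℝ := ∑ i ∈ I, ‖c i‖ ^ 2 with hC2
  have hC20 : 0 ≤ C2 := Finset.sum_nonneg fun _ _ => by positivity
  set D : ℕ → Set ℤ := fun n => {x | S ^ 2 ≤ n ∧ μ < ‖modSum I c ζ (H n) x‖} with hD
  have hsub : {x | ∃ n ≥ S ^ 2, μ < ‖modSum I c ζ (H n) x‖} ⊆ ⋃ n, D n := by
    rintro x ⟨n, hn, hx⟩
    exact Set.mem_iUnion.2 ⟨n, hn, hx⟩
  have hcount : ∀ n, ENNReal.ofReal (μ ^ 2) * Measure.count (D n)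
      ≤ 8194 * energy I c (H n) + ENNReal.ofReal (44 * (3 / 4) ^ (n - S ^ 2) *
        (if S ^ 2 ≤ n then 1 else 0) * (A * C2)) * X := by
    intro n
    by_cases hn : S ^ 2 ≤ n
    · have hDn : ENNReal.ofReal (μ ^ 2) * Measure.count (D n) ≤ normTwoSq (modSum I c ζ (H n)) :=
        count_le_total fun x hx => by
          have := hx.2
          gcongr
      refine hDn.trans ((h.normTwoSq_modSum_le c (n / 2) (H n)).trans ?_)
      rw [mul_add, if_pos hn, mul_one]
      refine add_le_add ?_ ?_
      · rw [← mul_assoc]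
        refine mul_le_mul_left ?_ _
        rw [show (2 : ENNReal) = ENNReal.ofReal 2 by simp,
          show (8194 : ENNReal) = ENNReal.ofReal 8194 by simp, ← ENNReal.ofReal_mul (by norm_num)]
        apply ENNReal.ofReal_le_ofReal
        linarith [pow_div_pow_half_le hn]
      · refine (mul_le_mul_right (mul_le_mul_right (energy_le_of_le (h2 n)) _) _).trans ?_
        rw [show (2 : ENNReal) = ENNReal.ofReal 2 by simp, ← mul_assoc, ← mul_assoc, ← mul_assoc,
          ← ENNReal.ofReal_mul (by norm_num), ← ENNReal.ofReal_mul (by positivity),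
          ← ENNReal.ofReal_mul (by positivity)]
        refine mul_le_mul_left (ENNReal.ofReal_le_ofReal ?_) _
        have := mul_le_mul_of_nonneg_right (sq_mul_pow_half_le hn) (mul_nonneg hA hC20)
        linarith
    · have : D n = ∅ := by
        ext x
        simp only [hD, Set.mem_ofPred_eq, Set.mem_empty_iff_false, iff_false]
        exact fun hx => hn hx.1
      rw [this]; simp
  have hgeo : ∀ N, ∑ n ∈ Finset.range N, (44 * (3 / 4) ^ (n - S ^ 2) *
        (if S ^ 2 ≤ n then 1 else 0) * (A * C2) : ℝ) ≤ 176 * (A * C2) := by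
    intro N
    rw [← Finset.sum_mul]
    refine mul_le_mul_of_nonneg_right ?_ (mul_nonneg hA hC20)
    calc ∑ n ∈ Finset.range N, (44 * (3 / 4) ^ (n - S ^ 2) * (if S ^ 2 ≤ n then 1 else 0) : ℝ)
        ≤ ∑ n ∈ Finset.range (S ^ 2 + N),
          (44 * (3 / 4) ^ (n - S ^ 2) * (if S ^ 2 ≤ n then 1 else 0) : ℝ) :=
          Finset.sum_le_sum_of_subset_of_nonneg
            (Finset.range_subset_range.2 (Nat.le_add_left _ _)) fun _ _ _ => by
              split_ifs <;> positivity
      _ = ∑ j ∈ Finset.range N, (44 * (3 / 4) ^ j : ℝ) := by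
          rw [Finset.sum_range_add, Finset.sum_eq_zero, zero_add]
          · simp
          · intro n hn
            rw [if_neg (by rw [Finset.mem_range] at hn; omega), mul_zero]
      _ ≤ _ := by
          rw [← Finset.mul_sum]
          linarith [geom_sum_range_le (r := 3 / 4) (by norm_num) (by norm_num) N]
  calc ENNReal.ofReal (μ ^ 2) * Measure.count {x | ∃ n ≥ S ^ 2, μ < ‖modSum I c ζ (H n) x‖}
      ≤ ENNReal.ofReal (μ ^ 2) * ∑' n, Measure.count (D n) := by
        gcongr
        exact (measure_mono hsub).trans (measure_iUnion_le _)
    _ = ∑' n, ENNReal.ofReal (μ ^ 2) * Measure.count (D n) := ENNReal.tsum_mul_left.symm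
    _ ≤ _ := by
        refine ENNReal.tsum_le_of_sum_range_le fun N => ?_
        refine (Finset.sum_le_sum fun n _ => hcount n).trans ?_
        rw [Finset.sum_add_distrib, ← Finset.mul_sum, ← Finset.sum_mul,
          ← ENNReal.ofReal_sum_of_nonneg fun n _ => by split_ifs <;> positivity]
        calc _ ≤ 8194 * (ENNReal.ofReal C2 * (ENNReal.ofReal A * X))
              + ENNReal.ofReal (176 * (A * C2)) * X := by
              refine add_le_add (mul_le_mul_right (sum_energy_le_of_le _ (h1 N)) _)
                (mul_le_mul_left (ENNReal.ofReal_le_ofReal (hgeo N)) _)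
          _ = ENNReal.ofReal (8194 * C2 * A + 176 * (A * C2)) * X := by
              rw [show (8194 : ENNReal) = ENNReal.ofReal 8194 by simp, ← mul_assoc, ← mul_assoc,
                ← ENNReal.ofReal_mul (by norm_num), ← ENNReal.ofReal_mul (by positivity),
                ENNReal.ofReal_add (by positivity) (by positivity), add_mul]
          _ ≤ _ := by
              refine mul_le_mul_left (ENNReal.ofReal_le_ofReal ?_) _
              nlinarith [mul_nonneg hA hC20]

lemma ofReal_mul_count_le {D : Set ℤ} {μ lam a : ℝ} {X : ENNReal} (hμ : 0 < μ) (hlam : 0 ≤ lam)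
    (h : ENNReal.ofReal (μ ^ 2) * Measure.count D ≤ ENNReal.ofReal a * X) :
    ENNReal.ofReal lam * Measure.count D ≤ ENNReal.ofReal (lam / μ ^ 2 * a) * X := by
  have h0 : 0 ≤ lam / μ ^ 2 := by positivity
  calc ENNReal.ofReal lam * Measure.count D
      = ENNReal.ofReal (lam / μ ^ 2) * (ENNReal.ofReal (μ ^ 2) * Measure.count D) := by
        rw [← mul_assoc, ← ENNReal.ofReal_mul h0, div_mul_cancel₀ _ (by positivity)]
    _ ≤ ENNReal.ofReal (lam / μ ^ 2) * (ENNReal.ofReal a * X) := mul_le_mul_right h _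
    _ = _ := by rw [← mul_assoc, ← ENNReal.ofReal_mul h0]

/-- The left side is a multiple of every order up to Q = 2^(S+1) and is at least Q⁴. Periodicity is
therefore usable for n ≥ 2^(2S+4), and the logarithm of this threshold is only linear in S, as
Rademacher–Menshov needs. -/
lemma common_period_le (S : ℕ) :
    (2 ^ (S + 1)) ^ 4 * (2 ^ (S + 1)).factorial ≤ 2 ^ 2 ^ (2 * S + 4) := by
  calc (2 ^ (S + 1)) ^ 4 * (2 ^ (S + 1)).factorial
      ≤ (2 ^ (S + 1)) ^ 4 * (2 ^ (S + 1)) ^ (2 ^ (S + 1)) :=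
        Nat.mul_le_mul_left _ (Nat.factorial_le_pow _)
    _ = 2 ^ ((S + 1) * (4 + 2 ^ (S + 1))) := by rw [← pow_add, ← pow_mul]
    _ ≤ _ := by
        refine Nat.pow_le_pow_right (by norm_num) ?_
        have h1 : S + 1 ≤ 2 ^ S := Nat.lt_two_pow_self
        have h2 : 1 ≤ 2 ^ S := Nat.one_le_two_pow
        calc (S + 1) * (4 + 2 ^ (S + 1)) ≤ 2 ^ S * (4 + 2 ^ (S + 1)) := Nat.mul_le_mul_right _ h1
          _ ≤ 2 ^ (2 * S + 4) := by
            have e1 : 2 ^ (S + 1) = 2 ^ S * 2 := pow_succ 2 S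
            have e2 : 2 ^ (2 * S + 4) = 2 ^ S * 2 ^ S * 16 := by
              rw [pow_add, two_mul, pow_add]; norm_num
            rw [e1, e2, mul_assoc]
            refine Nat.mul_le_mul_left _ ?_
            omega

/-- The weight may depend on i only through the level `s i`, because at large scales the masses have
to be factored out level by level. The coefficient bound per level gives ∑|c_i|² ≤ C₀(S+1)²
altogether. -/
theorem exists_weak_type_bound (C₀ : ℝ) (hC₀ : 0 ≤ C₀) : ∃ C : ℝ, 0 ≤ C ∧
    ∀ {ι : Type} (S : ℕ) (I : Finset ι) (ζ c : ι → ℂ) (w : ℕ → ℕ → ℝ) (s : ι → ℕ),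
      IsFareyFamily (2 ^ (S + 1)) I ζ → (∀ i, ‖ζ i‖ = 1) → (∀ j, IsDecreasingWeight (w j)) →
      (∀ i ∈ I, s i ≤ S) →
      (∀ j ≤ S, ∑ i ∈ I with s i = j, ‖c i‖ ^ 2 ≤ C₀ * (S + 1)) →
      ∀ f : ℤ → ℂ, normOne f ≠ ⊤ → ∀ lam : ℝ, 0 < lam →
        ENNReal.ofReal lam * Measure.count {x | ∃ n ≥ S ^ 2, lam < ‖modSum I c ζ
          (fun i => wAvg (w (s i)) n fun y => ζ i ^ (-y) * f y) x‖}
          ≤ ENNReal.ofReal (C * (S + 1) ^ 2) * normOne f := by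
  refine ⟨2 + 10 ^ 12 * C₀, by positivity, ?_⟩
  intro ι S I ζ c w s hF hζ hw hs hc f hf lam hlam
  classical
  have hS : (0 : ℝ) < S + 1 := by positivity
  have hS1 : (1 : ℝ) ≤ S + 1 := by linarith [show (0 : ℝ) ≤ S by positivity]
  -- At this height the exceptional set costs (S+1)², and the intermediate scales cost (S+1)² for
  -- chaining times (S+1)² for the coefficients times α/λ, again (S+1)².
  set α : ℝ := lam / (S + 1) ^ 2 with hα
  have hα0 : 0 < α := by positivity
  have hlamα : lam = α * (S + 1) ^ 2 := by rw [hα]; field_simp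
  obtain ⟨K, hK⟩ := exists_blockAvg_le (u := fun y => ‖f y‖) (fun _ => norm_nonneg _) hf hα0
  set G : ι → ℤ → ℂ := fun i y => ζ i ^ (-y) * f y with hGdef
  have hG : ∀ i x, ‖G i x‖ = ‖f x‖ := by
    intro i x
    rw [hGdef]
    simp only
    rw [norm_mul, norm_zpow, hζ, one_zpow, one_mul]
  set g : ι → ℤ → ℂ := fun i => goodPart α f (G i) K with hg
  set Ω := exceptionalSet α fun y => ‖f y‖ with hΩ
  set C2 : ℝ := ∑ i ∈ I, ‖c i‖ ^ 2 with hC2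
  have hC20 : 0 ≤ C2 := Finset.sum_nonneg fun _ _ => by positivity
  have hC2le : C2 ≤ C₀ * (S + 1) ^ 2 := by
    have h1 : C2 = ∑ j ∈ Finset.range (S + 1), ∑ i ∈ I with s i = j, ‖c i‖ ^ 2 :=
      (Finset.sum_fiberwise_of_maps_to (fun i hi => Finset.mem_range.2 (by have := hs i hi; omega))
        _).symm
    rw [h1]
    refine (Finset.sum_le_sum fun j hj => hc j (by rw [Finset.mem_range] at hj; omega)).trans ?_
    rw [Finset.sum_const, Finset.card_range, nsmul_eq_mul]
    push_cast
    exact le_of_eq (by ring)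
  have hgN : ∀ i, normTwoSq (g i) ≤ ENNReal.ofReal (6 * α) * normOne f := fun i =>
    normTwoSq_goodPart_le hα0 (hG i) hf hK
  set R1 : ℕ → ι → ℤ → ℂ := fun n i =>
    wAvg (w (s i)) n (badPart α f (G i) ((Finset.range K).filter (· ≤ n))) with hR1
  set R2 : ℕ → ι → ℤ → ℂ := fun n i x =>
    wAvg (w (s i)) n (g i) x - mass (w (s i)) n • blockAvg n (g i) x with hR2
  set Y : ℕ → ℤ → ℂ := mainTerm I c ζ (fun i => w (s i)) g with hY
  have hdecomp : ∀ n x, x ∉ Ω → modSum I c ζ (fun i => wAvg (w (s i)) n (G i)) x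
      = modSum I c ζ (R1 n) x + modSum I c ζ (R2 n) x + Y n x := by
    intro n x hx
    rw [hY, mainTerm, ← modSum_add, ← modSum_add]
    simp only [modSum]
    refine Finset.sum_congr rfl fun i _ => ?_
    rw [wAvg_eq_of_notMem_exceptionalSet (w (s i)) n K hx]
    simp only [hR1, hR2, hg]
    ring
  set D1 : Set ℤ := {x | ∃ n ≥ S ^ 2, lam / 4 < ‖modSum I c ζ (R1 n) x‖} with hD1
  set D2 : Set ℤ := {x | ∃ n ≥ S ^ 2, lam / 4 < ‖modSum I c ζ (R2 n) x‖} with hD2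
  set D3 : Set ℤ := {x | ∃ m < 2 ^ (2 * S + 4), lam / 4 < ‖Y (S ^ 2 + m) x‖} with hD3
  set D4 : Set ℤ := {x | ∃ n ≥ 2 ^ (2 * S + 4), lam / 4 < ‖Y n x‖} with hD4
  have hcover : {x | ∃ n ≥ S ^ 2, lam < ‖modSum I c ζ (fun i => wAvg (w (s i)) n (G i)) x‖}
      ⊆ Ω ∪ (D1 ∪ (D2 ∪ (D3 ∪ D4))) := by
    rintro x ⟨n, hn, hx⟩
    by_cases hxΩ : x ∈ Ω
    · exact Or.inl hxΩ
    rw [hdecomp n x hxΩ] at hx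
    by_cases h1 : lam / 4 < ‖modSum I c ζ (R1 n) x‖
    · exact Or.inr (Or.inl ⟨n, hn, h1⟩)
    by_cases h2 : lam / 4 < ‖modSum I c ζ (R2 n) x‖
    · exact Or.inr (Or.inr (Or.inl ⟨n, hn, h2⟩))
    have h3 : lam / 4 < ‖Y n x‖ := by
      have := norm_add₃_le (a := modSum I c ζ (R1 n) x) (b := modSum I c ζ (R2 n) x) (c := Y n x)
      linarith
    by_cases h4 : n < S ^ 2 + 2 ^ (2 * S + 4)
    · refine Or.inr (Or.inr (Or.inr (Or.inl ⟨n - S ^ 2, by omega, ?_⟩)))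
      rwa [Nat.add_sub_cancel' hn]
    · exact Or.inr (Or.inr (Or.inr (Or.inr ⟨n, by omega, h3⟩)))
  have hl4 : 0 < lam / 4 := by positivity
  -- the exceptional set
  have b0 : ENNReal.ofReal lam * Measure.count Ω ≤ ENNReal.ofReal (2 * (S + 1) ^ 2) * normOne f := by
    have h1 := count_exceptionalSet_le hα0 (u := fun y => ‖f y‖) (fun _ => norm_nonneg _) hf
    rw [hlamα, mul_comm α, ENNReal.ofReal_mul (by positivity), mul_assoc]
    refine (mul_le_mul_right h1 _).trans (le_of_eq ?_)
    rw [show (2 : ENNReal) = ENNReal.ofReal 2 by simp, ← mul_assoc,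
      ← ENNReal.ofReal_mul (by positivity), mul_comm (((S : ℝ) + 1) ^ 2)]
    rfl
  have hratio : lam / (lam / 4) ^ 2 = 16 / (α * (S + 1) ^ 2) := by
    rw [← hlamα]; field_simp; norm_num
  have hT1 : (1 : ℝ) ≤ (S + 1) ^ 2 := one_le_pow₀ hS1
  have hfinal : ∀ b : ℝ, b ≤ 18432 → lam / (lam / 4) ^ 2 * (10000 * (b * α) * C2)
      ≤ 10 ^ 10 * C₀ * (S + 1) ^ 2 := by
    intro b hb
    rw [hratio, div_mul_eq_mul_div, div_le_iff₀ (by positivity)]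
    have h1 : b * (α * C2) ≤ 18432 * (α * C2) :=
      mul_le_mul_of_nonneg_right hb (mul_nonneg hα0.le hC20)
    have h2 : α * C2 ≤ α * (C₀ * (S + 1) ^ 2) := mul_le_mul_of_nonneg_left hC2le hα0.le
    have h3 : 0 ≤ α * (C₀ * (S + 1) ^ 2) := by positivity
    have h4 : α * (C₀ * (S + 1) ^ 2) * 1 ≤ α * (C₀ * (S + 1) ^ 2) * (S + 1) ^ 2 :=
      mul_le_mul_of_nonneg_left hT1 h3
    calc 16 * (10000 * (b * α) * C2) = 160000 * (b * (α * C2)) := by ring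
      _ ≤ 10 ^ 10 * (α * (C₀ * (S + 1) ^ 2) * (S + 1) ^ 2) := by linarith
      _ = _ := by ring
  -- the error terms
  have b1 : ENNReal.ofReal lam * Measure.count D1
      ≤ ENNReal.ofReal (10 ^ 10 * C₀ * (S + 1) ^ 2) * normOne f := by
    have h1 := hF.count_sup_modSum_le c (H := R1) (A := 6144 * α) (by positivity)
      (X := normOne f) (fun N i _ => sum_normTwoSq_wAvg_badPart_le (hw (s i)) hα0 (hG i) N K)
      (fun n i _ => by
        refine (normTwoSq_wAvg_badPart_sub_blockAvg_le (hw (s i)) hα0 (hG i)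
          (fun k hk => (Finset.mem_filter.1 hk).2) (n / 2)).trans ?_
        gcongr
        norm_num) hl4
    refine (ofReal_mul_count_le hl4 hlam.le h1).trans
      (mul_le_mul_left (ENNReal.ofReal_le_ofReal ?_) _)
    exact hfinal 6144 (by norm_num)
  have b2 : ENNReal.ofReal lam * Measure.count D2
      ≤ ENNReal.ofReal (10 ^ 10 * C₀ * (S + 1) ^ 2) * normOne f := by
    have h1 := hF.count_sup_modSum_le c (H := R2) (A := 18432 * α) (by positivity)
      (X := normOne f) (fun N i _ => by
        refine (sum_normTwoSq_wAvg_sub_blockAvg_le (hw (s i)) N (g i)).trans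
          ((mul_le_mul_right (hgN i) _).trans (le_of_eq ?_))
        rw [← mul_assoc, ← ENNReal.ofReal_mul (by norm_num)]
        congr 2; ring)
      (fun n i _ => by
        -- The subtracted multiple of E_n g_i is constant on blocks of length 2^n, hence on those of
        -- length 2^(n/2), and drops out of the deviation.
        have e : (fun x => R2 n i x - blockAvg (n / 2) (R2 n i) x)
            = fun x => wAvg (w (s i)) n (g i) x - blockAvg (n / 2) (wAvg (w (s i)) n (g i)) x := by
          ext x
          have e1 : blockAvg (n / 2) (R2 n i) x = blockAvg (n / 2) (wAvg (w (s i)) n (g i)) x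
              - blockAvg (n / 2) (fun x => mass (w (s i)) n • blockAvg n (g i) x) x := by
            rw [hR2]; exact blockAvg_sub _ _ _ _
          rw [e1, blockAvg_of_const (u := fun x => mass (w (s i)) n • blockAvg n (g i) x)
            fun y hy => by
              simp only [blockAvg_congr_of_le (Nat.div_le_self n 2) (g i) (mem_block.1 hy)]]
          simp only [hR2]
          ring
        rw [e]
        refine (normTwoSq_wAvg_sub_blockAvg_le (hw (s i)) n (n / 2) (g i)).trans
          ((mul_le_mul_right (hgN i) _).trans ?_)
        rw [← mul_assoc, ← ENNReal.ofReal_mul (by positivity)]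
        refine mul_le_mul_left (ENNReal.ofReal_le_ofReal ?_) _
        have h0 : (0 : ℝ) ≤ 2 ^ (n / 2) * ((2 : ℝ) ^ n)⁻¹ := by positivity
        have h1 : (2 : ℝ) ^ (n / 2) * ((2 : ℝ) ^ n)⁻¹ ≤ 1 := by
          rw [← div_eq_mul_inv, div_le_one (by positivity)]
          exact pow_le_pow_right₀ (by norm_num) (Nat.div_le_self _ _)
        have h2 := mul_le_mul_of_nonneg_left h1 h0
        nlinarith [mul_nonneg hα0.le h0, mul_le_mul_of_nonneg_left h2 hα0.le]) hl4
    refine (ofReal_mul_count_le hl4 hlam.le h1).trans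
      (mul_le_mul_left (ENNReal.ofReal_le_ofReal ?_) _)
    exact hfinal 18432 (by norm_num)
  have hEn : energy I c g ≤ ENNReal.ofReal (6 * α * C2) * normOne f := by
    refine (energy_le_of_le fun i _ => hgN i).trans (le_of_eq ?_)
    rw [← mul_assoc, ← ENNReal.ofReal_mul hC20]
    congr 2; ring
  -- intermediate scales
  have b3 : ENNReal.ofReal lam * Measure.count D3
      ≤ ENNReal.ofReal (10 ^ 9 * C₀ * (S + 1) ^ 2) * normOne f := by
    -- The 2^(2S+4) intermediate scales have K = 2S + 4 dyadic levels, and K + 1 ≤ 5(S+1).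
    obtain ⟨M, hM1, hM2⟩ := hF.exists_majorant_mainTerm c (fun i => hw (s i)) g (S ^ 2) (2 * S + 4)
    have h1 : ENNReal.ofReal ((lam / 4) ^ 2) * Measure.count D3 ≤ total M :=
      count_le_total fun x hx => by
        obtain ⟨m, hm, hx⟩ := hx
        refine le_trans ?_ (hM1 m hm x)
        gcongr
    have h2 : ENNReal.ofReal ((lam / 4) ^ 2) * Measure.count D3
        ≤ ENNReal.ofReal (40 * (5 * (S + 1)) ^ 2 * 4097 * (6 * α * C2)) * normOne f := by
      refine h1.trans (hM2.trans ((mul_le_mul_right hEn _).trans ?_))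
      rw [← mul_assoc, ← ENNReal.ofReal_mul (by positivity)]
      refine mul_le_mul_left (ENNReal.ofReal_le_ofReal ?_) _
      have h3 : ((2 ^ (S + 1) : ℕ) : ℝ) ^ 4 * ((2 : ℝ) ^ (S ^ 2))⁻¹ ≤ 4096 := by
        refine le_trans ?_ (pow_div_pow_half_le (S := S) le_rfl)
        gcongr
        · norm_num
        · exact Nat.div_le_self _ _
      have h4 : (((2 * S + 4 : ℕ) : ℝ) + 1) ≤ 5 * (S + 1) := by
        push_cast; linarith
      gcongr
      linarith
    refine (ofReal_mul_count_le hl4 hlam.le h2).trans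
      (mul_le_mul_left (ENNReal.ofReal_le_ofReal ?_) _)
    rw [hratio, div_mul_eq_mul_div, div_le_iff₀ (by positivity)]
    have h5 := mul_le_mul_of_nonneg_left hC2le
      (show (0 : ℝ) ≤ α * (S + 1) ^ 2 by positivity)
    have h6 : 0 ≤ α * (S + 1) ^ 2 * (C₀ * (S + 1) ^ 2) := by positivity
    calc 16 * (40 * (5 * ((S : ℝ) + 1)) ^ 2 * 4097 * (6 * α * C2))
        = 393312000 * (α * (S + 1) ^ 2 * C2) := by ring
      _ ≤ 10 ^ 9 * (α * (S + 1) ^ 2 * (C₀ * (S + 1) ^ 2)) := by linarith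
      _ = _ := by ring
  -- large scales
  have b4 : ENNReal.ofReal lam * Measure.count D4
      ≤ ENNReal.ofReal (10 ^ 4 * C₀ * (S + 1) ^ 2) * normOne f := by
    -- The masses depend on n and on the level but on nothing else, so each level is treated
    -- separately with its mass, at most 2, pulled out. S + 1 levels of size 2ν add up to λ/4. The
    -- union over levels is paid for by the sharper bound C₀(S+1) for the coefficients of one level.
    set ν : ℝ := lam / (8 * (S + 1)) with hν
    have hν0 : 0 < ν := by positivity
    set E : ℕ → Set ℤ := fun j => {x | ∃ n ≥ 2 ^ (2 * S + 4),
      ν < ‖modSum (I.filter fun i => s i = j) c ζ (fun i => blockAvg n (g i)) x‖} with hE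
    have hsub : D4 ⊆ ⋃ j ∈ Finset.range (S + 1), E j := by
      rintro x ⟨n, hn, hx⟩
      by_contra hne
      simp only [Set.mem_iUnion, not_exists] at hne
      have h1 : Y n x = ∑ j ∈ Finset.range (S + 1), mass (w j) n •
          modSum (I.filter fun i => s i = j) c ζ (fun i => blockAvg n (g i)) x := by
        rw [hY, mainTerm, modSum, ← Finset.sum_fiberwise_of_maps_to (t := Finset.range (S + 1))
          (g := s) fun i hi => Finset.mem_range.2 (by have := hs i hi; omega)]
        refine Finset.sum_congr rfl fun j _ => ?_
        rw [modSum, Finset.smul_sum]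
        refine Finset.sum_congr rfl fun i hi => ?_
        rw [(Finset.mem_filter.1 hi).2, mul_smul_comm]
      have h2 : ‖Y n x‖ ≤ ∑ j ∈ Finset.range (S + 1), 2 * ν := by
        rw [h1]
        refine (norm_sum_le _ _).trans (Finset.sum_le_sum fun j hj => ?_)
        rw [norm_smul, Real.norm_of_nonneg (mass_nonneg (hw j) n)]
        have h3 : ‖modSum (I.filter fun i => s i = j) c ζ (fun i => blockAvg n (g i)) x‖ ≤ ν := by
          by_contra hlt
          exact hne j hj ⟨n, hn, not_le.1 hlt⟩
        exact mul_le_mul (mass_le_two (hw j) n) h3 (norm_nonneg _) (by norm_num)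
      rw [Finset.sum_const, Finset.card_range, nsmul_eq_mul] at h2
      have h3 : ((S + 1 : ℕ) : ℝ) * (2 * ν) = lam / 4 := by
        rw [hν]; push_cast; field_simp; norm_num
      rw [h3] at h2
      exact absurd hx (not_lt.2 h2)
    have hEj : ∀ j ∈ Finset.range (S + 1), ENNReal.ofReal (ν ^ 2) * Measure.count (E j)
        ≤ ENNReal.ofReal (48 * α * (C₀ * (S + 1))) * normOne f := by
      intro j hj
      have hj' : j ≤ S := by rw [Finset.mem_range] at hj; omega
      have hen : energy (I.filter fun i => s i = j) c g
          ≤ ENNReal.ofReal (6 * α * (C₀ * (S + 1))) * normOne f := by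
        refine (energy_le_of_le fun i _ => hgN i).trans ?_
        rw [← mul_assoc, ← ENNReal.ofReal_mul (Finset.sum_nonneg fun _ _ => by positivity),
          mul_comm (6 * α)]
        refine mul_le_mul_left (ENNReal.ofReal_le_ofReal ?_) _
        exact mul_le_mul_of_nonneg_right (hc j hj') (by positivity)
      have hfac : 1 ≤ (2 ^ (S + 1)).factorial := Nat.factorial_pos _
      refine ((hF.subset (Finset.filter_subset _ _)).count_modSum_blockAvg_le c g
        (ne_top_of_le_ne_top (ENNReal.mul_ne_top ENNReal.ofReal_ne_top hf) hen)
        (P := (2 ^ (S + 1)) ^ 4 * (2 ^ (S + 1)).factorial)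
        (Nat.mul_pos (by positivity) hfac) (Nat.le_mul_of_pos_right _ hfac)
        (common_period_le S) (fun i hi => ?_) hν0).trans ?_
      · obtain ⟨q, hq1, hq2, hq3⟩ := hF.root i (Finset.mem_filter.1 hi).1
        obtain ⟨r, hr⟩ : q ∣ (2 ^ (S + 1)) ^ 4 * (2 ^ (S + 1)).factorial :=
          (Nat.dvd_factorial hq1 hq2).mul_left _
        rw [hr, pow_mul, hq3, one_pow]
      · refine (mul_le_mul_right hen _).trans (le_of_eq ?_)
        rw [show (8 : ENNReal) = ENNReal.ofReal 8 by simp, ← mul_assoc,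
          ← ENNReal.ofReal_mul (by norm_num)]
        congr 2; ring
    calc ENNReal.ofReal lam * Measure.count D4
        ≤ ENNReal.ofReal lam * ∑ j ∈ Finset.range (S + 1), Measure.count (E j) := by
          gcongr
          exact (measure_mono hsub).trans (measure_biUnion_finset_le _ _)
      _ = ∑ j ∈ Finset.range (S + 1), ENNReal.ofReal lam * Measure.count (E j) :=
          Finset.mul_sum _ _ _
      _ ≤ ∑ j ∈ Finset.range (S + 1),
          ENNReal.ofReal (lam / ν ^ 2 * (48 * α * (C₀ * (S + 1)))) * normOne f :=
          Finset.sum_le_sum fun j hj => ofReal_mul_count_le hν0 hlam.le (hEj j hj)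
      _ = ENNReal.ofReal ((S + 1) * (lam / ν ^ 2 * (48 * α * (C₀ * (S + 1))))) * normOne f := by
          rw [Finset.sum_const, Finset.card_range, nsmul_eq_mul, ← mul_assoc,
            ← ENNReal.ofReal_natCast, ← ENNReal.ofReal_mul (by positivity)]
          push_cast
          rfl
      _ ≤ _ := by
          refine mul_le_mul_left (ENNReal.ofReal_le_ofReal ?_) _
          have e : ((S : ℝ) + 1) * (lam / ν ^ 2 * (48 * α * (C₀ * (S + 1))))
              = 3072 * C₀ * (S + 1) ^ 2 := by
            rw [hν, hα]; field_simp; norm_num; ring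
          rw [e]
          gcongr
          norm_num
  calc _ ≤ ENNReal.ofReal lam * (Measure.count Ω + (Measure.count D1 + (Measure.count D2
          + (Measure.count D3 + Measure.count D4)))) := by
        gcongr
        refine (measure_mono hcover).trans ((measure_union_le _ _).trans ?_)
        gcongr
        refine (measure_union_le _ _).trans ?_
        gcongr
        refine (measure_union_le _ _).trans ?_
        gcongr
        exact measure_union_le _ _
    _ ≤ ENNReal.ofReal (2 * (S + 1) ^ 2) * normOne f
        + (ENNReal.ofReal (10 ^ 10 * C₀ * (S + 1) ^ 2) * normOne f
        + (ENNReal.ofReal (10 ^ 10 * C₀ * (S + 1) ^ 2) * normOne f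
        + (ENNReal.ofReal (10 ^ 9 * C₀ * (S + 1) ^ 2) * normOne f
        + ENNReal.ofReal (10 ^ 4 * C₀ * (S + 1) ^ 2) * normOne f))) := by
        simp only [mul_add]
        exact add_le_add b0 (add_le_add b1 (add_le_add b2 (add_le_add b3 b4)))
    _ = ENNReal.ofReal (2 * (S + 1) ^ 2 + (10 ^ 10 * C₀ * (S + 1) ^ 2
        + (10 ^ 10 * C₀ * (S + 1) ^ 2 + (10 ^ 9 * C₀ * (S + 1) ^ 2
        + 10 ^ 4 * C₀ * (S + 1) ^ 2)))) * normOne f := by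
        rw [ENNReal.ofReal_add (by positivity) (by positivity),
          ENNReal.ofReal_add (by positivity) (by positivity),
          ENNReal.ofReal_add (by positivity) (by positivity),
          ENNReal.ofReal_add (by positivity) (by positivity)]
        ring
    _ ≤ _ := by
        refine mul_le_mul_left (ENNReal.ofReal_le_ofReal ?_) _
        nlinarith [mul_nonneg hC₀ (show (0 : ℝ) ≤ (S + 1) ^ 2 by positivity)]

end WeakType

end

end PrimeMultiplier

/-! ### Totients, Gauss sums and the coefficients. -/

namespace PrimeMultiplier

noncomputable section

section Totient

/-- The j-th smallest element is at least j + 1, so ∏ p/(p-1) is at most the telescoping product of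
(j+1)/j. -/
lemma prod_le_card_add_one_mul_prod_sub_one (s : Finset ℕ) (hs : ∀ p ∈ s, 2 ≤ p) :
    ∏ p ∈ s, p ≤ (s.card + 1) * ∏ p ∈ s, (p - 1) := by
  induction s using Finset.induction_on_max with
  | empty => simp
  | insert m s hlt ih =>
    have hm : m ∉ s := fun h => lt_irrefl _ (hlt m h)
    have hcard : s.card + 2 ≤ m := by
      have h1 : s ⊆ Finset.Ico 2 m := fun p hp =>
        Finset.mem_Ico.2 ⟨hs p (Finset.mem_insert_of_mem hp), hlt p hp⟩
      have h2 := Finset.card_le_card h1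
      have h3 := hs m (Finset.mem_insert_self _ _)
      rw [Nat.card_Ico] at h2
      omega
    rw [Finset.prod_insert hm, Finset.prod_insert hm, Finset.card_insert_of_notMem hm]
    have ih' := ih fun p hp => hs p (Finset.mem_insert_of_mem hp)
    obtain ⟨k, rfl⟩ : ∃ k, m = k + 1 := ⟨m - 1, by omega⟩
    rw [Nat.add_sub_cancel]
    calc (k + 1) * ∏ p ∈ s, p ≤ (k + 1) * ((s.card + 1) * ∏ p ∈ s, (p - 1)) :=
          Nat.mul_le_mul_left _ ih'
      _ = ((k + 1) * (s.card + 1)) * ∏ p ∈ s, (p - 1) := by ring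
      _ ≤ ((s.card + 1 + 1) * k) * ∏ p ∈ s, (p - 1) := by
          refine Nat.mul_le_mul_right _ ?_
          nlinarith
      _ = _ := by ring

/-- q/φ(q) is the product of p/(p-1) over the prime divisors, and there are at most s of them
because 2 to their number is at most q. -/
lemma le_mul_totient {q s : ℕ} (hq : 0 < q) (h : q < 2 ^ (s + 1)) :
    q ≤ (s + 1) * q.totient := by
  have h1 := prod_le_card_add_one_mul_prod_sub_one q.primeFactors fun p hp =>
    (Nat.prime_of_mem_primeFactors hp).two_le
  have h2 := Nat.totient_mul_prod_primeFactors q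
  have hcard : q.primeFactors.card ≤ s := by
    have h3 : 2 ^ q.primeFactors.card ≤ ∏ p ∈ q.primeFactors, p :=
      Finset.pow_card_le_prod _ _ _ fun p hp => (Nat.prime_of_mem_primeFactors hp).two_le
    have h4 : ∏ p ∈ q.primeFactors, p ≤ q := Nat.le_of_dvd hq (Nat.prod_primeFactors_dvd q)
    have := (Nat.pow_lt_pow_iff_right (a := 2) (by norm_num)).1 ((h3.trans h4).trans_lt h)
    omega
  have hpos : 0 < ∏ p ∈ q.primeFactors, (p - 1) := Finset.prod_pos fun p hp => by
    have := (Nat.prime_of_mem_primeFactors hp).two_le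
    omega
  refine Nat.le_of_mul_le_mul_right ?_ hpos
  rw [← h2]
  calc q.totient * ∏ p ∈ q.primeFactors, p
      ≤ q.totient * ((q.primeFactors.card + 1) * ∏ p ∈ q.primeFactors, (p - 1)) :=
        Nat.mul_le_mul_left _ h1
    _ ≤ q.totient * ((s + 1) * ∏ p ∈ q.primeFactors, (p - 1)) := by gcongr
    _ = _ := by ring

lemma sum_Icc_eq_sum_range {M : Type*} [AddCommMonoid M] {F : ℕ → M} {q : ℕ} (hq : 0 < q)
    (h : F q = F 0) : ∑ r ∈ Finset.Icc 1 q, F r = ∑ r ∈ Finset.range q, F r := by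
  obtain ⟨k, rfl⟩ : ∃ k, q = k + 1 := ⟨q - 1, by omega⟩
  rw [Finset.sum_range_succ', ← h, ← Finset.sum_range_succ (fun k => F (k + 1)),
    Finset.range_eq_Ico, Finset.sum_Ico_add' F 0 (k + 1) 1]
  rfl

lemma card_reducedResidues {q : ℕ} (hq : 0 < q) : (reducedResidues q).card = q.totient := by
  rw [reducedResidues, Nat.totient_eq_card_coprime, Finset.card_filter, Finset.card_filter,
    sum_Icc_eq_sum_range hq (by simp)]
  simp only [Nat.coprime_comm]

end Totient

section CharSum

/-- The character sum `∑_{r mod q} χ(r) e(ra/q)`. -/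
def charSum {q : ℕ} (χ : DirichletCharacter ℂ q) (a : ℕ) : ℂ :=
  ∑ r ∈ Finset.range q, χ (r : ZMod q) * Complex.exp (2 * Real.pi * Complex.I * r * a / q)

lemma changeLevel_natCast {q N : ℕ} (h : q ∣ N) (χ : DirichletCharacter ℂ q) (r : ℕ) :
    DirichletCharacter.changeLevel h χ (r : ZMod N) = if r.Coprime N then χ (r : ZMod q) else 0 := by
  split_ifs with hr
  · have := DirichletCharacter.changeLevel_eq_cast_of_dvd' χ h (a := r)
      (Nat.isCoprime_iff_coprime.2 hr)
    simpa using this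
  · exact MulChar.map_nonunit _ fun hu => hr ((ZMod.isUnit_iff_coprime r N).1 hu)

lemma sum_range_add_right_of_periodic {F : ℕ → ℂ} {N : ℕ} (hF : ∀ r, F (r + N) = F r) (k : ℕ) :
    ∑ r ∈ Finset.range N, F (r + k) = ∑ r ∈ Finset.range N, F r := by
  induction k with
  | zero => rfl
  | succ k ih =>
    have h1 := Finset.sum_range_succ (fun r => F (r + k)) N
    rw [Finset.sum_range_succ', add_comm N k, hF, zero_add] at h1
    rw [← ih, ← add_right_cancel h1]
    exact Finset.sum_congr rfl fun r _ => by rw [add_assoc, add_comm 1 k]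

lemma exp_eq_one_iff_dvd {p a : ℕ} (hp : 0 < p) :
    Complex.exp (2 * Real.pi * Complex.I * a / p) = 1 ↔ p ∣ a := by
  have h := (Complex.isPrimitiveRoot_exp p hp.ne').pow_eq_one_iff_dvd a
  rw [← h, ← Complex.exp_nat_mul]
  congr! 2
  ring

/-- Shifting r by q preserves the sum over a full period but multiplies it by e(a/p) ≠ 1. -/
lemma sum_mul_exp_eq_zero {g : ℕ → ℂ} {q p a : ℕ} (hq : 0 < q) (hp : 0 < p)
    (hg : ∀ r, g (r + q) = g r) (ha : ¬ p ∣ a) :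
    ∑ r ∈ Finset.range (q * p), g r *
      Complex.exp (2 * Real.pi * Complex.I * r * a / (q * p : ℕ)) = 0 := by
  set F : ℕ → ℂ := fun r => g r * Complex.exp (2 * Real.pi * Complex.I * r * a / (q * p : ℕ))
    with hF
  have hq' : (q : ℂ) ≠ 0 := by exact_mod_cast hq.ne'
  have hp' : (p : ℂ) ≠ 0 := by exact_mod_cast hp.ne'
  have hgk : ∀ k r, g (r + q * k) = g r := by
    intro k
    induction k with
    | zero => simp
    | succ k ih => intro r; rw [Nat.mul_succ, ← add_assoc, hg, ih]
  have hper : ∀ r, F (r + q * p) = F r := by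
    intro r
    simp only [hF]
    rw [hgk, Complex.exp_eq_exp_iff_exists_int.2 ⟨a, ?_⟩]
    push_cast
    field_simp
  have hshift : ∀ r, F (r + q) = Complex.exp (2 * Real.pi * Complex.I * a / p) * F r := by
    intro r
    simp only [hF]
    rw [hg, mul_left_comm, ← Complex.exp_add]
    congr 2
    push_cast
    field_simp
    ring
  have h1 := sum_range_add_right_of_periodic hper q
  simp only [hshift] at h1
  rw [← Finset.mul_sum] at h1
  have h2 : (Complex.exp (2 * Real.pi * Complex.I * a / p) - 1) *
      ∑ r ∈ Finset.range (q * p), F r = 0 := by rw [sub_mul, h1, one_mul, sub_self]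
  exact (mul_eq_zero.1 h2).resolve_left (sub_ne_zero.2 fun h => ha ((exp_eq_one_iff_dvd hp).1 h))

/-- The lifted character is χ with the multiples of p removed. The sum of χ over all r modulo qp
vanishes, and the multiples of p contribute χ(p) times the old character sum. If p divides q, then
χ(p) = 0. -/
lemma norm_charSum_changeLevel_mul_prime_le {q p a : ℕ} (hq : 0 < q) (hp : p.Prime)
    (χ : DirichletCharacter ℂ q) (ha : ¬ p ∣ a) :
    ‖charSum (DirichletCharacter.changeLevel (Dvd.intro p rfl : q ∣ q * p) χ) a‖
      ≤ ‖charSum χ a‖ := by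
  have hq' : (q : ℂ) ≠ 0 := by exact_mod_cast hq.ne'
  have hp' : (p : ℂ) ≠ 0 := by exact_mod_cast hp.pos.ne'
  set e : ℕ → ℂ := fun r => Complex.exp (2 * Real.pi * Complex.I * r * a / (q * p : ℕ)) with he
  have h0 : ∑ r ∈ Finset.range (q * p), χ (r : ZMod q) * e r = 0 :=
    sum_mul_exp_eq_zero hq hp.pos (g := fun r => χ (r : ZMod q)) (fun r => by simp) ha
  have hval : ∀ r : ℕ, DirichletCharacter.changeLevel (Dvd.intro p rfl : q ∣ q * p) χ
      (r : ZMod (q * p)) = χ (r : ZMod q) - if p ∣ r then χ (r : ZMod q) else 0 := by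
    intro r
    have hc : r.Coprime (q * p) ↔ r.Coprime q ∧ ¬ p ∣ r := by
      rw [Nat.coprime_mul_iff_right, Nat.coprime_comm (n := r) (m := p), hp.coprime_iff_not_dvd]
    rw [changeLevel_natCast]
    simp only [hc]
    by_cases hr : r.Coprime q
    · by_cases hpr : p ∣ r <;> simp [hr, hpr]
    · have : χ (r : ZMod q) = 0 :=
        MulChar.map_nonunit _ fun hu => hr ((ZMod.isUnit_iff_coprime r q).1 hu)
      simp [hr, this]
  have h1 : charSum (DirichletCharacter.changeLevel (Dvd.intro p rfl : q ∣ q * p) χ) a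
      = - ∑ r ∈ (Finset.range (q * p)).filter (p ∣ ·), χ (r : ZMod q) * e r := by
    suffices h : charSum (DirichletCharacter.changeLevel (Dvd.intro p rfl : q ∣ q * p) χ) a
        = ∑ r ∈ Finset.range (q * p), χ (r : ZMod q) * e r
          - ∑ r ∈ (Finset.range (q * p)).filter (p ∣ ·), χ (r : ZMod q) * e r by
      rw [h, h0, zero_sub]
    rw [Finset.sum_filter, ← Finset.sum_sub_distrib, charSum]
    refine Finset.sum_congr rfl fun r _ => ?_
    rw [hval, sub_mul, ite_mul, zero_mul]
  have h2 : ∑ r ∈ (Finset.range (q * p)).filter (p ∣ ·), χ (r : ZMod q) * e r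
      = χ (p : ZMod q) * charSum χ a := by
    rw [charSum, Finset.mul_sum]
    symm
    refine Finset.sum_bij (fun r _ => p * r) ?_ ?_ ?_ ?_
    · intro r hr
      rw [Finset.mem_range] at hr
      rw [Finset.mem_filter, Finset.mem_range, mul_comm q]
      exact ⟨Nat.mul_lt_mul_of_pos_left hr hp.pos, Dvd.intro _ rfl⟩
    · intro r _ r' _ h
      exact Nat.eq_of_mul_eq_mul_left hp.pos h
    · intro r hr
      simp only [Finset.mem_filter, Finset.mem_range] at hr
      obtain ⟨hr, k, rfl⟩ := hr
      refine ⟨k, Finset.mem_range.2 ?_, rfl⟩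
      rw [mul_comm q] at hr
      exact Nat.lt_of_mul_lt_mul_left hr
    · intro r _
      have h : e (p * r) = Complex.exp (2 * Real.pi * Complex.I * r * a / q) := by
        simp only [he]
        congr 1
        push_cast
        field_simp
      rw [h, Nat.cast_mul, map_mul]
      ring
  rw [h1, h2, norm_neg, norm_mul]
  exact mul_le_of_le_one_left (norm_nonneg _) (χ.norm_le_one _)

lemma charSum_eq_sum_stdAddChar {q : ℕ} [NeZero q] (χ : DirichletCharacter ℂ q) (a : ℕ) :
    charSum χ a = ∑ x : ZMod q, χ x * ZMod.stdAddChar (x * (a : ZMod q)) := by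
  rw [charSum]
  symm
  refine Finset.sum_bij (fun x _ => x.val) (fun x _ => Finset.mem_range.2 x.val_lt)
    (fun x _ y _ h => ZMod.val_injective q h)
    (fun r hr => ⟨(r : ZMod q), Finset.mem_univ _, ZMod.val_cast_of_lt (Finset.mem_range.1 hr)⟩)
    fun x _ => ?_
  have h : (x * (a : ZMod q) : ZMod q) = (((x.val : ℤ) * (a : ℤ) : ℤ) : ZMod q) := by
    push_cast; rw [ZMod.natCast_zmod_val]
  rw [ZMod.natCast_zmod_val, h, ZMod.stdAddChar_coe]
  congr 2
  push_cast
  ring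

/-- Parseval on ℤ/q. -/
lemma sum_norm_sq_sum_stdAddChar {q : ℕ} [NeZero q] (v : ZMod q → ℂ) :
    ∑ b : ZMod q, ‖∑ x : ZMod q, v x * ZMod.stdAddChar (x * b)‖ ^ 2 = q * ∑ x, ‖v x‖ ^ 2 := by
  have hconj : ∀ x : ZMod q, (starRingEnd ℂ) (ZMod.stdAddChar x) = ZMod.stdAddChar (-x) := by
    intro x
    rw [AddChar.map_neg_eq_conj]
  have key : ((∑ b : ZMod q, ‖∑ x : ZMod q, v x * ZMod.stdAddChar (x * b)‖ ^ 2 : ℝ) : ℂ)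
      = ((q * ∑ x, ‖v x‖ ^ 2 : ℝ) : ℂ) := by
    push_cast
    simp only [← Complex.mul_conj', map_sum, map_mul, Finset.sum_mul_sum, hconj]
    rw [Finset.sum_comm, Finset.mul_sum]
    refine Finset.sum_congr rfl fun x _ => ?_
    rw [Finset.sum_comm, Finset.sum_eq_single x]
    · rw [Finset.sum_congr rfl (g := fun _ => v x * (starRingEnd ℂ) (v x))]
      · simp [ZMod.card]
      · intro b _
        have : ZMod.stdAddChar (x * b) * ZMod.stdAddChar (-(x * b)) = (1 : ℂ) := by
          rw [← AddChar.map_add_eq_mul, add_neg_cancel, AddChar.map_zero_eq_one]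
        linear_combination (v x * (starRingEnd ℂ) (v x)) * this
    · intro y _ hy
      have h1 : ∑ b : ZMod q, ZMod.stdAddChar (b * (x - y)) = (0 : ℂ) := by
        rw [AddChar.sum_mulShift _ (ZMod.isPrimitive_stdAddChar q),
          if_neg (sub_ne_zero.2 (Ne.symm hy)), Nat.cast_zero]
      rw [← mul_zero (v x * (starRingEnd ℂ) (v y)), ← h1, Finset.mul_sum]
      refine Finset.sum_congr rfl fun b _ => ?_
      rw [show b * (x - y) = x * b + -(y * b) by ring, AddChar.map_add_eq_mul]
      ring
    · simp
  exact_mod_cast key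

/-- No primitivity is needed: the transform T has the same modulus at all φ(q) units, and Parseval
bounds its total energy by qφ(q). -/
lemma norm_charSum_sq_le {q a : ℕ} [NeZero q] (χ : DirichletCharacter ℂ q) (ha : a.Coprime q) :
    ‖charSum χ a‖ ^ 2 ≤ q := by
  set T : ZMod q → ℂ := fun b => ∑ x : ZMod q, χ x * ZMod.stdAddChar (x * b) with hT
  have hunit : ∀ u : (ZMod q)ˣ, ‖T u‖ = ‖T 1‖ := by
    intro u
    have h := gaussSum_mulShift χ (ZMod.stdAddChar : AddChar (ZMod q) ℂ) u
    have e1 : T u = _root_.gaussSum χ ((ZMod.stdAddChar : AddChar (ZMod q) ℂ).mulShift u) := by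
      simp only [hT, _root_.gaussSum, AddChar.mulShift_apply, mul_comm]
    have e2 : T 1 = _root_.gaussSum χ (ZMod.stdAddChar : AddChar (ZMod q) ℂ) := by
      simp only [hT, _root_.gaussSum, mul_one]
    rw [e2, ← h, norm_mul, ← e1]
    rw [DirichletCharacter.unit_norm_eq_one, one_mul]
  have hsum := sum_norm_sq_sum_stdAddChar (q := q) χ
  have h1 : (q.totient : ℝ) * ‖T 1‖ ^ 2 ≤ ∑ b : ZMod q, ‖T b‖ ^ 2 := by
    calc (q.totient : ℝ) * ‖T 1‖ ^ 2 = ∑ u : (ZMod q)ˣ, ‖T u‖ ^ 2 := by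
          simp only [hunit, Finset.sum_const, Finset.card_univ, ZMod.card_units_eq_totient,
            nsmul_eq_mul]
      _ = ∑ b ∈ Finset.univ.image (fun u : (ZMod q)ˣ => (u : ZMod q)), ‖T b‖ ^ 2 := by
          rw [Finset.sum_image fun u _ v _ h => Units.ext h]
      _ ≤ _ := Finset.sum_le_sum_of_subset_of_nonneg (Finset.subset_univ _) fun _ _ _ => by
          positivity
  have h2 : ∑ x : ZMod q, ‖χ x‖ ^ 2 = q.totient := by
    rw [← Finset.sum_subset (Finset.subset_univ
        (Finset.univ.image (fun u : (ZMod q)ˣ => (u : ZMod q)))) fun x _ hx => ?_,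
      Finset.sum_image fun u _ v _ h => Units.ext h]
    · simp [ZMod.card_units_eq_totient]
    · rw [MulChar.map_nonunit, norm_zero, zero_pow two_ne_zero]
      rintro ⟨u, rfl⟩
      exact hx (Finset.mem_image_of_mem _ (Finset.mem_univ u))
  rw [hsum, h2] at h1
  have hpos : (0 : ℝ) < q.totient := by exact_mod_cast Nat.totient_pos.2 (NeZero.pos q)
  have h3 : ‖T 1‖ ^ 2 ≤ q := by
    refine le_of_mul_le_mul_left (h1.trans (le_of_eq (mul_comm _ _))) hpos
  rw [charSum_eq_sum_stdAddChar]
  obtain ⟨u, hu⟩ := (ZMod.isUnit_iff_coprime a q).2 ha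
  rw [← hu]
  change ‖T u‖ ^ 2 ≤ _
  rw [hunit]
  exact h3

/-- The prime factors of N/f are added to the level one at a time, and none of these steps increases
the sum. Applied to the primitive character, this replaces the modulus by the conductor. -/
lemma norm_charSum_changeLevel_le {f : ℕ} [NeZero f] (ψ : DirichletCharacter ℂ f) (m : ℕ) :
    ∀ (N : ℕ) (h : f ∣ N), N = f * m → 0 < m → ∀ a : ℕ, a.Coprime N →
      ‖charSum (DirichletCharacter.changeLevel h ψ) a‖ ^ 2 ≤ f := by
  induction m using induction_on_primes with
  | zero => intro N h e hm; omega
  | one =>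
    intro N h e _ a ha
    rw [mul_one] at e
    subst e
    rw [DirichletCharacter.changeLevel_self]
    exact norm_charSum_sq_le ψ ha
  | prime_mul p m hp ih =>
    intro N h e hm a ha
    have hm' : 0 < m := Nat.pos_of_mul_pos_left hm
    obtain rfl : N = f * m * p := by rw [e]; ring
    have h1 : f ∣ f * m := Dvd.intro m rfl
    have h2 : f * m ∣ f * m * p := Dvd.intro p rfl
    rw [show DirichletCharacter.changeLevel h ψ = DirichletCharacter.changeLevel h2
      (DirichletCharacter.changeLevel h1 ψ) from DirichletCharacter.changeLevel_trans ψ h1 h2]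
    have hap := (Nat.coprime_mul_iff_right.1 ha)
    refine le_trans ?_ (ih (f * m) h1 rfl hm' a hap.1)
    have := norm_charSum_changeLevel_mul_prime_le (q := f * m)
      (Nat.mul_pos (NeZero.pos f) hm') hp (DirichletCharacter.changeLevel h1 ψ)
      ((hp.coprime_iff_not_dvd).1 hap.2.symm)
    gcongr

lemma norm_charSum_sq_le_conductor {q a : ℕ} [NeZero q] (χ : DirichletCharacter ℂ q)
    (ha : a.Coprime q) : ‖charSum χ a‖ ^ 2 ≤ χ.conductor := by
  have : NeZero χ.conductor := ⟨DirichletCharacter.conductor_ne_zero χ⟩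
  obtain ⟨m, hm⟩ := χ.conductor_dvd_level
  have hq := NeZero.pos q
  have h := norm_charSum_changeLevel_le χ.primitiveCharacter m q χ.conductor_dvd_level hm
    (Nat.pos_of_ne_zero fun h => by rw [h, mul_zero] at hm; omega) a ha
  rwa [DirichletCharacter.changeLevel_primitiveCharacter] at h

lemma gaussSum_eq_charSum {q : ℕ} (hq : 0 < q) (χ : DirichletCharacter ℂ q) (a : ℕ) :
    gaussSum χ a = (1 / (Nat.totient q : ℂ)) * charSum χ a := by
  rw [gaussSum, charSum, ← sum_Icc_eq_sum_range hq, reducedResidues, Finset.sum_filter]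
  · congr 1
    refine Finset.sum_congr rfl fun r _ => ?_
    split_ifs with h
    · rfl
    · rw [MulChar.map_nonunit _ fun hu => h ((ZMod.isUnit_iff_coprime r q).1 hu), zero_mul]
  · have hq' : (q : ℂ) ≠ 0 := by exact_mod_cast hq.ne'
    rw [ZMod.natCast_self, Nat.cast_zero, Complex.exp_eq_exp_iff_exists_int.2 ⟨a, ?_⟩]
    push_cast
    field_simp
    ring

lemma norm_gaussSum_sq_le {q a : ℕ} [NeZero q] (χ : DirichletCharacter ℂ q) (ha : a.Coprime q) :
    ‖gaussSum χ a‖ ^ 2 ≤ χ.conductor / (q.totient : ℝ) ^ 2 := by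
  rw [gaussSum_eq_charSum (NeZero.pos q), norm_mul, mul_pow, norm_div, norm_one,
    Complex.norm_natCast, div_pow, one_pow, div_mul_eq_mul_div, one_mul]
  gcongr
  exact norm_charSum_sq_le_conductor χ ha

lemma norm_gaussSum_le_one {q : ℕ} (hq : 0 < q) (χ : DirichletCharacter ℂ q) (a : ℕ) :
    ‖gaussSum χ a‖ ≤ 1 := by
  have hpos : (0 : ℝ) < q.totient := by exact_mod_cast Nat.totient_pos.2 hq
  rw [gaussSum, norm_mul, norm_div, norm_one, Complex.norm_natCast, div_mul_eq_mul_div, one_mul,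
    div_le_one hpos]
  refine (norm_sum_le _ _).trans ?_
  rw [← card_reducedResidues hq, Finset.card_eq_sum_ones, Nat.cast_sum]
  refine Finset.sum_le_sum fun r _ => ?_
  rw [norm_mul, show 2 * Real.pi * Complex.I * r * a / q
    = ((2 * Real.pi * r * a / q : ℝ) : ℂ) * Complex.I by push_cast; ring,
    Complex.norm_exp_ofReal_mul_I, mul_one]
  simpa using χ.norm_le_one _

/-- One modulus contributes at most f/φ(q) ≤ f(s+1)/2^s. All moduli are multiples of f, so there are
at most 2^(s+1)/f of them, and f cancels. -/
lemma sum_norm_gaussSum_sq_le {s f : ℕ} (Q : Finset ℕ) (hQ : ∀ q ∈ Q, 2 ^ s ≤ q ∧ q < 2 ^ (s + 1))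
    (χ : ∀ q : ℕ, DirichletCharacter ℂ q) (hχ : ∀ q ∈ Q, (χ q).conductor = f) :
    ∑ q ∈ Q, ∑ a ∈ reducedResidues q, ‖gaussSum (χ q) a‖ ^ 2 ≤ 2 * (s + 1) := by
  rcases Q.eq_empty_or_nonempty with rfl | ⟨q₀, hq₀⟩
  · simp; positivity
  have hpos : ∀ q ∈ Q, 0 < q := fun q hq => lt_of_lt_of_le (by positivity) (hQ q hq).1
  have hf : 0 < f := by
    rw [← hχ q₀ hq₀]
    have : NeZero q₀ := ⟨(hpos q₀ hq₀).ne'⟩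
    exact Nat.pos_of_ne_zero (DirichletCharacter.conductor_ne_zero _)
  have hf' : (0 : ℝ) < f := by exact_mod_cast hf
  have hterm : ∀ q ∈ Q, ∑ a ∈ reducedResidues q, ‖gaussSum (χ q) a‖ ^ 2
      ≤ f * (s + 1) / 2 ^ s := by
    intro q hq
    have hq0 := hpos q hq
    have : NeZero q := ⟨hq0.ne'⟩
    have hφ : (0 : ℝ) < q.totient := by exact_mod_cast Nat.totient_pos.2 hq0
    have h1 : (2 : ℝ) ^ s ≤ (s + 1) * q.totient := by
      exact_mod_cast (hQ q hq).1.trans (le_mul_totient hq0 (hQ q hq).2)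
    calc ∑ a ∈ reducedResidues q, ‖gaussSum (χ q) a‖ ^ 2
        ≤ ∑ a ∈ reducedResidues q, (f : ℝ) / (q.totient : ℝ) ^ 2 := by
          refine Finset.sum_le_sum fun a ha => ?_
          rw [← hχ q hq]
          exact norm_gaussSum_sq_le _ (Finset.mem_filter.1 ha).2
      _ = f / q.totient := by
          rw [Finset.sum_const, card_reducedResidues hq0, nsmul_eq_mul]
          field_simp
      _ ≤ _ := by
          rw [div_le_div_iff₀ hφ (by positivity)]
          nlinarith
  have hcard : (Q.card : ℝ) * f ≤ 2 ^ (s + 1) := by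
    have h1 : Q ⊆ (Finset.Ioc 0 (2 ^ (s + 1))).filter (f ∣ ·) := by
      intro q hq
      rw [Finset.mem_filter, Finset.mem_Ioc]
      refine ⟨⟨hpos q hq, (hQ q hq).2.le⟩, ?_⟩
      rw [← hχ q hq]
      exact DirichletCharacter.conductor_dvd_level _
    have h2 := Finset.card_le_card h1
    rw [Nat.Ioc_filter_dvd_card_eq_div] at h2
    exact_mod_cast (Nat.mul_le_mul_right f h2).trans (Nat.div_mul_le_self _ _)
  refine (Finset.sum_le_sum hterm).trans ?_
  rw [Finset.sum_const, nsmul_eq_mul, mul_div_assoc', div_le_iff₀ (by positivity)]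
  rw [pow_succ] at hcard
  nlinarith [show (0 : ℝ) ≤ s by positivity]

lemma farey_isFareyFamily {Q : ℕ} (I : Finset (ℕ × ℕ))
    (hI : ∀ p ∈ I, 0 < p.1 ∧ p.1 < Q ∧ p.2 ∈ reducedResidues p.1) :
    IsFareyFamily Q I fun p => Complex.exp (2 * Real.pi * Complex.I * p.2 / p.1) where
  root p hp := by
    obtain ⟨h1, h2, h3⟩ := hI p hp
    refine ⟨p.1, h1, h2.le, ?_⟩
    have h1' : (p.1 : ℂ) ≠ 0 := by exact_mod_cast h1.ne'
    rw [← Complex.exp_nat_mul, Complex.exp_eq_one_iff]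
    refine ⟨p.2, ?_⟩
    push_cast
    field_simp
  inj := by
    rintro ⟨q, a⟩ hp ⟨q', a'⟩ hp' h
    obtain ⟨h1, h2, h3⟩ := hI _ hp
    obtain ⟨h1', h2', h3'⟩ := hI _ hp'
    simp only [reducedResidues, Finset.mem_filter, Finset.mem_Icc] at h1 h3 h1' h3' h
    obtain ⟨k, hk⟩ := Complex.exp_eq_exp_iff_exists_int.1 h
    have hq : (q : ℂ) ≠ 0 := by exact_mod_cast h1.ne'
    have hq' : (q' : ℂ) ≠ 0 := by exact_mod_cast h1'.ne'
    have hpi : (Real.pi : ℂ) ≠ 0 := by exact_mod_cast Real.pi_ne_zero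
    have hk' : (a : ℤ) * q' = a' * q + k * (q * q') := by
      have : (a : ℂ) * q' = a' * q + k * (q * q') := by
        field_simp at hk
        linear_combination hk
      exact_mod_cast this
    obtain ⟨⟨ha1, ha2⟩, ha3⟩ := h3
    obtain ⟨⟨ha1', ha2'⟩, ha3'⟩ := h3'
    -- Both fractions lie in (0, 1], so their integral difference is zero.
    have hk0 : k = 0 := by
      have e1 : (a : ℤ) * q' ≤ q * q' := by exact_mod_cast Nat.mul_le_mul_right q' ha2
      have e2 : (a' : ℤ) * q ≤ q' * q := by exact_mod_cast Nat.mul_le_mul_right q ha2'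
      have e3 : (0 : ℤ) < a * q' := by exact_mod_cast Nat.mul_pos ha1 h1'
      have e4 : (0 : ℤ) < a' * q := by exact_mod_cast Nat.mul_pos ha1' h1
      have e5 : (0 : ℤ) < q * q' := by exact_mod_cast Nat.mul_pos h1 h1'
      have e6 : k < 1 := by
        by_contra! hk1
        nlinarith
      have e7 : -1 < k := by
        by_contra! hk1
        nlinarith
      omega
    have hk2 : a * q' = a' * q := by
      rw [hk0, zero_mul, add_zero] at hk'
      exact_mod_cast hk'
    have d1 : q ∣ q' := ha3.symm.dvd_of_dvd_mul_left (Dvd.intro_left a' hk2.symm)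
    have d2 : q' ∣ q := ha3'.symm.dvd_of_dvd_mul_left (Dvd.intro_left a hk2)
    obtain rfl := Nat.dvd_antisymm d1 d2
    rw [Nat.eq_of_mul_eq_mul_right h1 hk2]
  card_le := by
    have h1 : I ⊆ Finset.range Q ×ˢ Finset.Icc 1 Q := by
      intro p hp
      obtain ⟨h1, h2, h3⟩ := hI p hp
      simp only [reducedResidues, Finset.mem_filter, Finset.mem_Icc] at h3
      simp only [Finset.mem_product, Finset.mem_range, Finset.mem_Icc]
      omega
    refine (Finset.card_le_card h1).trans ?_
    rw [Finset.card_product, Finset.card_range, Nat.card_Icc, Nat.add_sub_cancel, sq]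

end CharSum

end

end PrimeMultiplier

/-! ### Logarithmic derivatives and zeros in a disc. -/

namespace PrimeMultiplier

noncomputable section

open Complex Metric Filter Topology

section LogDerivative

lemma exists_factorization {g : ℂ → ℂ} {R : ℝ} (hR : 0 < R)
    (hg : AnalyticOnNhd ℂ g (closedBall 0 R)) (h0 : g 0 ≠ 0) :
    ∃ (s : Finset ℂ) (n : ℂ → ℕ) (h : ℂ → ℂ), AnalyticOnNhd ℂ h (closedBall 0 R) ∧
      (∀ z ∈ closedBall (0 : ℂ) R, h z ≠ 0) ∧
      (∀ z ∈ closedBall (0 : ℂ) R, g z = (∏ u ∈ s, (z - u) ^ n u) * h z) ∧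
      ∀ u ∈ s, u ∈ closedBall (0 : ℂ) R ∧ 0 < n u := by
  classical
  set U : Set ℂ := closedBall 0 R with hU
  have h0U : (0 : ℂ) ∈ U := mem_closedBall_self hR.le
  have hpre : IsPreconnected U := (convex_closedBall _ _).isPreconnected
  have hord : ∀ u : U, meromorphicOrderAt g u ≠ ⊤ := by
    refine (hg.meromorphicOn.exists_meromorphicOrderAt_ne_top_iff_forall
      ⟨⟨0, h0U⟩, hpre⟩).1 ⟨⟨0, h0U⟩, ?_⟩
    rw [(hg 0 h0U).meromorphicOrderAt_eq, (hg 0 h0U).analyticOrderAt_eq_zero.2 h0]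
    simp
  set D := MeromorphicOn.divisor g U with hD
  have hfin : D.support.Finite := D.finiteSupport (isCompact_closedBall _ _)
  obtain ⟨h, hh1, hh2, hh3⟩ := hg.meromorphicOn.extract_zeros_poles hord hfin
  have hDnn : ∀ u, 0 ≤ D u := fun u => MeromorphicOn.AnalyticOnNhd.divisor_nonneg hg u
  have hprod : (∏ᶠ u, (· - u) ^ D u : ℂ → ℂ)
      = fun z => ∏ u ∈ hfin.toFinset, (z - u) ^ (D u).toNat := by
    rw [finprod_eq_prod_of_mulSupport_subset (s := hfin.toFinset)]
    · ext z
      rw [Finset.prod_apply]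
      refine Finset.prod_congr rfl fun u _ => ?_
      rw [Pi.pow_apply, ← zpow_natCast, Int.toNat_of_nonneg (hDnn u)]
    · intro u hu
      rw [Set.Finite.coe_toFinset, Function.mem_support]
      intro h
      apply hu
      simp only
      rw [show D u = 0 from h, zpow_zero]
  refine ⟨hfin.toFinset, fun u => (D u).toNat, h, hh1, fun z hz => hh2 ⟨z, hz⟩, ?_, ?_⟩
  · intro z hz
    -- The extraction of zeros gives the factorization only off a discrete set; continuity of both
    -- sides extends it to every point of the disc.
    have hP : AnalyticAt ℂ (fun z => (∏ u ∈ hfin.toFinset, (z - u) ^ (D u).toNat) * h z) z := by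
      have := hh1 z hz
      fun_prop
    have hacc : AccPt z (𝓟 U) := by
      refine hpre.preperfect_of_nontrivial ⟨0, h0U, (R : ℂ), ?_, ?_⟩ z hz
      · simp [hU, abs_of_pos hR]
      · exact_mod_cast hR.ne
    have h1 := (hg z hz).meromorphicAt.eventuallyEq_nhdsNE_of_eventuallyEq_codiscreteWithin
      (g := fun z => (∏ u ∈ hfin.toFinset, (z - u) ^ (D u).toNat) * h z) hP.meromorphicAt hz hacc
      (by rw [hprod] at hh3; exact hh3)
    exact ((hg z hz).continuousAt.eventuallyEq_nhds_iff_eventuallyEq_nhdsNE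
      hP.continuousAt).1 h1 |>.eq_of_nhds
  · intro u hu
    rw [Set.Finite.mem_toFinset, Function.mem_support] at hu
    have hu' : u ∈ U := D.supportWithinDomain hu
    refine ⟨hu', ?_⟩
    change 0 < (D u).toNat
    have := hDnn u
    change D u ≠ 0 at hu
    omega

/-- A zero-free function on a disc has a controlled logarithmic derivative at the centre. -/
lemma norm_logDeriv_le_of_ne_zero {G : ℂ → ℂ} {R M : ℝ} (hR : 0 < R) (hM : 0 < M)
    (hG : DifferentiableOn ℂ G (ball 0 R)) (h0 : ∀ z ∈ ball (0 : ℂ) R, G z ≠ 0)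
    (hb : ∀ z ∈ ball (0 : ℂ) R, ‖G z‖ ≤ Real.exp M * ‖G 0‖) :
    ‖deriv G 0 / G 0‖ ≤ 4 * M / R := by
  have hzero : (0 : ℂ) ∈ ball (0 : ℂ) R := mem_ball_self hR
  have hdG : DifferentiableOn ℂ (deriv G) (ball 0 R) := hG.deriv isOpen_ball
  -- F is the branch of log(G/G(0)) vanishing at the centre; the growth hypothesis bounds its real
  -- part by M.
  obtain ⟨F, hF0, hF⟩ := ((hdG.div hG h0).isExactOn_ball).with_val_at 0 0
  have hconst : ∀ z ∈ ball (0 : ℂ) R, G z = G 0 * exp (F z) := by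
    intro z hz
    have hd : ∀ w ∈ ball (0 : ℂ) R, HasDerivAt (fun w => G w * exp (-F w)) 0 w := by
      intro w hw
      have h1 := (hG.differentiableAt (isOpen_ball.mem_nhds hw)).hasDerivAt
      have h2 := (hF w hw).neg.cexp
      refine (h1.mul h2).congr_deriv ?_
      have := h0 w hw
      simp only [Pi.div_apply, Pi.neg_apply]
      field_simp
      ring
    have h3 : G z * exp (-F z) = G 0 * exp (-F 0) := by
      refine (convex_ball (0 : ℂ) R).is_const_of_fderivWithin_eq_zero
        (𝕜 := ℂ) (f := fun w => G w * exp (-F w)) ?_ ?_ hz hzero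
      · exact fun w hw => (hd w hw).differentiableAt.differentiableWithinAt
      · intro w hw
        rw [fderivWithin_of_isOpen isOpen_ball hw]
        ext
        simpa using (hd w hw).deriv
    rw [hF0, neg_zero, exp_zero, mul_one] at h3
    rw [← h3, mul_assoc, ← exp_add, neg_add_cancel, exp_zero, mul_one]
  have hre : Set.MapsTo F (ball 0 R) {z | z.re ≤ M} := by
    intro z hz
    have h1 := hb z hz
    rw [hconst z hz, norm_mul, norm_exp, mul_comm] at h1
    have h2 := le_of_mul_le_mul_right h1 (norm_pos_iff.2 (h0 0 hzero))
    exact Real.exp_le_exp.1 h2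
  have hdF : DifferentiableOn ℂ F (ball 0 R) :=
    fun z hz => (hF z hz).differentiableAt.differentiableWithinAt
  -- Borel–Carathéodory at half the radius; Cauchy's estimate then gives 2M/(R/2) = 4M/R.
  have hbound : ∀ z ∈ sphere (0 : ℂ) (R / 2), ‖F z‖ ≤ 2 * M := by
    intro z hz
    have hz' : ‖z‖ = R / 2 := by simpa using hz
    have h1 := borelCaratheodory_zero hM hdF hre hR (z := z)
      (by rw [mem_ball_zero_iff, hz']; linarith) hF0
    rw [hz'] at h1
    refine h1.trans (le_of_eq ?_)
    field_simp
    ring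
  have h4 := norm_deriv_le_of_forall_mem_sphere_norm_le (c := (0 : ℂ)) (R := R / 2) (f := F)
    (by positivity) ?_ hbound
  · rw [(hF 0 hzero).deriv] at h4
    refine h4.trans (le_of_eq ?_)
    field_simp
    ring
  · refine (hdF.mono ?_).diffContOnCl
    rw [closure_ball _ (by positivity)]
    exact closedBall_subset_ball (by linarith)

/-- Lower bound for the logarithmic derivative at the centre of a disc all of whose zeros lie in
the left half of the disc. -/
lemma re_logDeriv_ge {g : ℂ → ℂ} {R M : ℝ} (hR : 0 < R) (hM : 0 < M)
    (hg : AnalyticOnNhd ℂ g (closedBall 0 R)) (h0 : g 0 ≠ 0)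
    (hb : ∀ z ∈ closedBall (0 : ℂ) R, ‖g z‖ ≤ Real.exp M * ‖g 0‖)
    (hleft : ∀ z ∈ closedBall (0 : ℂ) R, g z = 0 → z.re ≤ 0)
    (Z : Finset ℂ) (hZ : ∀ z ∈ Z, z ∈ closedBall (0 : ℂ) R ∧ g z = 0) :
    ∑ z ∈ Z, (-z.re) * (1 / ‖z‖ ^ 2 - 1 / R ^ 2) - 4 * M / R ≤ (deriv g 0 / g 0).re := by
  obtain ⟨s, n, h, hh1, hh2, hh3, hs⟩ := exists_factorization hR hg h0
  have hzero : (0 : ℂ) ∈ closedBall (0 : ℂ) R := mem_closedBall_self hR.le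
  have hR' : (R : ℂ) ≠ 0 := by exact_mod_cast hR.ne'
  have hzs : ∀ u ∈ s, g u = 0 := by
    intro u hu
    rw [hh3 u (hs u hu).1, Finset.prod_eq_zero hu, zero_mul]
    rw [sub_self, zero_pow (hs u hu).2.ne']
  have hs0 : ∀ u ∈ s, u ≠ 0 := fun u hu h => h0 (h ▸ hzs u hu)
  have hsz : ∀ z ∈ closedBall (0 : ℂ) R, g z = 0 → z ∈ s := by
    intro z hz hgz
    rw [hh3 z hz, mul_eq_zero, or_iff_left (hh2 z hz), Finset.prod_eq_zero_iff] at hgz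
    obtain ⟨u, hu, hzu⟩ := hgz
    rwa [sub_eq_zero.1 ((pow_eq_zero_iff (hs u hu).2.ne').1 hzu)]
  -- Blaschke factors: `B u` has the modulus of z - u on the circle, has no zero in the open disc,
  -- and has modulus R ≥ |u| at the centre. Exchanging them for the linear factors removes the zeros
  -- while keeping the growth bound relative to the value at 0.
  set B : ℂ → ℂ → ℂ := fun u z => (R ^ 2 - (starRingEnd ℂ) u * z) / R with hB
  set G : ℂ → ℂ := fun z => (∏ u ∈ s, B u z ^ n u) * h z with hG
  have hBd : ∀ u, Differentiable ℂ (B u) := by intro u; simp only [hB]; fun_prop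
  have hGd : DifferentiableOn ℂ G (closedBall 0 R) := by
    intro z hz
    have := (hh1 z hz).differentiableAt
    refine DifferentiableAt.differentiableWithinAt ?_
    simp only [hG]
    refine DifferentiableAt.mul (DifferentiableAt.fun_finsetProd fun u _ => ?_) this
    exact ((hBd u) z).pow _
  have hnormB : ∀ u z, ‖z‖ = R → ‖B u z‖ = ‖z - u‖ := by
    intro u z hz
    have e1 : (R : ℂ) ^ 2 = (starRingEnd ℂ) z * z := by
      rw [← Complex.normSq_eq_conj_mul_self, Complex.normSq_eq_norm_sq, hz]; push_cast; rfl
    simp only [hB]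
    rw [e1, ← sub_mul, ← map_sub, norm_div, norm_mul, hz, RCLike.norm_conj, norm_real,
      Real.norm_of_nonneg hR.le, mul_div_cancel_right₀ _ hR.ne']
  have hnorm0 : ‖g 0‖ ≤ ‖G 0‖ := by
    rw [hh3 0 hzero, hG, norm_mul, norm_mul, norm_prod, norm_prod]
    refine mul_le_mul_of_nonneg_right (Finset.prod_le_prod (fun _ _ => norm_nonneg _)
      fun u hu => ?_) (norm_nonneg _)
    rw [norm_pow, norm_pow]
    refine pow_le_pow_left₀ (norm_nonneg _) ?_ _
    have e : B u 0 = R := by simp only [hB]; field_simp; ring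
    rw [e, zero_sub, norm_neg, norm_real, Real.norm_of_nonneg hR.le]
    simpa using (hs u hu).1
  have hGb : ∀ z ∈ ball (0 : ℂ) R, ‖G z‖ ≤ Real.exp M * ‖G 0‖ := by
    intro z hz
    refine Complex.norm_le_of_forall_mem_frontier_norm_le (U := ball 0 R) isBounded_ball ?_ ?_
      (subset_closure hz)
    · refine DifferentiableOn.diffContOnCl ?_
      rwa [closure_ball _ hR.ne']
    · intro w hw
      rw [frontier_ball _ hR.ne'] at hw
      have hw' : ‖w‖ = R := by simpa using hw
      have e : ‖G w‖ = ‖g w‖ := by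
        rw [hh3 w (sphere_subset_closedBall hw), hG, norm_mul, norm_mul, norm_prod, norm_prod]
        simp only [norm_pow, hnormB _ w hw']
      rw [e]
      exact (hb w (sphere_subset_closedBall hw)).trans
        (mul_le_mul_of_nonneg_left hnorm0 (Real.exp_pos M).le)
  have hBne : ∀ u ∈ s, ∀ z ∈ ball (0 : ℂ) R, B u z ≠ 0 := by
    intro u hu z hz h
    simp only [hB, div_eq_zero_iff, hR', or_false] at h
    have h1 : ‖(R : ℂ) ^ 2‖ = ‖u‖ * ‖z‖ := by
      rw [sub_eq_zero.1 h, norm_mul, RCLike.norm_conj]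
    rw [norm_pow, norm_real, Real.norm_of_nonneg hR.le] at h1
    have h2 : ‖u‖ ≤ R := by simpa using (hs u hu).1
    have h3 : ‖z‖ < R := by simpa using hz
    nlinarith [norm_nonneg u, norm_nonneg z]
  have hGne : ∀ z ∈ ball (0 : ℂ) R, G z ≠ 0 := fun z hz =>
    mul_ne_zero (Finset.prod_ne_zero_iff.2 fun u hu => pow_ne_zero _ (hBne u hu z hz))
      (hh2 z (ball_subset_closedBall hz))
  have hmain := norm_logDeriv_le_of_ne_zero hR hM (hGd.mono ball_subset_closedBall) hGne hGb
  have hhd := (hh1 0 hzero).differentiableAt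
  have hzb : (0 : ℂ) ∈ ball (0 : ℂ) R := mem_ball_self hR
  have eG : deriv G 0 / G 0 = ∑ u ∈ s, n u * (-(starRingEnd ℂ) u / R ^ 2) + deriv h 0 / h 0 := by
    change logDeriv G 0 = _
    rw [hG, logDeriv_mul (f := fun z => ∏ u ∈ s, B u z ^ n u) 0
      (Finset.prod_ne_zero_iff.2 fun u hu => pow_ne_zero _ (hBne u hu 0 hzb)) (hh2 0 hzero)
      (DifferentiableAt.fun_finsetProd fun u _ => ((hBd u) 0).pow _) hhd]
    congr 1
    rw [logDeriv_prod]
    · refine Finset.sum_congr rfl fun u hu => ?_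
      rw [logDeriv_fun_pow ((hBd u) 0)]
      congr 1
      have hd : HasDerivAt (B u) ((0 - (starRingEnd ℂ) u * 1) / R) 0 :=
        (((hasDerivAt_id (0 : ℂ)).const_mul _).const_sub _ |>.div_const _).congr_deriv (by ring)
      rw [logDeriv_apply, hd.deriv]
      simp only [hB]
      field_simp
      ring
    · exact fun u hu => pow_ne_zero _ (hBne u hu 0 hzb)
    · exact fun u hu => ((hBd u) 0).pow _
  have eg : deriv g 0 / g 0 = ∑ u ∈ s, n u * (-1 / u) + deriv h 0 / h 0 := by
    have hev : g =ᶠ[𝓝 0] fun z => (∏ u ∈ s, (z - u) ^ n u) * h z := by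
      filter_upwards [closedBall_mem_nhds (0 : ℂ) hR] with z hz using hh3 z hz
    have hne : ∀ u ∈ s, (0 : ℂ) - u ≠ 0 := fun u hu => by simpa using hs0 u hu
    rw [hev.deriv_eq, hev.eq_of_nhds]
    change logDeriv (fun z => (∏ u ∈ s, (z - u) ^ n u) * h z) 0 = _
    rw [logDeriv_mul (f := fun z => ∏ u ∈ s, (z - u) ^ n u) 0
      (Finset.prod_ne_zero_iff.2 fun u hu => pow_ne_zero _ (hne u hu)) (hh2 0 hzero)
      (DifferentiableAt.fun_finsetProd fun u _ => (by fun_prop)) hhd]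
    congr 1
    rw [logDeriv_prod]
    · refine Finset.sum_congr rfl fun u hu => ?_
      rw [logDeriv_fun_pow (by fun_prop)]
      congr 1
      have hu0 := hs0 u hu
      have hd : HasDerivAt (fun z : ℂ => z - u) 1 0 := (hasDerivAt_id (0 : ℂ)).sub_const u
      rw [logDeriv_apply, hd.deriv, zero_sub, div_neg, neg_div]
    · exact fun u hu => pow_ne_zero _ (hne u hu)
    · exact fun u hu => by fun_prop
  have hterm : ∀ u, u ≠ 0 → ((-1 / u) - (-(starRingEnd ℂ) u / R ^ 2)).re
      = (-u.re) * (1 / ‖u‖ ^ 2 - 1 / R ^ 2) := by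
    intro u hu
    have e1 : (-1 / u : ℂ) = ((-(1 / ‖u‖ ^ 2) : ℝ) : ℂ) * (starRingEnd ℂ) u := by
      have h1 : u * (starRingEnd ℂ) u = (‖u‖ ^ 2 : ℝ) := by
        rw [Complex.mul_conj, Complex.normSq_eq_norm_sq]
      have h2 : ((‖u‖ ^ 2 : ℝ) : ℂ) ≠ 0 := by
        rw [ofReal_ne_zero]; positivity
      rw [ofReal_neg, ofReal_div, ofReal_one]
      field_simp
      rw [← h1]
    have e2 : (-(starRingEnd ℂ) u / R ^ 2 : ℂ) = ((-(1 / R ^ 2) : ℝ) : ℂ) * (starRingEnd ℂ) u := by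
      push_cast; ring
    rw [e1, e2, ← sub_mul, ← ofReal_sub, re_ofReal_mul, conj_re]
    ring
  have hdiff : (deriv g 0 / g 0).re = (deriv G 0 / G 0).re
      + ∑ u ∈ s, n u * ((-u.re) * (1 / ‖u‖ ^ 2 - 1 / R ^ 2)) := by
    have e : deriv g 0 / g 0 = deriv G 0 / G 0
        + ∑ u ∈ s, n u * ((-1 / u) - (-(starRingEnd ℂ) u / R ^ 2)) := by
      rw [eg, eG]
      simp only [mul_sub, Finset.sum_sub_distrib]
      ring
    rw [e, add_re, re_sum]
    congr 1
    refine Finset.sum_congr rfl fun u hu => ?_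
    rw [← hterm u (hs0 u hu), ← ofReal_natCast, re_ofReal_mul]
  -- All zeros lie in the left half, so every term helps, and zeros outside `Z` and extra
  -- multiplicities may be discarded.
  have hnn : ∀ u ∈ s, 0 ≤ (-u.re) * (1 / ‖u‖ ^ 2 - 1 / R ^ 2) := by
    intro u hu
    refine mul_nonneg (by linarith [hleft u (hs u hu).1 (hzs u hu)]) (sub_nonneg.2 ?_)
    have h1 : 0 < ‖u‖ := norm_pos_iff.2 (hs0 u hu)
    have h2 : ‖u‖ ≤ R := by simpa using (hs u hu).1
    gcongr
  have hsum : ∑ z ∈ Z, (-z.re) * (1 / ‖z‖ ^ 2 - 1 / R ^ 2)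
      ≤ ∑ u ∈ s, n u * ((-u.re) * (1 / ‖u‖ ^ 2 - 1 / R ^ 2)) := by
    calc ∑ z ∈ Z, (-z.re) * (1 / ‖z‖ ^ 2 - 1 / R ^ 2)
        ≤ ∑ u ∈ s, (-u.re) * (1 / ‖u‖ ^ 2 - 1 / R ^ 2) :=
          Finset.sum_le_sum_of_subset_of_nonneg
            (fun z hz => hsz z (hZ z hz).1 (hZ z hz).2) fun u hu _ => hnn u hu
      _ ≤ _ := Finset.sum_le_sum fun u hu => by
          have : (1 : ℝ) ≤ n u := by exact_mod_cast (hs u hu).2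
          nlinarith [hnn u hu]
  have habs := (abs_le.1 ((abs_re_le_norm (deriv G 0 / G 0)).trans hmain)).1
  linarith

end LogDerivative

end

end PrimeMultiplier

/-! ### Growth of Dirichlet L-functions in the right half-plane. -/

namespace PrimeMultiplier

noncomputable section

open Complex Metric Filter Topology MeasureTheory

section LBound

variable {q : ℕ} [NeZero q] {χ : DirichletCharacter ℂ q}

lemma sum_range_character_eq_zero (hχ : χ ≠ 1) : ∑ r ∈ Finset.range q, χ (r : ZMod q) = 0 := by
  have h := charSum_eq_sum_stdAddChar χ 0
  simp only [charSum, Nat.cast_zero, mul_zero, zero_div, exp_zero, mul_one, AddChar.map_zero_eq_one]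
    at h
  rw [h, MulChar.sum_eq_zero_of_ne_one hχ]

lemma norm_sum_character_le (hχ : χ ≠ 1) (n : ℕ) : ‖∑ k ∈ Finset.Icc 1 n, χ (k : ZMod q)‖ ≤ q := by
  induction n using Nat.strong_induction_on with
  | _ n ih =>
    rcases Nat.lt_or_ge n q with h | h
    · refine (norm_sum_le _ _).trans ((Finset.sum_le_sum fun k _ => χ.norm_le_one _).trans ?_)
      simpa using h.le
    · obtain ⟨m, rfl⟩ := Nat.exists_eq_add_of_le' h
      have hq := NeZero.pos q
      have e1 : ∀ N : ℕ, ∑ k ∈ Finset.Icc 1 N, χ (k : ZMod q)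
          = ∑ k ∈ Finset.range N, χ ((k + 1 : ℕ) : ZMod q) := by
        intro N
        rw [Finset.range_eq_Ico, Finset.sum_Ico_add' (fun k : ℕ => χ (k : ZMod q)) 0 N 1]
        rfl
      have e2 : ∑ k ∈ Finset.range q, χ ((m + k + 1 : ℕ) : ZMod q) = 0 := by
        rw [← sum_range_character_eq_zero hχ, ← sum_range_add_right_of_periodic
          (F := fun r => χ (r : ZMod q)) (N := q) (fun r => by simp) (m + 1)]
        exact Finset.sum_congr rfl fun k _ => by rw [show m + k + 1 = k + (m + 1) by ring]
      rw [e1, Finset.sum_range_add, e2, add_zero, ← e1]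
      exact ih m (by omega)

lemma norm_integral_sum_character_le (hχ : χ ≠ 1) {s : ℂ} (hs : 0 < s.re) :
    ‖∫ t in Set.Ioi (1 : ℝ), (∑ k ∈ Finset.Icc 1 ⌊t⌋₊, χ (k : ZMod q)) * (t : ℂ) ^ (-(s + 1))‖
      ≤ q / s.re := by
  have hint : IntegrableOn (fun t : ℝ => (q : ℝ) * t ^ (-s.re - 1)) (Set.Ioi 1) :=
    (integrableOn_Ioi_rpow_of_lt (by linarith) one_pos).const_mul _
  refine (norm_integral_le_of_norm_le hint ?_).trans (le_of_eq ?_)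
  · filter_upwards [ae_restrict_mem measurableSet_Ioi] with t ht
    have ht' : 0 < t := lt_trans one_pos ht
    rw [norm_mul, norm_cpow_eq_rpow_re_of_pos ht', show (-(s + 1)).re = -s.re - 1 by simp; ring]
    exact mul_le_mul_of_nonneg_right (norm_sum_character_le hχ _) (Real.rpow_nonneg ht'.le _)
  · rw [integral_const_mul, integral_Ioi_rpow_of_lt (by linarith) one_pos, Real.one_rpow]
    have := hs.ne'
    rw [show -s.re - 1 + 1 = -s.re by ring]
    field_simp

/-- The integral is the Mellin transform at -s of a bounded function supported on (1, ∞), which is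
holomorphic for Re s > 0. -/
lemma differentiableAt_integral_sum_character (hχ : χ ≠ 1) {s : ℂ} (hs : 0 < s.re) :
    DifferentiableAt ℂ (fun s : ℂ => ∫ t in Set.Ioi (1 : ℝ),
      (∑ k ∈ Finset.Icc 1 ⌊t⌋₊, χ (k : ZMod q)) * (t : ℂ) ^ (-(s + 1))) s := by
  set S : ℝ → ℂ := fun t => ∑ k ∈ Finset.Icc 1 ⌊t⌋₊, χ (k : ZMod q) with hS
  set φ : ℝ → ℂ := (Set.Ioi 1).indicator S with hφ
  have hmeas : Measurable φ :=
    ((measurable_from_top (f := fun n : ℕ => ∑ k ∈ Finset.Icc 1 n, χ (k : ZMod q))).comp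
      Nat.measurable_floor).indicator measurableSet_Ioi
  have hbd : ∀ t, ‖φ t‖ ≤ q := fun t => (norm_indicator_le_norm_self _ _).trans
    (norm_sum_character_le hχ _)
  have hloc : LocallyIntegrableOn φ (Set.Ioi 0) := by
    refine LocallyIntegrable.locallyIntegrableOn ?_ _
    refine (locallyIntegrable_const (q : ℝ)).mono hmeas.aestronglyMeasurable ?_
    exact Eventually.of_forall fun t => (hbd t).trans (le_of_eq (by simp))
  have heq : (fun s : ℂ => ∫ t in Set.Ioi (1 : ℝ), S t * (t : ℂ) ^ (-(s + 1)))
      = fun s => mellin φ (-s) := by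
    ext s
    rw [mellin, ← integral_indicator measurableSet_Ioi, ← integral_indicator measurableSet_Ioi]
    congr 1
    ext t
    by_cases ht : t ∈ Set.Ioi (1 : ℝ)
    · have ht0 : t ∈ Set.Ioi (0 : ℝ) := Set.Ioi_subset_Ioi zero_le_one ht
      rw [Set.indicator_of_mem ht, Set.indicator_of_mem ht0, hφ, Set.indicator_of_mem ht,
        smul_eq_mul, mul_comm, neg_add']
    · rw [Set.indicator_of_notMem ht]
      by_cases ht0 : t ∈ Set.Ioi (0 : ℝ)
      · rw [Set.indicator_of_mem ht0, hφ, Set.indicator_of_notMem ht, smul_zero]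
      · rw [Set.indicator_of_notMem ht0]
  rw [heq]
  have h1 : DifferentiableAt ℂ (mellin φ) (-s) := by
    refine mellin_differentiableAt_of_isBigO_rpow (a := 0) (b := (-s).re - 1) hloc ?_
      (by simpa using hs) ?_ (by linarith)
    · refine Asymptotics.IsBigO.of_bound q (Eventually.of_forall fun t => ?_)
      simpa using hbd t
    · have : φ =ᶠ[𝓝[>] 0] fun _ => 0 := by
        filter_upwards [Ioo_mem_nhdsGT (zero_lt_one (α := ℝ))] with t ht
        exact Set.indicator_of_notMem (by simpa using ht.2.le) _
      exact this.trans_isBigO (Asymptotics.isBigO_zero _ _)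
  exact h1.comp s differentiableAt_id.neg

/-- Partial summation for Re s > 1, extended by the identity theorem. -/
lemma LFunction_eq_mul_integral (hχ : χ ≠ 1) {s : ℂ} (hs : 0 < s.re) :
    DirichletCharacter.LFunction χ s = s * ∫ t in Set.Ioi (1 : ℝ),
      (∑ k ∈ Finset.Icc 1 ⌊t⌋₊, χ (k : ZMod q)) * (t : ℂ) ^ (-(s + 1)) := by
  have hopen : IsOpen {s : ℂ | 0 < s.re} := isOpen_lt continuous_const continuous_re
  have hf : AnalyticOnNhd ℂ (DirichletCharacter.LFunction χ) {s : ℂ | 0 < s.re} :=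
    (DirichletCharacter.differentiable_LFunction hχ).differentiableOn.analyticOnNhd hopen
  have hg : AnalyticOnNhd ℂ (fun s : ℂ => s * ∫ t in Set.Ioi (1 : ℝ),
      (∑ k ∈ Finset.Icc 1 ⌊t⌋₊, χ (k : ZMod q)) * (t : ℂ) ^ (-(s + 1))) {s : ℂ | 0 < s.re} := by
    refine DifferentiableOn.analyticOnNhd (fun s hs => ?_) hopen
    exact (differentiableAt_id.mul
      (differentiableAt_integral_sum_character hχ hs)).differentiableWithinAt
  refine hf.eqOn_of_preconnected_of_eventuallyEq hg (z₀ := 2)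
    (convex_halfSpace_re_gt 0).isPreconnected (by simp) ?_ hs
  filter_upwards [(isOpen_lt continuous_const continuous_re).mem_nhds
    (show (1 : ℝ) < (2 : ℂ).re by simp)] with z hz
  have hz' : 1 < z.re := hz
  rw [DirichletCharacter.LFunction_eq_LSeries χ hz']
  refine LSeries_eq_mul_integral _ le_rfl (by linarith)
    (χ.LSeriesSummable_of_one_lt_re hz') ?_
  refine Asymptotics.IsBigO.of_bound q (Eventually.of_forall fun n => ?_)
  simpa using norm_sum_character_le hχ n

lemma norm_LFunction_le (hχ : χ ≠ 1) {s : ℂ} (hs : 0 < s.re) :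
    ‖DirichletCharacter.LFunction χ s‖ ≤ ‖s‖ * (q / s.re) := by
  rw [LFunction_eq_mul_integral hχ hs, norm_mul]
  exact mul_le_mul_of_nonneg_left (norm_integral_sum_character_le hχ hs) (norm_nonneg _)

end LBound

end

end PrimeMultiplier

/-! ### Landau's theorem on exceptional zeros. -/

namespace PrimeMultiplier

noncomputable section

open Complex Metric Filter Topology

section Landau

/-- (s-1)ζ(s), with its value at 1 filled in, is continuous without zeros on the compact segment [1,
2], and so is its logarithmic derivative continuous there. -/
lemma exists_zeta_bounds : ∃ C : ℝ, 1 ≤ C ∧ ∀ σ : ℝ, 1 < σ → σ ≤ 2 →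
    (-(deriv riemannZeta σ / riemannZeta σ)).re ≤ 1 / (σ - 1) + C ∧
      ‖riemannZeta σ‖ ≤ C / (σ - 1) := by
  set g : ℂ → ℂ := DirichletCharacter.LFunctionTrivChar₁ 1 with hg
  set T : Set ℂ := (fun σ : ℝ => (σ : ℂ)) '' Set.Icc 1 2 with hT
  have hTc : IsCompact T := isCompact_Icc.image continuous_ofReal
  have hζ : ∀ s, DirichletCharacter.LFunctionTrivChar 1 s = riemannZeta s := fun s =>
    congrFun DirichletCharacter.LFunction_modOne_eq s
  have h1 : ContinuousOn (fun s => -deriv g s / g s) T := by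
    refine (DirichletCharacter.continuousOn_neg_logDeriv_LFunctionTrivChar₁ 1).mono ?_
    rintro _ ⟨σ, hσ, rfl⟩
    rcases eq_or_lt_of_le hσ.1 with h | h
    · exact Or.inl (by simp [← h])
    · refine Or.inr ?_
      rw [hζ]
      exact riemannZeta_ne_zero_of_one_le_re (by simpa using h.le)
  obtain ⟨C₁, hC₁⟩ := hTc.exists_bound_of_continuousOn h1
  obtain ⟨C₂, hC₂⟩ := hTc.exists_bound_of_continuousOn
    (DirichletCharacter.differentiable_LFunctionTrivChar₁ 1).continuous.continuousOn
  refine ⟨max 1 (max C₁ C₂), le_max_left _ _, fun σ hσ hσ2 => ?_⟩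
  have hmem : (σ : ℂ) ∈ T := ⟨σ, ⟨hσ.le, hσ2⟩, rfl⟩
  have hne : (σ : ℂ) ≠ 1 := by exact_mod_cast hσ.ne'
  have hne' : (σ : ℂ) - 1 ≠ 0 := sub_ne_zero.2 hne
  have hpos : 0 < σ - 1 := by linarith
  have hζ0 : riemannZeta σ ≠ 0 := riemannZeta_ne_zero_of_one_le_re (by simpa using hσ.le)
  have hgσ : g σ = (σ - 1) * riemannZeta σ := by
    rw [hg, DirichletCharacter.LFunctionTrivChar₁, Function.update_of_ne hne, hζ]
  have hdσ : deriv g σ = (σ - 1) * deriv riemannZeta σ + riemannZeta σ := by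
    rw [hg, DirichletCharacter.deriv_LFunctionTrivChar₁_apply_of_ne_one 1 hne, hζ]
    congr 2
    exact congrArg (fun f => deriv f (σ : ℂ)) (funext hζ)
  constructor
  · have h2 := hC₁ _ hmem
    have e : -(deriv riemannZeta σ / riemannZeta σ) = ((1 / (σ - 1) : ℝ) : ℂ)
        + -deriv g σ / g σ := by
      rw [hgσ, hdσ]
      push_cast
      field_simp
      ring
    rw [e, add_re, ofReal_re]
    have := (re_le_norm _).trans (h2.trans ((le_max_left C₁ C₂).trans (le_max_right 1 _)))
    linarith
  · rw [le_div_iff₀ hpos]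
    have h2 := hC₂ _ hmem
    change ‖g σ‖ ≤ C₂ at h2
    rw [hgσ, norm_mul, mul_comm, ← ofReal_one, ← ofReal_sub, norm_real,
      Real.norm_of_nonneg hpos.le] at h2
    exact h2.trans ((le_max_right C₁ C₂).trans (le_max_right 1 _))

/-- 1/L is the Dirichlet series of χμ, whose coefficients have modulus at most one. This bounds L
from below at the centre of the disc used next. -/
lemma norm_LFunction_inv_le {q : ℕ} [NeZero q] (χ : DirichletCharacter ℂ q) {σ : ℝ} (hσ : 1 < σ) :
    ‖DirichletCharacter.LFunction χ σ‖⁻¹ ≤ ‖riemannZeta σ‖ := by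
  have hσ' : 1 < (σ : ℂ).re := by simpa using hσ
  have h1 := DirichletCharacter.LSeries.mul_mu_eq_one χ hσ'
  rw [← DirichletCharacter.LFunction_eq_LSeries χ hσ'] at h1
  rw [← norm_inv, inv_eq_of_mul_eq_one_right h1]
  have hs : Summable fun n : ℕ => 1 / (n : ℝ) ^ σ := Real.summable_one_div_nat_rpow.2 hσ
  have hz : riemannZeta σ = ((∑' n : ℕ, 1 / (n : ℝ) ^ σ : ℝ) : ℂ) := by
    rw [zeta_eq_tsum_one_div_nat_cpow hσ', ofReal_tsum]
    refine tsum_congr fun n => ?_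
    rw [ofReal_div, ofReal_one, ofReal_cpow (Nat.cast_nonneg n), ofReal_natCast]
  have hle : ∀ n : ℕ, ‖LSeries.term ((fun n : ℕ => χ (n : ZMod q)) *
      fun n => ((ArithmeticFunction.moebius n : ℤ) : ℂ)) σ n‖ ≤ 1 / (n : ℝ) ^ σ := by
    intro n
    rcases Nat.eq_zero_or_pos n with rfl | hn
    · simp; positivity
    · rw [LSeries.term_of_ne_zero hn.ne', norm_div, ← ofReal_natCast,
        norm_cpow_eq_rpow_re_of_pos (by exact_mod_cast hn), ofReal_re]
      gcongr
      rw [Pi.mul_apply, norm_mul]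
      have h2 : ‖((ArithmeticFunction.moebius n : ℤ) : ℂ)‖ ≤ 1 := by
        rw [norm_intCast]
        exact_mod_cast ArithmeticFunction.abs_moebius_le_one
      exact mul_le_one₀ (χ.norm_le_one _) (norm_nonneg _) h2
  rw [hz, norm_real, Real.norm_of_nonneg (tsum_nonneg fun n => by positivity)]
  exact tsum_of_norm_bounded hs.hasSum hle

/-- `re_logDeriv_ge` on the disc of radius 1/2 about σ. There |s| ≤ 5/2 and Re s ≥ 1/2, so |L| ≤ 5q;
zeros lie to the left since L ≠ 0 on Re s ≥ 1. The factors 8 and 4 are 4/R and 1/R² with R = 1/2. -/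
lemma neg_logDeriv_LFunction_le {C : ℝ} (hC1 : 1 ≤ C)
    (hC : ∀ σ : ℝ, 1 < σ → σ ≤ 2 → ‖riemannZeta σ‖ ≤ C / (σ - 1))
    {q : ℕ} [NeZero q] {χ : DirichletCharacter ℂ q} (hχ : χ ≠ 1) {σ : ℝ} (h1 : 1 < σ)
    (h2 : σ ≤ 2) (Z : Finset ℝ)
    (hZ : ∀ β ∈ Z, DirichletCharacter.LFunction χ β = 0 ∧ σ - 1 / 2 ≤ β) :
    (-(deriv (DirichletCharacter.LFunction χ) σ / DirichletCharacter.LFunction χ σ)).re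
      ≤ 8 * Real.log (5 * q * (C / (σ - 1))) - ∑ β ∈ Z, (1 / (σ - β) - 4 * (σ - β)) := by
  have hpos : 0 < σ - 1 := by linarith
  have hq1 : (1 : ℝ) ≤ q := by exact_mod_cast NeZero.one_le
  set L := DirichletCharacter.LFunction χ with hL
  set g : ℂ → ℂ := fun z => L (σ + z) with hg
  have hLd : Differentiable ℂ L := DirichletCharacter.differentiable_LFunction hχ
  have hgd : Differentiable ℂ g := hLd.comp (differentiable_id.const_add _)
  have hg0 : g 0 = L σ := by simp [hg]
  have hne : ∀ s : ℂ, 1 ≤ s.re → L s ≠ 0 := fun s hs =>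
    DirichletCharacter.LFunction_ne_zero_of_one_le_re χ (Or.inl hχ) hs
  have hg0ne : g 0 ≠ 0 := by rw [hg0]; exact hne _ (by simpa using h1.le)
  have hX : 1 < 5 * q * (C / (σ - 1)) := by
    have : 1 ≤ C / (σ - 1) := by rw [one_le_div hpos]; linarith
    nlinarith
  have hinv : ‖g 0‖⁻¹ ≤ C / (σ - 1) := by
    rw [hg0]; exact (norm_LFunction_inv_le χ h1).trans (hC σ h1 h2)
  have hbd : ∀ z ∈ closedBall (0 : ℂ) (1 / 2),
      ‖g z‖ ≤ Real.exp (Real.log (5 * q * (C / (σ - 1)))) * ‖g 0‖ := by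
    intro z hz
    have hz' : ‖z‖ ≤ 1 / 2 := by simpa using hz
    have hre := (abs_le.1 ((abs_re_le_norm z).trans hz')).1
    have hre' : 1 / 2 ≤ ((σ : ℂ) + z).re := by rw [add_re, ofReal_re]; linarith
    have hn : ‖(σ : ℂ) + z‖ ≤ 5 / 2 := by
      refine (norm_add_le _ _).trans ?_
      rw [norm_real, Real.norm_of_nonneg (by linarith)]
      linarith
    rw [Real.exp_log (by linarith)]
    have h3 : ‖g z‖ ≤ 5 * q := by
      refine (norm_LFunction_le hχ (by linarith)).trans ?_
      calc ‖(σ : ℂ) + z‖ * (q / ((σ : ℂ) + z).re) ≤ 5 / 2 * (q / (1 / 2)) := by gcongr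
        _ = 5 * q := by ring
    have h4 : 1 ≤ C / (σ - 1) * ‖g 0‖ := by
      rwa [← div_le_iff₀ (norm_pos_iff.2 hg0ne), one_div]
    nlinarith
  have key := re_logDeriv_ge (R := 1 / 2) (by norm_num) (Real.log_pos hX)
    (fun z _ => hgd.analyticAt z) hg0ne hbd (fun z _ hz => by
      by_contra! hre
      exact hne _ (by rw [add_re, ofReal_re]; linarith) hz)
    (Z.image fun β : ℝ => ((β - σ : ℝ) : ℂ)) (by
      intro z hz
      obtain ⟨β, hβ, rfl⟩ := Finset.mem_image.1 hz
      obtain ⟨hβ0, hβ1⟩ := hZ β hβ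
      have hβ2 : β < 1 := by
        by_contra! h
        exact hne β (by simpa using h) hβ0
      constructor
      · rw [mem_closedBall_zero_iff, norm_real, Real.norm_eq_abs, abs_le]
        constructor <;> linarith
      · simp only [hg]
        rw [← ofReal_add, add_sub_cancel]
        exact hβ0)
  rw [Finset.sum_image fun x _ y _ h => by
    have := ofReal_injective h; linarith] at key
  have hder : deriv g 0 = deriv L σ := by
    simp only [hg]
    rw [deriv_comp_const_add, add_zero]
  rw [hder, hg0] at key
  rw [neg_re]
  have hsum : ∑ β ∈ Z, (-((β - σ : ℝ) : ℂ).re) * (1 / ‖((β - σ : ℝ) : ℂ)‖ ^ 2 - 1 / (1 / 2) ^ 2)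
      = ∑ β ∈ Z, (1 / (σ - β) - 4 * (σ - β)) := by
    refine Finset.sum_congr rfl fun β hβ => ?_
    obtain ⟨hβ0, hβ1⟩ := hZ β hβ
    have hβ2 : β < 1 := by
      by_contra! h
      exact hne β (by simpa using h) hβ0
    rw [ofReal_re, norm_real, Real.norm_eq_abs, sq_abs]
    have h5 : σ - β ≠ 0 := by linarith
    have h6 : β - σ ≠ 0 := by intro h; apply h5; linarith
    rw [show (β - σ) ^ 2 = (σ - β) ^ 2 by ring]
    field_simp
    ring
  rw [hsum] at key
  linarith

lemma LSeries_re_nonneg {f : ℕ → ℂ} {σ : ℝ} (hf : LSeriesSummable f σ) (h : ∀ n, 0 ≤ (f n).re) :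
    0 ≤ (LSeries f σ).re := by
  rw [LSeries, re_tsum hf]
  refine tsum_nonneg fun n => ?_
  rcases Nat.eq_zero_or_pos n with rfl | hn
  · simp
  · rw [LSeries.term_of_ne_zero hn.ne', ← ofReal_natCast, ← ofReal_cpow (Nat.cast_nonneg n),
      div_ofReal_re]
    exact div_nonneg (h n) (by positivity)

lemma LSeries_character_mul_vonMangoldt {q : ℕ} [NeZero q] (χ : DirichletCharacter ℂ q) {σ : ℝ}
    (hσ : 1 < σ) : LSeries ((fun n : ℕ => χ (n : ZMod q)) *
      fun n : ℕ => ((ArithmeticFunction.vonMangoldt n : ℝ) : ℂ)) σ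
      = -(deriv (DirichletCharacter.LFunction χ) σ / DirichletCharacter.LFunction χ σ) := by
  have hσ' : 1 < (σ : ℂ).re := by simpa using hσ
  rw [DirichletCharacter.LSeries_twist_vonMangoldt_eq χ hσ',
    DirichletCharacter.deriv_LFunction_eq_deriv_LSeries χ hσ',
    DirichletCharacter.LFunction_eq_LSeries χ hσ', neg_div]

/-- The sum is the Dirichlet series of (1 + χ)Λ ≥ 0. It rules out two zeros of one L-function. -/
lemma neg_logDeriv_zeta_add_nonneg {q : ℕ} [NeZero q] {χ : DirichletCharacter ℂ q}
    (hχ : IsQuadraticCharacter χ) {σ : ℝ} (hσ : 1 < σ) :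
    0 ≤ (-(deriv riemannZeta σ / riemannZeta σ)).re +
      (-(deriv (DirichletCharacter.LFunction χ) σ / DirichletCharacter.LFunction χ σ)).re := by
  have hσ' : 1 < (σ : ℂ).re := by simpa using hσ
  have s0 := ArithmeticFunction.LSeriesSummable_vonMangoldt hσ'
  have s1 := DirichletCharacter.LSeriesSummable_twist_vonMangoldt χ hσ'
  have h := LSeries_re_nonneg (s0.add s1) fun n => by
    have hΛ := ArithmeticFunction.vonMangoldt_nonneg (n := n)
    simp only [Pi.add_apply, Pi.mul_apply]
    rcases hχ.1 (n : ZMod q) with h | h | h <;> rw [h] <;> simp [hΛ]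
  rw [LSeries_add s0 s1, add_re, LSeries_character_mul_vonMangoldt χ hσ,
    ArithmeticFunction.LSeries_vonMangoldt_eq_deriv_riemannZeta_div hσ', neg_div] at h
  exact h

/-- The sum is the Dirichlet series of (1 + χ)(1 + ψ)Λ ≥ 0. It rules out zeros of two different
L-functions. -/
lemma neg_logDeriv_zeta_add_add_add_nonneg {q : ℕ} [NeZero q] {χ ψ : DirichletCharacter ℂ q}
    (hχ : IsQuadraticCharacter χ) (hψ : IsQuadraticCharacter ψ) {σ : ℝ} (hσ : 1 < σ) :
    0 ≤ (-(deriv riemannZeta σ / riemannZeta σ)).re +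
      (-(deriv (DirichletCharacter.LFunction χ) σ / DirichletCharacter.LFunction χ σ)).re +
      (-(deriv (DirichletCharacter.LFunction ψ) σ / DirichletCharacter.LFunction ψ σ)).re +
      (-(deriv (DirichletCharacter.LFunction (χ * ψ)) σ /
        DirichletCharacter.LFunction (χ * ψ) σ)).re := by
  have hσ' : 1 < (σ : ℂ).re := by simpa using hσ
  have s0 := ArithmeticFunction.LSeriesSummable_vonMangoldt hσ'
  have s1 := DirichletCharacter.LSeriesSummable_twist_vonMangoldt χ hσ'
  have s2 := DirichletCharacter.LSeriesSummable_twist_vonMangoldt ψ hσ'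
  have s3 := DirichletCharacter.LSeriesSummable_twist_vonMangoldt (χ * ψ) hσ'
  have h := LSeries_re_nonneg (((s0.add s1).add s2).add s3) fun n => by
    have hΛ := ArithmeticFunction.vonMangoldt_nonneg (n := n)
    simp only [Pi.add_apply, Pi.mul_apply, MulChar.mul_apply]
    rcases hχ.1 (n : ZMod q) with h | h | h <;> rcases hψ.1 (n : ZMod q) with h' | h' | h' <;>
      rw [h, h'] <;> simp <;> linarith
  rw [LSeries_add ((s0.add s1).add s2) s3, LSeries_add (s0.add s1) s2, LSeries_add s0 s1, add_re,
    add_re, add_re, LSeries_character_mul_vonMangoldt χ hσ, LSeries_character_mul_vonMangoldt ψ hσ,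
    LSeries_character_mul_vonMangoldt (χ * ψ) hσ,
    ArithmeticFunction.LSeries_vonMangoldt_eq_deriv_riemannZeta_div hσ', neg_div] at h
  exact h

lemma IsQuadraticCharacter.ne_one {q : ℕ} {χ : DirichletCharacter ℂ q}
    (h : IsQuadraticCharacter χ) : χ ≠ 1 := by
  rintro rfl
  obtain ⟨x, hx⟩ := h.2
  by_cases hu : IsUnit x
  · rw [MulChar.one_apply hu] at hx
    norm_num at hx
  · rw [MulChar.map_nonunit _ hu] at hx
    norm_num at hx

lemma IsQuadraticCharacter.eq_of_mul_eq_one {q : ℕ} {χ ψ : DirichletCharacter ℂ q}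
    (h : IsQuadraticCharacter χ) (h' : IsQuadraticCharacter ψ) (e : χ * ψ = 1) : χ = ψ := by
  ext u
  have h1 : χ u * ψ u = 1 := by rw [← MulChar.mul_apply, e, MulChar.one_apply u.isUnit]
  rcases h.1 u with h2 | h2 | h2 <;> rcases h'.1 u with h3 | h3 | h3 <;> rw [h2, h3] at h1 ⊢ <;>
    norm_num at h1

lemma IsQuadraticCharacter.two_le {q : ℕ} [NeZero q] {χ : DirichletCharacter ℂ q}
    (h : IsQuadraticCharacter χ) : 2 ≤ q := by
  rcases Nat.lt_or_ge q 2 with hq | hq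
  · exact absurd (DirichletCharacter.level_one' χ (by have := NeZero.pos q; omega)) h.ne_one
  · exact hq

/-- Landau's theorem: there is at most one exceptional character to each modulus, and it has at
most one exceptional zero. -/
theorem exists_exceptional_unique : ∃ c : ℝ, 0 < c ∧
    ∀ (q : ℕ) (χ χ' : DirichletCharacter ℂ q) (β β' : ℝ),
      IsExceptional c q χ β → IsExceptional c q χ' β' → χ = χ' ∧ β = β' := by
  obtain ⟨C, hC1, hC⟩ := exists_zeta_bounds
  -- With d = e^(-K), δ = d/log q and σ = 1 + δ, the gain from two zeros is of order e^K log q,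
  -- while the errors grow only like log q + K + C; K is taken so large that the exponential wins.
  set K : ℝ := 200 + C with hK
  set d : ℝ := Real.exp (-K) with hd
  have hd0 : 0 < d := Real.exp_pos _
  have hexpK : 2 * (152 + 50 * C + 48 * K) < Real.exp K := by
    have := Real.quadratic_le_exp_of_nonneg (x := K) (by linarith)
    nlinarith
  have hdinv : 1 / d = Real.exp K := by rw [hd, Real.exp_neg, one_div, inv_inv]
  have hd8 : d ≤ 1 / 8 := by
    rw [le_div_iff₀ (by norm_num), mul_comm, ← le_div_iff₀ hd0, hdinv]
    linarith
  refine ⟨d / 3, by positivity, ?_⟩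
  intro q χ χ' β β' hE hE'
  obtain ⟨hχ, hβ1, hβ2, hβ3, hq, hβ0⟩ := hE
  obtain ⟨hχ', hβ1', hβ2', hβ3', hq', hβ0'⟩ := hE'
  have hq2 : 2 ≤ q := hχ.two_le
  set ℓ := Real.log q with hℓ
  have hℓ1 : 1 / 2 ≤ ℓ := by
    have h1 : Real.log 2 ≤ ℓ := Real.log_le_log (by norm_num) (by exact_mod_cast hq2)
    linarith [Real.log_two_gt_d9]
  have hℓ0 : 0 < ℓ := by linarith
  set δ := d / ℓ with hδ
  have hδ0 : 0 < δ := by positivity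
  have hδ4 : δ ≤ 1 / 4 := by
    rw [hδ, div_le_iff₀ hℓ0]; linarith
  have hδinv : 1 / δ = ℓ * Real.exp K := by rw [hδ, one_div_div, ← hdinv, mul_one_div]
  set σ := 1 + δ with hσ
  have hσ1 : 1 < σ := by linarith
  have hσ2 : σ ≤ 2 := by linarith
  set M := Real.log (5 * q * (C / (σ - 1))) with hM
  have hMle : M ≤ 2 * ℓ + K + 2 + C := by
    have hσδ : σ - 1 = δ := by rw [hσ]; ring
    have hq0 : (0 : ℝ) < q := by exact_mod_cast (by omega : 0 < q)
    have e : 5 * q * (C / (σ - 1)) = 5 * q * C * (ℓ * Real.exp K) := by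
      rw [hσδ, ← hδinv]; ring
    rw [hM, e, Real.log_mul (by positivity) (by positivity), Real.log_mul (by positivity)
      (by positivity), Real.log_mul (by norm_num) hq0.ne', Real.log_mul hℓ0.ne'
      (Real.exp_pos _).ne', Real.log_exp]
    have h5 : Real.log 5 ≤ 2 := by
      rw [Real.log_le_iff_le_exp (by norm_num)]
      have := Real.quadratic_le_exp_of_nonneg (x := 2) (by norm_num)
      linarith
    have h6 : Real.log C ≤ C - 1 := Real.log_le_sub_one_of_pos (by linarith)
    have h7 : Real.log ℓ ≤ ℓ - 1 := Real.log_le_sub_one_of_pos hℓ0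
    linarith
  have hM0 : 0 ≤ M := by
    refine Real.log_nonneg ?_
    have h1 : 1 ≤ C / (σ - 1) := by rw [one_le_div (by linarith)]; linarith
    have h2 : (2 : ℝ) ≤ q := by exact_mod_cast hq2
    nlinarith
  have hζ := (hC σ hσ1 hσ2).1
  have hC' : ∀ σ : ℝ, 1 < σ → σ ≤ 2 → ‖riemannZeta σ‖ ≤ C / (σ - 1) := fun σ h h' => (hC σ h h').2
  -- A zero within δ/3 of 1 is within 4δ/3 of σ, so it contributes at least 3/(4δ) up to a constant.
  have hrec : ∀ b : ℝ, 1 - d / 3 / ℓ < b → b < 1 →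
      3 / 4 * (ℓ * Real.exp K) - 2 ≤ 1 / (σ - b) - 4 * (σ - b) ∧ σ - 1 / 2 ≤ b := by
    intro b hb hb1
    have e : d / 3 / ℓ = δ / 3 := by rw [hδ]; ring
    rw [e] at hb
    have hr0 : 0 < σ - b := by linarith
    have hr1 : σ - b ≤ 4 / 3 * δ := by linarith
    refine ⟨?_, by linarith⟩
    have h1 : 3 / 4 * (ℓ * Real.exp K) ≤ 1 / (σ - b) := by
      rw [← hδinv]
      calc 3 / 4 * (1 / δ) = 1 / (4 / 3 * δ) := by field_simp
        _ ≤ _ := one_div_le_one_div_of_le hr0 hr1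
    linarith
  obtain ⟨hr, hb⟩ := hrec β hβ2 hβ3
  obtain ⟨hr', hb'⟩ := hrec β' hβ2' hβ3'
  have hδ' : 1 / (σ - 1) = ℓ * Real.exp K := by rw [← hδinv, hσ, add_sub_cancel_left]
  rw [hδ'] at hζ
  -- The pole of zeta gives 1/δ and two zeros take away 3/(2δ). The term 24M allows for three
  -- L-functions at 8M each, which also covers the case of a single one.
  have hfin : ¬ (0 ≤ ℓ * Real.exp K + C + 24 * M - 2 * (3 / 4 * (ℓ * Real.exp K) - 2)) := by
    intro h
    have h1 : ℓ * Real.exp K ≤ 2 * (C + 4 + 24 * (2 * ℓ + K + 2 + C)) := by linarith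
    have h2 : ℓ * (2 * (152 + 50 * C + 48 * K)) < ℓ * Real.exp K :=
      mul_lt_mul_of_pos_left hexpK hℓ0
    have hKC : 0 ≤ 52 + 25 * C + 24 * K := by linarith
    have h3 := mul_le_mul_of_nonneg_right hℓ1 hKC
    nlinarith
  have hχχ : χ = χ' := by
    by_contra hne
    have hmul : χ * χ' ≠ 1 := fun e => hne (hχ.eq_of_mul_eq_one hχ' e)
    have p := neg_logDeriv_zeta_add_add_add_nonneg hχ hχ' hσ1
    have l1 := neg_logDeriv_LFunction_le hC1 hC' hχ.ne_one hσ1 hσ2 {β} (by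
      intro b hb1; rw [Finset.mem_singleton.1 hb1]; exact ⟨hβ0, hb⟩)
    have l2 := neg_logDeriv_LFunction_le hC1 hC' hχ'.ne_one hσ1 hσ2 {β'} (by
      intro b hb1; rw [Finset.mem_singleton.1 hb1]; exact ⟨hβ0', hb'⟩)
    have l3 := neg_logDeriv_LFunction_le hC1 hC' hmul hσ1 hσ2 ∅ (by simp)
    rw [Finset.sum_singleton] at l1 l2
    rw [Finset.sum_empty] at l3
    exact hfin (by linarith)
  refine ⟨hχχ, ?_⟩
  by_contra hne
  subst hχχ
  have p := neg_logDeriv_zeta_add_nonneg hχ hσ1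
  have l1 := neg_logDeriv_LFunction_le hC1 hC' hχ.ne_one hσ1 hσ2 {β, β'} (by
    intro b hb1
    rcases Finset.mem_insert.1 hb1 with rfl | hb1
    · exact ⟨hβ0, hb⟩
    · rw [Finset.mem_singleton.1 hb1]; exact ⟨hβ0', hb'⟩)
  rw [Finset.sum_pair hne] at l1
  exact hfin (by linarith)

end Landau

end

end PrimeMultiplier

/-! ### Exceptional characters of different moduli in one dyadic range. -/

namespace PrimeMultiplier

noncomputable section

section CrossLevel

lemma IsQuadraticCharacter.changeLevel {q N : ℕ} [NeZero N] {χ : DirichletCharacter ℂ q}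
    (h : IsQuadraticCharacter χ) (hqN : q ∣ N) :
    IsQuadraticCharacter (DirichletCharacter.changeLevel hqN χ) := by
  constructor
  · intro x
    by_cases hx : IsUnit x
    · obtain ⟨u, rfl⟩ := hx
      rw [DirichletCharacter.changeLevel_eq_cast_of_dvd]
      exact h.1 _
    · exact Or.inr (Or.inl (MulChar.map_nonunit _ hx))
  · obtain ⟨x, hx⟩ := h.2
    have hxu : IsUnit x := by
      by_contra hxu
      rw [MulChar.map_nonunit _ hxu] at hx
      norm_num at hx
    obtain ⟨u, rfl⟩ := hxu
    obtain ⟨z, rfl⟩ := ZMod.unitsMap_surjective hqN u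
    exact ⟨z, by rw [DirichletCharacter.changeLevel_eq_cast_of_dvd, ← ZMod.unitsMap_val hqN]; exact hx⟩

/-- Inducing a character multiplies its L-function by finitely many Euler factors, so the zero
survives; only its distance to 1 has to be compared with the new logarithm. -/
lemma IsExceptional.changeLevel {c c' : ℝ} {q N : ℕ} {χ : DirichletCharacter ℂ q} {β : ℝ}
    (h : IsExceptional c q χ β) (hqN : q ∣ N) (hN : N ≠ 0)
    (hc : c / Real.log q ≤ c' / Real.log N) :
    IsExceptional c' N (DirichletCharacter.changeLevel hqN χ) β := by
  have : NeZero N := ⟨hN⟩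
  obtain ⟨h1, h2, h3, h4, hq, h5⟩ := h
  refine ⟨h1.changeLevel hqN, h2, by linarith, h4, ⟨hN⟩, ?_⟩
  rw [DirichletCharacter.LFunction_changeLevel hqN χ (Or.inl h1.ne_one), h5, zero_mul]

lemma log_mul_le_three_mul_log {s q r : ℕ} (hq : 2 ^ s ≤ q) (hq2 : 2 ≤ q) (hr0 : 0 < r)
    (hr : r < 2 ^ (s + 1)) : Real.log ((q * r : ℕ) : ℝ) ≤ 3 * Real.log q := by
  have h1 : q * r ≤ q ^ 3 := by
    have h2 : r ≤ q * q := by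
      calc r ≤ 2 ^ s * 2 := by rw [← pow_succ]; exact hr.le
        _ ≤ q * q := Nat.mul_le_mul hq hq2
    calc q * r ≤ q * (q * q) := Nat.mul_le_mul_left _ h2
      _ = q ^ 3 := by ring
  have h3 : Real.log ((q : ℝ) ^ 3) = 3 * Real.log q := by rw [Real.log_pow]; norm_num
  rw [← h3]
  refine Real.log_le_log ?_ (by exact_mod_cast h1)
  exact_mod_cast Nat.mul_pos (by omega) hr0

lemma IsExceptional.two_le {c : ℝ} {q : ℕ} {χ : DirichletCharacter ℂ q} {β : ℝ}
    (h : IsExceptional c q χ β) : 2 ≤ q := by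
  obtain ⟨h1, -, -, -, hq, -⟩ := h
  exact h1.two_le

/-- There is a constant such that all exceptional characters with moduli in a dyadic block have
the same conductor and the same exceptional zero. -/
theorem exists_exceptional_common : ∃ c₀ : ℝ, 0 < c₀ ∧ ∀ c : ℝ, 0 < c → c ≤ c₀ →
    (∀ (q : ℕ) (χ χ' : DirichletCharacter ℂ q) (β β' : ℝ),
      IsExceptional c q χ β → IsExceptional c q χ' β' → χ = χ' ∧ β = β') ∧
    ∀ (s q r : ℕ) (χ : DirichletCharacter ℂ q) (ψ : DirichletCharacter ℂ r) (β γ : ℝ),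
      2 ^ s ≤ q → q < 2 ^ (s + 1) → 2 ^ s ≤ r → r < 2 ^ (s + 1) →
      IsExceptional c q χ β → IsExceptional c r ψ γ → χ.conductor = ψ.conductor ∧ β = γ := by
  obtain ⟨cA, hcA, huniq⟩ := exists_exceptional_unique
  -- The 3 pays for log(qr) ≤ 3 log q when both characters are lifted to the modulus qr.
  refine ⟨cA / 3, by positivity, fun c hc hcle => ?_⟩
  have hlog : ∀ s q r : ℕ, 2 ≤ q → 2 ≤ r → 2 ^ s ≤ q → r < 2 ^ (s + 1) →
      c / Real.log q ≤ cA / Real.log ((q * r : ℕ) : ℝ) := by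
    intro s q r hq hr hsq hrs
    have h1 := log_mul_le_three_mul_log hsq hq (by omega) hrs
    have h2 : 0 < Real.log q := Real.log_pos (by exact_mod_cast hq)
    have h3 : 0 < Real.log ((q * r : ℕ) : ℝ) :=
      Real.log_pos (by exact_mod_cast (by nlinarith : 1 < q * r))
    rw [div_le_div_iff₀ h2 h3]
    nlinarith
  have hcommon : ∀ (s q r : ℕ) (χ : DirichletCharacter ℂ q) (ψ : DirichletCharacter ℂ r)
      (β γ : ℝ), 2 ^ s ≤ q → q < 2 ^ (s + 1) → 2 ^ s ≤ r → r < 2 ^ (s + 1) →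
      IsExceptional c q χ β → IsExceptional c r ψ γ →
      DirichletCharacter.changeLevel (Dvd.intro r rfl : q ∣ q * r) χ
        = DirichletCharacter.changeLevel (Dvd.intro_left q rfl : r ∣ q * r) ψ ∧ β = γ := by
    intro s q r χ ψ β γ h1 h2 h3 h4 hχ hψ
    have hq := hχ.two_le
    have hr := hψ.two_le
    have hN : q * r ≠ 0 := Nat.mul_ne_zero (by omega) (by omega)
    refine huniq (q * r) _ _ β γ (hχ.changeLevel _ hN (hlog s q r hq hr h1 h4))
      (hψ.changeLevel _ hN ?_)
    rw [mul_comm q r]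
    exact hlog s r q hr hq h3 h2
  refine ⟨fun q χ χ' β β' h h' => ?_, fun s q r χ ψ β γ h1 h2 h3 h4 hχ hψ => ?_⟩
  · have hmono : ∀ {ψ : DirichletCharacter ℂ q} {γ : ℝ}, IsExceptional c q ψ γ →
        IsExceptional cA q ψ γ := by
      intro ψ γ h
      have := h.changeLevel (c' := cA) dvd_rfl (by have := h.two_le; omega) 
        (div_le_div_of_nonneg_right (by linarith) (Real.log_natCast_nonneg q))
      rwa [DirichletCharacter.changeLevel_self] at this
    exact huniq q χ χ' β β' (hmono h) (hmono h')
  · obtain ⟨e, hβ⟩ := hcommon s q r χ ψ β γ h1 h2 h3 h4 hχ hψ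
    have : NeZero (q * r) := ⟨Nat.mul_ne_zero (by have := hχ.two_le; omega)
      (by have := hψ.two_le; omega)⟩
    refine ⟨?_, hβ⟩
    -- The lifts to qr coincide, and lifting does not change the conductor.
    rw [← DirichletCharacter.conductor_changeLevel χ (Dvd.intro r rfl : q ∣ q * r), e,
      DirichletCharacter.conductor_changeLevel]

end CrossLevel

end

end PrimeMultiplier

/-! ### The convolution kernel of the cutoff. -/

namespace PrimeMultiplier

noncomputable section

open MeasureTheory Filter Topology
open scoped FourierTransform SchwartzMap ContDiff

section CutoffKernel

/-- The Fourier coefficients of the periodic cutoff `cutoffScale η s`. -/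
def cutoffKernel (η : ℝ → ℝ) (s : ℕ) (k : ℤ) : ℂ :=
  ∫ ξ in (0 : ℝ)..1, (cutoffScale η s ξ : ℂ) * Complex.exp (2 * Real.pi * Complex.I * ξ * k)

lemma cutoffScale_add_int (η : ℝ → ℝ) (s : ℕ) (ξ : ℝ) (k : ℤ) :
    cutoffScale η s (ξ + k) = cutoffScale η s ξ := by
  rw [cutoffScale, cutoffScale, round_add_intCast]
  congr 2
  push_cast
  ring

lemma exp_two_pi_mul_int (ξ : ℝ) (j k : ℤ) :
    Complex.exp (2 * Real.pi * Complex.I * ((ξ + j : ℝ) : ℂ) * k)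
      = Complex.exp (2 * Real.pi * Complex.I * ξ * k) := by
  rw [Complex.exp_eq_exp_iff_exists_int]
  refine ⟨j * k, ?_⟩
  push_cast
  ring

variable {η : ℝ → ℝ}

lemma IsCutoff.eq_zero_of_half_le_abs_mul (hη : IsCutoff η) (s : ℕ) {u : ℝ} (hu : 1 / 2 ≤ |u|) :
    η (2 ^ (4 * s) * u) = 0 := by
  refine hη.eq_zero _ ?_
  rw [abs_mul, abs_of_pos (by positivity)]
  have : (1 : ℝ) ≤ 2 ^ (4 * s) := one_le_pow₀ (by norm_num)
  nlinarith [abs_nonneg u]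

/-- Integrate over the period (-1/2, 1/2], where `round` is zero except at the endpoint 1/2; there,
and outside the period, the cutoff vanishes. -/
lemma cutoffKernel_eq_integral (hη : IsCutoff η) (s : ℕ) (k : ℤ) :
    cutoffKernel η s k = ∫ u : ℝ, (η (2 ^ (4 * s) * u) : ℂ) *
      Complex.exp (2 * Real.pi * Complex.I * u * k) := by
  set h : ℝ → ℂ := fun ξ => (cutoffScale η s ξ : ℂ) *
    Complex.exp (2 * Real.pi * Complex.I * ξ * k) with hh
  have hper : Function.Periodic h 1 := by
    intro ξ
    simp only [hh]
    have e1 := cutoffScale_add_int η s ξ 1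
    have e2 := exp_two_pi_mul_int ξ 1 k
    rw [Int.cast_one] at e1 e2
    rw [e1, e2]
  have h1 := hper.intervalIntegral_add_eq 0 (-(1 / 2))
  rw [zero_add] at h1
  rw [cutoffKernel]
  change ∫ ξ in (0 : ℝ)..1, h ξ = _
  rw [h1, intervalIntegral.integral_of_le (by norm_num)]
  have h2 : ∫ u in Set.Ioc (-(1 / 2) : ℝ) (-(1 / 2) + 1), (η (2 ^ (4 * s) * u) : ℂ) *
      Complex.exp (2 * Real.pi * Complex.I * u * k) = ∫ u : ℝ, (η (2 ^ (4 * s) * u) : ℂ) *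
      Complex.exp (2 * Real.pi * Complex.I * u * k) := by
    refine setIntegral_eq_integral_of_forall_compl_eq_zero fun u hu => ?_
    rw [hη.eq_zero_of_half_le_abs_mul s, Complex.ofReal_zero, zero_mul]
    rw [Set.mem_Ioc, not_and_or, not_lt, not_le] at hu
    rcases hu with hu | hu
    · rw [le_abs]; right; linarith
    · rw [le_abs]; left; linarith
  rw [← h2]
  refine setIntegral_congr_fun (measurableSet_Ioc (a := (-(1 / 2) : ℝ))) fun u hu => ?_
  simp only [hh]
  congr 2
  rcases eq_or_ne u (1 / 2) with rfl | hne
  · rw [hη.eq_zero_of_half_le_abs_mul s (by norm_num), cutoffScale,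
      hη.eq_zero_of_half_le_abs_mul s]
    norm_num [round_eq]
  · have : round u = 0 := round_eq_zero_iff.2
      ⟨hu.1.le, lt_of_le_of_ne (hu.2.trans (by norm_num)) hne⟩
    rw [cutoffScale, this]
    simp

lemma IsCutoff.hasCompactSupport (hη : IsCutoff η) {a : ℝ} (ha : 1 ≤ a) :
    HasCompactSupport fun u : ℝ => (η (a * u) : ℂ) := by
  refine HasCompactSupport.intro (isCompact_Icc (a := (-(1 / 2) : ℝ)) (b := 1 / 2)) fun u hu => ?_
  rw [hη.eq_zero, Complex.ofReal_zero]
  have h1 : 1 / 2 ≤ |u| := by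
    by_contra! h
    exact hu (abs_le.1 h.le)
  rw [abs_mul, abs_of_pos (by linarith)]
  nlinarith [abs_nonneg u]

lemma IsCutoff.contDiff_scale (hη : IsCutoff η) (a : ℝ) :
    ContDiff ℝ ∞ fun u : ℝ => (η (a * u) : ℂ) :=
  Complex.ofRealCLM.contDiff.comp (hη.smooth.comp (contDiff_const.mul contDiff_id))

/-- The rescaled cutoff as a Schwartz function. -/
def scaledCutoff (hη : IsCutoff η) {a : ℝ} (ha : 1 ≤ a) : 𝓢(ℝ, ℂ) :=
  (hη.hasCompactSupport ha).toSchwartzMap (hη.contDiff_scale a)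

lemma fourier_scaledCutoff (hη : IsCutoff η) {a : ℝ} (ha : 1 ≤ a) (w : ℝ) :
    𝓕 (scaledCutoff hη ha) w
      = ∫ u : ℝ, (η (a * u) : ℂ) * Complex.exp (2 * Real.pi * Complex.I * u * (-w : ℝ)) := by
  rw [SchwartzMap.fourier_coe, Real.fourier_real_eq_integral_exp_smul]
  refine integral_congr_ae (Eventually.of_forall fun u => ?_)
  simp only [smul_eq_mul]
  rw [mul_comm]
  congr 2
  push_cast
  ring

lemma one_le_two_pow (s : ℕ) : (1 : ℝ) ≤ 2 ^ (4 * s) := one_le_pow₀ (by norm_num)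

lemma cutoffKernel_eq_fourier (hη : IsCutoff η) (s : ℕ) (k : ℤ) :
    cutoffKernel η s k = 𝓕 (scaledCutoff hη (one_le_two_pow s)) ((-k : ℤ) : ℝ) := by
  rw [fourier_scaledCutoff, cutoffKernel_eq_integral hη]
  push_cast
  simp only [neg_neg]

lemma cutoffKernel_eq_scaled (hη : IsCutoff η) (s : ℕ) (k : ℤ) :
    cutoffKernel η s k = ((2 : ℝ) ^ (4 * s))⁻¹ •
      𝓕 (scaledCutoff hη le_rfl) (-(k / 2 ^ (4 * s))) := by
  have ha : (0 : ℝ) < 2 ^ (4 * s) := by positivity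
  rw [cutoffKernel_eq_integral hη, fourier_scaledCutoff]
  have h := Measure.integral_comp_mul_left (fun v : ℝ => (η v : ℂ) *
    Complex.exp (2 * Real.pi * Complex.I * v * ((k / 2 ^ (4 * s) : ℝ) : ℂ))) ((2 : ℝ) ^ (4 * s))
  rw [abs_of_pos (inv_pos.2 ha)] at h
  simp only [one_mul, neg_neg]
  rw [← h]
  refine integral_congr_ae (Eventually.of_forall fun u => ?_)
  simp only
  congr 2
  push_cast
  field_simp

/-- Cubic decay of a fixed Schwartz function, rescaled by a = 2^(4s): a^(-1)(a/|k|)³ leaves a² =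
2^(8s). The third power keeps the first moment summable. -/
lemma exists_norm_cutoffKernel_le (hη : IsCutoff η) : ∃ A : ℝ, 0 < A ∧ ∀ (s : ℕ) (k : ℤ),
    |(k : ℝ)| * ‖cutoffKernel η s k‖ ≤ A * 2 ^ (8 * s) * (1 / (k : ℝ) ^ 2) := by
  obtain ⟨A, hA, hdecay⟩ := (𝓕 (scaledCutoff hη le_rfl)).decay 3 0
  refine ⟨A, hA, fun s k => ?_⟩
  have ha : (0 : ℝ) < 2 ^ (4 * s) := by positivity
  rcases eq_or_ne k 0 with rfl | hk
  · simp
  have hk' : (0 : ℝ) < |(k : ℝ)| := abs_pos.2 (by exact_mod_cast hk)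
  have h1 := hdecay (-(k / 2 ^ (4 * s)))
  rw [norm_iteratedFDeriv_zero, norm_neg, Real.norm_eq_abs, abs_div, abs_of_pos ha] at h1
  rw [cutoffKernel_eq_scaled hη, norm_smul, Real.norm_of_nonneg (inv_pos.2 ha).le,
    mul_one_div, le_div_iff₀ (by positivity), ← sq_abs]
  set N := ‖𝓕 (scaledCutoff hη le_rfl) (-((k : ℝ) / 2 ^ (4 * s)))‖
  have e : (2 : ℝ) ^ (8 * s) = 2 ^ (4 * s) * 2 ^ (4 * s) := by rw [← pow_add]; congr 1; ring
  rw [e]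
  calc |(k : ℝ)| * ((2 ^ (4 * s))⁻¹ * N) * |(k : ℝ)| ^ 2
      = (2 ^ (4 * s) * 2 ^ (4 * s)) * ((|(k : ℝ)| / 2 ^ (4 * s)) ^ 3 * N) := by field_simp
    _ ≤ (2 ^ (4 * s) * 2 ^ (4 * s)) * A := by gcongr
    _ = _ := by ring

lemma summable_cutoffKernel (hη : IsCutoff η) (s : ℕ) : Summable (cutoffKernel η s) := by
  obtain ⟨A, hA, h⟩ := exists_norm_cutoffKernel_le hη
  refine Summable.of_norm_bounded_eventually
    (g := fun k : ℤ => A * 2 ^ (8 * s) * (1 / (k : ℝ) ^ 2))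
    ((Real.summable_one_div_int_pow.2 one_lt_two).mul_left _) ?_
  filter_upwards [(Set.finite_singleton (0 : ℤ)).compl_mem_cofinite] with k hk
  have hk1 : (1 : ℝ) ≤ |(k : ℝ)| := by exact_mod_cast Int.one_le_abs hk
  refine le_trans ?_ (h s k)
  exact le_mul_of_one_le_left (norm_nonneg _) hk1

/-- Poisson summation at the origin; among the integers only 0 lies in the support of the scaled
cutoff, where its value is 1. -/
lemma hasSum_cutoffKernel (hη : IsCutoff η) (s : ℕ) : HasSum (cutoffKernel η s) 1 := by
  have h := SchwartzMap.tsum_eq_tsum_fourier (scaledCutoff hη (one_le_two_pow s)) 0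
  have h1 : ∑' n : ℤ, scaledCutoff hη (one_le_two_pow s) (0 + n) = 1 := by
    rw [tsum_eq_single 0]
    · change ((η (2 ^ (4 * s) * (0 + ((0 : ℤ) : ℝ))) : ℝ) : ℂ) = 1
      rw [Int.cast_zero, add_zero, mul_zero, hη.eq_one 0 (by norm_num), Complex.ofReal_one]
    · intro n hn
      change ((η (2 ^ (4 * s) * (0 + (n : ℝ))) : ℝ) : ℂ) = 0
      rw [zero_add, hη.eq_zero_of_half_le_abs_mul, Complex.ofReal_zero]
      have : (1 : ℝ) ≤ |(n : ℝ)| := by exact_mod_cast Int.one_le_abs hn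
      linarith
  have h2 : ∑' n : ℤ, 𝓕 (scaledCutoff hη (one_le_two_pow s)) n *
      fourier n ((0 : ℝ) : UnitAddCircle) = ∑' k, cutoffKernel η s k := by
    rw [← (Equiv.neg ℤ).tsum_eq]
    refine tsum_congr fun k => ?_
    rw [cutoffKernel_eq_fourier hη, Equiv.neg_apply]
    simp
  rw [h1, h2] at h
  rw [h]
  exact (summable_cutoffKernel hη s).hasSum

lemma exists_tsum_abs_mul_cutoffKernel_le (hη : IsCutoff η) : ∃ A : ℝ, 0 < A ∧ ∀ s : ℕ,
    ∑' k : ℤ, ENNReal.ofReal (|(k : ℝ)| * ‖cutoffKernel η s k‖)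
      ≤ ENNReal.ofReal (A * 2 ^ (8 * s)) := by
  obtain ⟨A, hA, h⟩ := exists_norm_cutoffKernel_le hη
  have hs : Summable fun k : ℤ => 1 / (k : ℝ) ^ 2 := Real.summable_one_div_int_pow.2 one_lt_two
  set B := ∑' k : ℤ, 1 / (k : ℝ) ^ 2 with hB
  have hB0 : 0 ≤ B := tsum_nonneg fun _ => by positivity
  refine ⟨A * (B + 1), by positivity, fun s => ?_⟩
  refine (ENNReal.tsum_le_tsum fun k => ENNReal.ofReal_le_ofReal (h s k)).trans ?_
  rw [← ENNReal.ofReal_tsum_of_nonneg (fun k => by positivity) (hs.mul_left _), tsum_mul_left]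
  refine ENNReal.ofReal_le_ofReal ?_
  rw [← hB]
  nlinarith [mul_pos hA (show (0 : ℝ) < 2 ^ (8 * s) by positivity)]

end CutoffKernel

section Smoothing

lemma normOne_add_le (u v : ℤ → ℂ) : normOne (fun x => u x + v x) ≤ normOne u + normOne v := by
  rw [normOne, normOne, normOne, ← total_add (fun _ => norm_nonneg _) fun _ => norm_nonneg _]
  exact total_mono fun x => norm_add_le _ _

lemma normOne_sub_comm (u v : ℤ → ℂ) :
    normOne (fun x => u x - v x) = normOne fun x => v x - u x := by
  simp only [normOne, norm_sub_rev]

lemma normOne_shift_nat_le (W : ℤ → ℂ) (k : ℕ) :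
    normOne (fun x => W (x - k) - W x) ≤ ENNReal.ofReal k * normOne (backDiff W) := by
  induction k with
  | zero => simp [normOne, total]
  | succ k ih =>
    have e : (fun x => W (x - (k + 1 : ℕ)) - W x)
        = fun x => (W (x - k) - W x) + (W (x - k - 1) - W (x - k)) := by
      ext x
      rw [show x - ((k + 1 : ℕ) : ℤ) = x - k - 1 by push_cast; ring]
      ring
    rw [e]
    refine (normOne_add_le _ _).trans ?_
    rw [Nat.cast_succ, ENNReal.ofReal_add (by positivity) zero_le_one, add_mul,
      ENNReal.ofReal_one, one_mul]
    refine add_le_add ih (le_of_eq ?_)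
    rw [normOne_sub_comm]
    exact normOne_sub_right (backDiff W) k

lemma normOne_shift_le (W : ℤ → ℂ) (k : ℤ) :
    normOne (fun x => W (x - k) - W x) ≤ ENNReal.ofReal |(k : ℝ)| * normOne (backDiff W) := by
  rcases Int.natAbs_eq k with h | h
  · rw [h]
    simpa using normOne_shift_nat_le W k.natAbs
  · have h1 := normOne_shift_nat_le W k.natAbs
    rw [normOne_sub_comm, ← normOne_sub_right _ (-(k.natAbs : ℤ))] at h1
    rw [h]
    simpa using h1

lemma normOne_tsum_shift_sub_le (φ : ℤ → ℂ) (W : ℤ → ℂ) :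
    normOne (fun x => ∑' k, φ k * (W (x - k) - W x))
      ≤ (∑' k : ℤ, ENNReal.ofReal (|(k : ℝ)| * ‖φ k‖)) * normOne (backDiff W) := by
  calc normOne (fun x => ∑' k, φ k * (W (x - k) - W x))
      ≤ ∑' x, ∑' k : ℤ, ENNReal.ofReal ‖φ k * (W (x - k) - W x)‖ := by
        refine ENNReal.tsum_le_tsum fun x => ?_
        simp only [ofReal_norm]
        exact enorm_tsum_le_tsum_enorm
    _ = ∑' k, ENNReal.ofReal ‖φ k‖ * normOne (fun x => W (x - k) - W x) := by
        rw [ENNReal.tsum_comm]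
        refine tsum_congr fun k => ?_
        rw [normOne, total, ← ENNReal.tsum_mul_left]
        refine tsum_congr fun x => ?_
        rw [norm_mul, ENNReal.ofReal_mul (norm_nonneg _)]
    _ ≤ ∑' k : ℤ, ENNReal.ofReal (|(k : ℝ)| * ‖φ k‖) * normOne (backDiff W) := by
        refine ENNReal.tsum_le_tsum fun k => ?_
        rw [mul_comm |(k : ℝ)|, ENNReal.ofReal_mul (norm_nonneg _), mul_assoc]
        exact mul_le_mul_right (normOne_shift_le W k) _
    _ = _ := ENNReal.tsum_mul_right

/-- A kernel of mass one moves W only by combinations of W(x-k) - W(x), each costing |k| unit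
differences; hence the first moment. -/
lemma normOne_smoothing_sub_le {φ : ℤ → ℂ} (hφ : HasSum φ 1) {W : ℤ → ℂ}
    (hW : ∀ x, Summable fun k => φ k * W (x - k)) {A : ℝ}
    (hA : ∑' k : ℤ, ENNReal.ofReal (|(k : ℝ)| * ‖φ k‖) ≤ ENNReal.ofReal A) :
    normOne (fun x => ∑' k, φ k * W (x - k) - W x)
      ≤ ENNReal.ofReal A * normOne (backDiff W) := by
  have e : (fun x => ∑' k, φ k * W (x - k) - W x)
      = fun x => ∑' k, φ k * (W (x - k) - W x) := by
    ext x
    simp only [mul_sub]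
    rw [(hW x).tsum_sub (hφ.summable.mul_right _), tsum_mul_right, hφ.tsum_eq, one_mul]
  rw [e]
  exact (normOne_tsum_shift_sub_le φ W).trans (mul_le_mul_left hA _)

end Smoothing

end

end PrimeMultiplier

/-! ### The multiplier attached to one fraction. -/

namespace PrimeMultiplier

noncomputable section

open MeasureTheory Filter Topology

section PowWeight

/-- The density weights `(m^β - (m-1)^β) / β` of the kernel `avgKernel β`. -/
def powWeight (β : ℝ) (m : ℕ) : ℝ := ((m : ℝ) ^ β - ((m : ℝ) - 1) ^ β) / β

/-- Concavity of x^β gives monotonicity, and its subadditivity bounds the increments by 1; β ≥ 1/2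
turns this into the bound 2. -/
lemma isDecreasingWeight_powWeight {β : ℝ} (h1 : 1 / 2 ≤ β) (h2 : β ≤ 1) :
    IsDecreasingWeight (powWeight β) where
  nonneg m hm := by
    have hm' : (1 : ℝ) ≤ m := by exact_mod_cast hm
    refine div_nonneg (sub_nonneg.2 ?_) (by linarith)
    exact Real.rpow_le_rpow (by linarith) (by linarith) (by linarith)
  le_two m hm := by
    have hm' : (1 : ℝ) ≤ m := by exact_mod_cast hm
    rw [powWeight, div_le_iff₀ (by linarith)]
    have h := Real.rpow_add_le_add_rpow (a := (m : ℝ) - 1) (b := 1) (by linarith) zero_le_one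
      (by linarith : 0 ≤ β) h2
    rw [sub_add_cancel, Real.one_rpow] at h
    linarith
  anti m hm := by
    have hm' : (1 : ℝ) ≤ m := by exact_mod_cast hm
    rw [powWeight, powWeight]
    refine div_le_div_of_nonneg_right ?_ (by linarith)
    have h := (Real.concaveOn_rpow (by linarith : 0 ≤ β) h2).slope_anti_adjacent
      (x := (m : ℝ) - 1) (y := m) (z := m + 1) (Set.mem_Ici.2 (by linarith))
      (Set.mem_Ici.2 (by linarith)) (by linarith) (by linarith)
    push_cast
    rw [add_sub_cancel_left, sub_sub_cancel, div_one, div_one] at h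
    rw [add_sub_cancel_right]
    exact h

end PowWeight

section Hat

lemma hat_eq_sum (f : ℤ →₀ ℂ) (ξ : ℝ) :
    hat f ξ = f.sum fun n z => z * Complex.exp (-(2 * Real.pi * Complex.I * ξ * n)) := rfl

lemma hat_sub (f g : ℤ →₀ ℂ) (ξ : ℝ) : hat (f - g) ξ = hat f ξ - hat g ξ := by
  simp only [hat_eq_sum]
  exact Finsupp.sum_sub_index fun _ _ _ => sub_mul _ _ _

lemma hat_smul (c : ℂ) (f : ℤ →₀ ℂ) (ξ : ℝ) : hat (c • f) ξ = c * hat f ξ := by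
  simp only [hat_eq_sum]
  rw [Finsupp.sum_smul_index fun _ => zero_mul _, Finsupp.mul_sum]
  simp only [mul_assoc]

lemma hat_avgKernel (β : ℝ) (N : ℕ) (ξ : ℝ) :
    hat (avgKernel β N) ξ = ∑ m ∈ Finset.Icc 1 N, (((N : ℝ)⁻¹ * powWeight β m : ℝ) : ℂ) *
      Complex.exp (-(2 * Real.pi * Complex.I * ξ * (m : ℤ))) := by
  rw [hat_eq_sum, avgKernel,
    ← Finsupp.sum_finsetSum_index (fun _ => zero_mul _) fun _ _ _ => add_mul _ _ _]
  refine Finset.sum_congr rfl fun m _ => ?_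
  rw [Finsupp.sum_single_index (zero_mul _), powWeight, one_div]

lemma measurable_cutoffScale {η : ℝ → ℝ} (hη : IsCutoff η) (s : ℕ) :
    Measurable (cutoffScale η s) := by
  have h : Measurable fun ξ : ℝ => ((round ξ : ℤ) : ℝ) := by
    simp only [round_eq]
    exact (measurable_from_top (f := fun k : ℤ => (k : ℝ))).comp
      (Int.measurable_floor.comp (measurable_id.add_const _))
  exact hη.smooth.continuous.measurable.comp ((measurable_id.sub h).const_mul _)

lemma norm_cutoffScale_le {η : ℝ → ℝ} (hη : IsCutoff η) (s : ℕ) (ξ : ℝ) :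
    ‖(cutoffScale η s ξ : ℂ)‖ ≤ 1 := by
  rw [Complex.norm_real, Real.norm_of_nonneg (by exact hη.nonneg _)]
  exact hη.le_one _

lemma intervalIntegrable_cutoffScale_mul {η : ℝ → ℝ} (hη : IsCutoff η) (s : ℕ) {g : ℝ → ℂ}
    (hg : Continuous g) (θ a b : ℝ) :
    IntervalIntegrable (fun ξ => (cutoffScale η s (ξ - θ) : ℂ) * g ξ) volume a b := by
  rw [intervalIntegrable_iff]
  refine Integrable.bdd_mul (c := 1)
    (intervalIntegrable_iff.1 (hg.intervalIntegrable a b)) ?_ ?_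
  · exact (Complex.measurable_ofReal.comp ((measurable_cutoffScale hη s).comp
      (measurable_id.sub_const θ))).aestronglyMeasurable
  · exact Eventually.of_forall fun ξ => norm_cutoffScale_le hη s _

lemma continuous_hat (f : ℤ →₀ ℂ) : Continuous (hat f) := by
  unfold hat
  fun_prop

end Hat

section PairMultiplier

lemma hasSum_mul_wAvg (K : ℤ → ℂ) (w : ℕ → ℝ) (n : ℕ) {u : ℤ → ℂ} {F : Finset ℤ}
    (hu : ∀ y ∉ F, u y = 0) (x : ℤ) :
    HasSum (fun k => K k * wAvg w n u (x - k))
      (∑ m ∈ Finset.Icc 1 (2 ^ n), ∑ y ∈ F,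
        ((((2 : ℝ) ^ n)⁻¹ * w m : ℝ) : ℂ) * (K (x - m - y) * u y)) := by
  have h1 : ∀ m ∈ Finset.Icc 1 (2 ^ n), HasSum
      (fun k => ((((2 : ℝ) ^ n)⁻¹ * w m : ℝ) : ℂ) * (K k * u (x - k - m)))
      (∑ y ∈ F, ((((2 : ℝ) ^ n)⁻¹ * w m : ℝ) : ℂ) * (K (x - m - y) * u y)) := by
    intro m _
    rw [← Finset.mul_sum]
    refine HasSum.mul_left _ ?_
    rw [← (Equiv.subLeft (x - (m : ℤ))).hasSum_iff]
    have e : ((fun k => K k * u (x - k - m)) ∘ Equiv.subLeft (x - (m : ℤ)))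
        = fun y => K (x - m - y) * u y := by
      ext y
      simp only [Function.comp, Equiv.subLeft_apply]
      congr 2
      ring
    rw [e]
    exact hasSum_sum_of_ne_finset_zero fun y hy => by rw [hu y hy, mul_zero]
  convert hasSum_sum h1 using 2 with k
  rw [wAvg, Complex.real_smul, mul_left_comm, Finset.mul_sum, Finset.mul_sum]
  refine Finset.sum_congr rfl fun m _ => ?_
  rw [Complex.real_smul]
  push_cast
  ring

variable {η : ℝ → ℝ}

/-- Translating the frequency by θ demodulates f; at frequency zero the product of multipliers is
the composition of the weighted average with convolution by the cutoff kernel. -/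
lemma invFourier_hat_avgKernel (hη : IsCutoff η) (β : ℝ) (s n : ℕ) (θ : ℝ) (f : ℤ →₀ ℂ) (x : ℤ) :
    invFourier (fun ξ => hat (avgKernel β (2 ^ n)) (ξ - θ) * (cutoffScale η s (ξ - θ) : ℂ) *
        hat f ξ) x
      = Complex.exp (2 * Real.pi * Complex.I * θ) ^ x *
        ∑' k, cutoffKernel η s k * wAvg (powWeight β) n
          (fun y => Complex.exp (2 * Real.pi * Complex.I * θ) ^ (-y) * f y) (x - k) := by
  have hhat : ∀ (g : ℤ →₀ ℂ) (ξ : ℝ), hat g (ξ + 1) = hat g ξ := by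
    intro g ξ
    refine Finset.sum_congr rfl fun k _ => ?_
    have := exp_two_pi_mul_int ξ 1 (-k)
    rw [Int.cast_one] at this
    push_cast at this ⊢
    rw [← mul_neg, ← mul_neg, this]
  set h : ℝ → ℂ := fun ξ => hat (avgKernel β (2 ^ n)) (ξ - θ) * (cutoffScale η s (ξ - θ) : ℂ) *
        hat f ξ * Complex.exp (2 * Real.pi * Complex.I * ξ * x) with hh
  have hper : Function.Periodic h 1 := by
    intro ξ
    simp only [hh]
    have e1 := cutoffScale_add_int η s (ξ - θ) 1
    have e2 := exp_two_pi_mul_int ξ 1 x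
    rw [Int.cast_one] at e1 e2
    rw [e2, hhat f, add_sub_right_comm, e1, hhat]
  have h1 : invFourier (fun ξ => hat (avgKernel β (2 ^ n)) (ξ - θ) *
      (cutoffScale η s (ξ - θ) : ℂ) * hat f ξ) x = ∫ u in (0 : ℝ)..1, h (u + θ) := by
    rw [invFourier]
    change ∫ ξ in (0 : ℝ)..1, h ξ = _
    rw [intervalIntegral.integral_comp_add_right h θ]
    have := hper.intervalIntegral_add_eq 0 θ
    rw [zero_add, add_comm θ] at this
    rw [this, zero_add]
  set ζ := Complex.exp (2 * Real.pi * Complex.I * θ) with hζ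
  have hζ0 : ζ ≠ 0 := Complex.exp_ne_zero _
  have h2 : ∀ u, h (u + θ) = ∑ m ∈ Finset.Icc 1 (2 ^ n), ∑ y ∈ f.support,
      ((((2 : ℝ) ^ n)⁻¹ * powWeight β m : ℝ) : ℂ) * (ζ ^ (x - y) * f y) *
        ((cutoffScale η s (u - 0) : ℂ) *
          Complex.exp (2 * Real.pi * Complex.I * u * (x - m - y : ℤ))) := by
    intro u
    simp only [hh, add_sub_cancel_right, sub_zero]
    rw [hat_avgKernel, hat, Finset.sum_mul, Finset.sum_mul, Finset.sum_mul]
    refine Finset.sum_congr rfl fun m _ => ?_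
    rw [Finset.mul_sum, Finset.sum_mul]
    refine Finset.sum_congr rfl fun y _ => ?_
    have e : Complex.exp (-(2 * Real.pi * Complex.I * u * (m : ℤ))) *
        Complex.exp (-(2 * Real.pi * Complex.I * ((u + θ : ℝ) : ℂ) * y)) *
        Complex.exp (2 * Real.pi * Complex.I * ((u + θ : ℝ) : ℂ) * x)
        = ζ ^ (x - y) * Complex.exp (2 * Real.pi * Complex.I * u * (x - m - y : ℤ)) := by
      rw [hζ, ← Complex.exp_int_mul, ← Complex.exp_add, ← Complex.exp_add, ← Complex.exp_add]
      congr 1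
      push_cast
      ring
    push_cast at e ⊢
    linear_combination (((2 : ℂ) ^ n)⁻¹ * (powWeight β m : ℂ) * f y * (cutoffScale η s u : ℂ)) * e
  have hu : ∀ y ∉ f.support, ζ ^ (-y) * f y = 0 := fun y hy => by
    rw [Finsupp.notMem_support_iff.1 hy, mul_zero]
  rw [h1, (hasSum_mul_wAvg (cutoffKernel η s) (powWeight β) n hu x).tsum_eq]
  simp only [h2]
  have hint : ∀ (m : ℕ) (y : ℤ), IntervalIntegrable (fun u =>
      ((((2 : ℝ) ^ n)⁻¹ * powWeight β m : ℝ) : ℂ) * (ζ ^ (x - y) * f y) *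
        ((cutoffScale η s (u - 0) : ℂ) *
          Complex.exp (2 * Real.pi * Complex.I * u * (x - m - y : ℤ)))) volume 0 1 :=
    fun m y => (intervalIntegrable_cutoffScale_mul hη s (by fun_prop) 0 0 1).const_mul _
  rw [intervalIntegral.integral_finsetSum fun m _ => by
    simpa only [Finset.sum_fn] using IntervalIntegrable.sum _ fun y _ => hint m y, Finset.mul_sum]
  refine Finset.sum_congr rfl fun m _ => ?_
  rw [intervalIntegral.integral_finsetSum fun y _ => hint m y, Finset.mul_sum]
  refine Finset.sum_congr rfl fun y _ => ?_
  rw [intervalIntegral.integral_const_mul]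
  simp only [sub_zero]
  rw [← cutoffKernel, sub_eq_add_neg x y, zpow_add₀ hζ0]
  ring

/-- The error made in dropping the smooth cutoff of a single rational frequency. -/
lemma normOne_cutoff_error_le (hη : IsCutoff η) {A : ℝ} {s : ℕ}
    (hA : ∑' k : ℤ, ENNReal.ofReal (|(k : ℝ)| * ‖cutoffKernel η s k‖) ≤ ENNReal.ofReal A)
    {w : ℕ → ℝ} (hw : IsDecreasingWeight w) (n : ℕ) {ζ : ℂ} (hζ : ‖ζ‖ = 1) (f : ℤ →₀ ℂ) :
    normOne (fun x => ζ ^ x * (∑' k, cutoffKernel η s k *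
        wAvg w n (fun y => ζ ^ (-y) * f y) (x - k) - wAvg w n (fun y => ζ ^ (-y) * f y) x))
      ≤ ENNReal.ofReal A * (ENNReal.ofReal (4 * ((2 : ℝ) ^ n)⁻¹) * normOne f) := by
  have hu : ∀ y ∉ f.support, ζ ^ (-y) * f y = 0 := fun y hy => by
    rw [Finsupp.notMem_support_iff.1 hy, mul_zero]
  have h1 := normOne_smoothing_sub_le (hasSum_cutoffKernel hη s)
    (fun x => (hasSum_mul_wAvg (cutoffKernel η s) w n hu x).summable) hA
  have e1 : ∀ g : ℤ → ℂ, normOne (fun x => ζ ^ x * g x) = normOne g := by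
    intro g
    simp only [normOne, norm_mul, norm_zpow, hζ, one_zpow, one_mul]
  have e2 : normOne (fun y => ζ ^ (-y) * f y) = normOne f := by
    simp only [normOne, norm_mul, norm_zpow, hζ, one_zpow, one_mul]
  rw [e1]
  refine h1.trans (mul_le_mul_right ?_ _)
  rw [← e2]
  exact normOne_backDiff_wAvg_le hw n _

end PairMultiplier

end

end PrimeMultiplier

/-! ### Assembling the multiplier from its fractions. -/

namespace PrimeMultiplier

noncomputable section

open MeasureTheory Filter Topology

section Fractions

lemma bounds_of_mem_denominators {s q : ℕ} (h : q ∈ denominators s) :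
    2 ^ s ≤ q ∧ q < 2 ^ (s + 1) :=
  Finset.mem_Ico.1 (Finset.mem_filter.1 h).1

lemma log_eq_of_mem_denominators {s q : ℕ} (h : q ∈ denominators s) : Nat.log 2 q = s :=
  have h' := bounds_of_mem_denominators h
  Nat.log_eq_of_pow_le_of_lt_pow h'.1 h'.2

/-- The pairs `(q, a)` with `a / q ∈ ℛ_s` for some `s ≤ S`. -/
def fractions (S : ℕ) : Finset (ℕ × ℕ) :=
  (((Finset.range (S + 1)).biUnion denominators) ×ˢ Finset.range (2 ^ (S + 1))).filter
    fun p => p.2 ∈ reducedResidues p.1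

lemma mem_fractions_iff {S : ℕ} {p : ℕ × ℕ} : p ∈ fractions S ↔
    p.1 ∈ (Finset.range (S + 1)).biUnion denominators ∧ p.2 ∈ reducedResidues p.1 := by
  rw [fractions, Finset.mem_filter, Finset.mem_product, and_assoc, and_congr_right_iff]
  intro h
  refine and_iff_right_of_imp fun h2 => ?_
  obtain ⟨s, hs, hq⟩ := Finset.mem_biUnion.1 h
  have h3 := (Finset.mem_Icc.1 (Finset.mem_filter.1 h2).1).2
  refine Finset.mem_range.2 (h3.trans_lt ((bounds_of_mem_denominators hq).2.trans_le ?_))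
  exact Nat.pow_le_pow_right two_pos (Nat.succ_le_succ (Finset.mem_range_succ_iff.1 hs))

lemma mem_fractions {S : ℕ} {p : ℕ × ℕ} (h : p ∈ fractions S) :
    Nat.log 2 p.1 ≤ S ∧ p.1 ∈ denominators (Nat.log 2 p.1) ∧ p.2 ∈ reducedResidues p.1 := by
  obtain ⟨h1, h2⟩ := mem_fractions_iff.1 h
  obtain ⟨s, hs, hq⟩ := Finset.mem_biUnion.1 h1
  rw [log_eq_of_mem_denominators hq]
  exact ⟨Finset.mem_range_succ_iff.1 hs, hq, h2⟩

lemma card_fractions_le (S : ℕ) : (fractions S).card ≤ 2 ^ (S + 1) * 2 ^ (S + 1) := by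
  refine (Finset.card_filter_le _ _).trans ?_
  rw [Finset.card_product, Finset.card_range]
  refine Nat.mul_le_mul_right _ ?_
  conv_rhs => rw [← Finset.card_range (2 ^ (S + 1))]
  refine Finset.card_le_card fun q hq => ?_
  obtain ⟨s, hs, hq⟩ := Finset.mem_biUnion.1 hq
  refine Finset.mem_range.2 ((bounds_of_mem_denominators hq).2.trans_le ?_)
  exact Nat.pow_le_pow_right two_pos (Nat.succ_le_succ (Finset.mem_range_succ_iff.1 hs))

lemma sum_fractions {M : Type*} [AddCommMonoid M] (S : ℕ) (F : ℕ → ℕ → ℕ → M) :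
    ∑ s ∈ Finset.range (S + 1), ∑ q ∈ denominators s, ∑ a ∈ reducedResidues q, F s q a
      = ∑ p ∈ fractions S, F (Nat.log 2 p.1) p.1 p.2 := by
  rw [Finset.sum_finset_product' (fractions S) _ _ (fun p => mem_fractions_iff)
    (f := fun q a => F (Nat.log 2 q) q a), Finset.sum_biUnion]
  · refine Finset.sum_congr rfl fun s _ => Finset.sum_congr rfl fun q hq => ?_
    rw [log_eq_of_mem_denominators hq]
  · intro s _ s' _ hne
    refine Finset.disjoint_left.2 fun q hq hq' => hne ?_
    rw [← log_eq_of_mem_denominators hq, log_eq_of_mem_denominators hq']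

lemma sum_fractions_log_eq {M : Type*} [AddCommMonoid M] {S j : ℕ} (hj : j ≤ S)
    (F : ℕ → ℕ → M) :
    ∑ p ∈ fractions S with Nat.log 2 p.1 = j, F p.1 p.2
      = ∑ q ∈ denominators j, ∑ a ∈ reducedResidues q, F q a := by
  refine Finset.sum_finset_product' _ _ _ fun p => ?_
  rw [Finset.mem_filter, mem_fractions_iff, and_right_comm, and_congr_left_iff]
  intro _
  rw [Finset.mem_biUnion]
  constructor
  · rintro ⟨⟨s, hs, hq⟩, h⟩
    rwa [← h, log_eq_of_mem_denominators hq]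
  · intro hq
    exact ⟨⟨j, Finset.mem_range_succ_iff.2 hj, hq⟩, log_eq_of_mem_denominators hq⟩

end Fractions

section ExceptionalCoefficient

open Classical in
/-- The coefficient `G(χ_q, a)` of the exceptional part of `approxKernel`, and zero if there is
no exceptional character. -/
def exceptionalCoeff (c : ℝ) (q a : ℕ) : ℂ :=
  if h : ∃ p : DirichletCharacter ℂ q × ℝ, IsExceptional c q p.1 p.2 then
    gaussSum h.choose.1 a
  else 0

lemma norm_exceptionalCoeff_le_one (c : ℝ) {q : ℕ} (hq : 0 < q) (a : ℕ) :
    ‖exceptionalCoeff c q a‖ ≤ 1 := by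
  rw [exceptionalCoeff]
  split_ifs with h
  · exact norm_gaussSum_le_one hq _ a
  · simp

/-- Within a dyadic range of moduli, the exceptional characters relative to `c` share their
conductor and their exceptional zero. -/
def HasCommonExceptionalZero (c : ℝ) : Prop :=
  ∀ (s q r : ℕ) (χ : DirichletCharacter ℂ q) (ψ : DirichletCharacter ℂ r) (β γ : ℝ),
    2 ^ s ≤ q → q < 2 ^ (s + 1) → 2 ^ s ≤ r → r < 2 ^ (s + 1) →
      IsExceptional c q χ β → IsExceptional c r ψ γ → χ.conductor = ψ.conductor ∧ β = γ

/-- Since exceptional zeros agree within a dyadic range, the exponent depends on the range only. In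
a range without exceptional characters the value 1 is a placeholder with coefficient zero. -/
lemma exists_scale_zero {c : ℝ} (hc : HasCommonExceptionalZero c) : ∃ β : ℕ → ℝ,
    (∀ j, 1 / 2 ≤ β j ∧ β j ≤ 1) ∧ ∀ j q, 2 ^ j ≤ q → q < 2 ^ (j + 1) → ∀ a N,
      approxKernel c a q N = gaussSum (1 : DirichletCharacter ℂ q) a • avgKernel 1 N
        - exceptionalCoeff c q a • avgKernel (β j) N := by
  have h : ∀ j : ℕ, ∃ b : ℝ, (1 / 2 ≤ b ∧ b ≤ 1) ∧ ∀ q, 2 ^ j ≤ q → q < 2 ^ (j + 1) → ∀ a N,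
      approxKernel c a q N = gaussSum (1 : DirichletCharacter ℂ q) a • avgKernel 1 N
        - exceptionalCoeff c q a • avgKernel b N := by
    intro j
    by_cases hj : ∃ (q : ℕ) (χ : DirichletCharacter ℂ q) (b : ℝ),
      2 ^ j ≤ q ∧ q < 2 ^ (j + 1) ∧ IsExceptional c q χ b
    · obtain ⟨r, ψ, b, hr1, hr2, hb⟩ := hj
      refine ⟨b, ⟨hb.2.1, hb.2.2.2.1.le⟩, fun q hq1 hq2 a N => ?_⟩
      rw [approxKernel, exceptionalCoeff]
      split_ifs with h
      · rw [(hc j q r _ ψ _ b hq1 hq2 hr1 hr2 h.choose_spec hb).2]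
      · rw [zero_smul, sub_zero]
    · refine ⟨1, ⟨by norm_num, le_rfl⟩, fun q hq1 hq2 a N => ?_⟩
      have h : ¬ ∃ p : DirichletCharacter ℂ q × ℝ, IsExceptional c q p.1 p.2 :=
        fun ⟨p, hp⟩ => hj ⟨q, p.1, p.2, hq1, hq2, hp⟩
      rw [approxKernel, exceptionalCoeff, dif_neg h, dif_neg h, zero_smul, sub_zero]
  choose β hβ using h
  exact ⟨β, fun j => (hβ j).1, fun j => (hβ j).2⟩

lemma sum_norm_principal_sq_le {S j : ℕ} (hj : j ≤ S) :
    ∑ p ∈ fractions S with Nat.log 2 p.1 = j,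
      ‖gaussSum (1 : DirichletCharacter ℂ p.1) p.2‖ ^ 2 ≤ 2 * (S + 1) := by
  rw [sum_fractions_log_eq hj fun q a => ‖gaussSum (1 : DirichletCharacter ℂ q) a‖ ^ 2]
  refine (sum_norm_gaussSum_sq_le (denominators j) (fun q hq => bounds_of_mem_denominators hq)
    (fun _ => 1) (f := 1) fun q hq => ?_).trans ?_
  · have : NeZero q :=
      ⟨(lt_of_lt_of_le (by positivity) (bounds_of_mem_denominators hq).1).ne'⟩
    exact DirichletCharacter.conductor_one
  have : (j : ℝ) ≤ S := by exact_mod_cast hj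
  linarith

/-- Only moduli with an exceptional character contribute, and their characters share one conductor.
-/
lemma sum_norm_exceptionalCoeff_sq_le {c : ℝ} (hc : HasCommonExceptionalZero c) {S j : ℕ}
    (hj : j ≤ S) :
    ∑ p ∈ fractions S with Nat.log 2 p.1 = j, ‖exceptionalCoeff c p.1 p.2‖ ^ 2 ≤ 2 * (S + 1) := by
  classical
  rw [sum_fractions_log_eq hj fun q a => ‖exceptionalCoeff c q a‖ ^ 2]
  set χ : ∀ q : ℕ, DirichletCharacter ℂ q := fun q =>
    if h : ∃ p : DirichletCharacter ℂ q × ℝ, IsExceptional c q p.1 p.2 then h.choose.1 else 1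
    with hχ
  set Q := (denominators j).filter fun q =>
    ∃ p : DirichletCharacter ℂ q × ℝ, IsExceptional c q p.1 p.2 with hQ
  have hj' : (j : ℝ) ≤ S := by exact_mod_cast hj
  have e : ∑ q ∈ denominators j, ∑ a ∈ reducedResidues q, ‖exceptionalCoeff c q a‖ ^ 2
      = ∑ q ∈ Q, ∑ a ∈ reducedResidues q, ‖gaussSum (χ q) a‖ ^ 2 := by
    rw [hQ, Finset.sum_filter]
    refine Finset.sum_congr rfl fun q _ => ?_
    split_ifs with h
    · refine Finset.sum_congr rfl fun a _ => ?_
      rw [exceptionalCoeff, dif_pos h, hχ]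
      simp only [dif_pos h]
    · refine Finset.sum_eq_zero fun a _ => ?_
      rw [exceptionalCoeff, dif_neg h]
      simp
  have hb : ∀ q ∈ Q, 2 ^ j ≤ q ∧ q < 2 ^ (j + 1) := fun q hq =>
    bounds_of_mem_denominators (Finset.mem_filter.1 hq).1
  have hexc : ∀ q ∈ Q, ∃ β, IsExceptional c q (χ q) β := by
    intro q hq
    have h := (Finset.mem_filter.1 hq).2
    rw [hχ]
    simp only [dif_pos h]
    exact ⟨_, h.choose_spec⟩
  rw [e]
  rcases Q.eq_empty_or_nonempty with h0 | ⟨r, hr⟩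
  · rw [h0, Finset.sum_empty]
    positivity
  obtain ⟨γ, hγ⟩ := hexc r hr
  refine (sum_norm_gaussSum_sq_le Q hb χ (f := (χ r).conductor) fun q hq => ?_).trans (by linarith)
  obtain ⟨β, hβ⟩ := hexc q hq
  exact (hc j q r _ _ β γ (hb q hq).1 (hb q hq).2 (hb r hr).1 (hb r hr).2 hβ hγ).1

end ExceptionalCoefficient

section Decomposition

lemma invFourier_sum {ι : Type*} (I : Finset ι) {m : ι → ℝ → ℂ}
    (h : ∀ i ∈ I, IntervalIntegrable (m i) volume 0 1) (x : ℤ) :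
    invFourier (fun ξ => ∑ i ∈ I, m i ξ) x = ∑ i ∈ I, invFourier (m i) x := by
  simp only [invFourier, Finset.sum_mul]
  exact intervalIntegral.integral_finsetSum fun i hi =>
    (h i hi).mul_continuousOn (by fun_prop)

lemma invFourier_mul_sub_mul (c d : ℂ) {m m' : ℝ → ℂ} (h : IntervalIntegrable m volume 0 1)
    (h' : IntervalIntegrable m' volume 0 1) (x : ℤ) :
    invFourier (fun ξ => c * m ξ - d * m' ξ) x = c * invFourier m x - d * invFourier m' x := by
  simp only [invFourier, sub_mul, mul_assoc]
  rw [intervalIntegral.integral_sub, intervalIntegral.integral_const_mul,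
    intervalIntegral.integral_const_mul]
  · exact (h.mul_continuousOn (by fun_prop)).const_mul c
  · exact (h'.mul_continuousOn (by fun_prop)).const_mul d

/-- The error made in dropping the cutoff `cutoffScale η s` around a rational frequency. -/
def cutoffError (η : ℝ → ℝ) (s : ℕ) (w : ℕ → ℝ) (n : ℕ) (ζ : ℂ) (f : ℤ →₀ ℂ) (x : ℤ) : ℂ :=
  ζ ^ x * (∑' k, cutoffKernel η s k * wAvg w n (fun y => ζ ^ (-y) * f y) (x - k)
    - wAvg w n (fun y => ζ ^ (-y) * f y) x)

variable {η : ℝ → ℝ}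

/-- The root of unity `e(a / q)` attached to the pair `(q, a)`. -/
def fracRoot (p : ℕ × ℕ) : ℂ := Complex.exp (2 * Real.pi * Complex.I * p.2 / p.1)

lemma norm_fracRoot (p : ℕ × ℕ) : ‖fracRoot p‖ = 1 := by
  rw [fracRoot, show 2 * Real.pi * Complex.I * p.2 / p.1
    = ((2 * Real.pi * p.2 / p.1 : ℝ) : ℂ) * Complex.I by push_cast; ring,
    Complex.norm_exp_ofReal_mul_I]

lemma invFourier_multiplier (hη : IsCutoff η) {c : ℝ} {β : ℕ → ℝ}
    (hβ : ∀ j q, 2 ^ j ≤ q → q < 2 ^ (j + 1) → ∀ a N,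
      approxKernel c a q N = gaussSum (1 : DirichletCharacter ℂ q) a • avgKernel 1 N
        - exceptionalCoeff c q a • avgKernel (β j) N) (t : ℝ) (n : ℕ) (f : ℤ →₀ ℂ) (x : ℤ) :
    invFourier (fun ξ => multiplier c η t n ξ * hat f ξ) x
      = modSum (fractions ⌊√t⌋₊) (fun p => gaussSum (1 : DirichletCharacter ℂ p.1) p.2) fracRoot
          (fun p => wAvg (powWeight 1) n fun y => fracRoot p ^ (-y) * f y) x
        - modSum (fractions ⌊√t⌋₊) (fun p => exceptionalCoeff c p.1 p.2) fracRoot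
          (fun p => wAvg (powWeight (β (Nat.log 2 p.1))) n fun y => fracRoot p ^ (-y) * f y) x
        + ∑ p ∈ fractions ⌊√t⌋₊, (gaussSum (1 : DirichletCharacter ℂ p.1) p.2 *
            cutoffError η (Nat.log 2 p.1) (powWeight 1) n (fracRoot p) f x
          - exceptionalCoeff c p.1 p.2 * cutoffError η (Nat.log 2 p.1)
              (powWeight (β (Nat.log 2 p.1))) n (fracRoot p) f x) := by
  set T : ℝ → ℕ → ℝ → ℝ → ℂ := fun b s θ ξ =>
    hat (avgKernel b (2 ^ n)) (ξ - θ) * (cutoffScale η s (ξ - θ) : ℂ) * hat f ξ with hT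
  have hTint : ∀ b s θ, IntervalIntegrable (T b s θ) volume 0 1 := by
    intro b s θ
    have h := intervalIntegrable_cutoffScale_mul hη s (g := fun ξ =>
      hat (avgKernel b (2 ^ n)) (ξ - θ) * hat f ξ)
      (((continuous_hat _).comp (continuous_id.sub continuous_const)).mul (continuous_hat f)) θ 0 1
    refine h.congr fun ξ _ => ?_
    simp only [hT]
    ring
  have hTval : ∀ (b : ℝ) (p : ℕ × ℕ) (s : ℕ), invFourier (T b s ((p.2 : ℝ) / p.1)) x
      = fracRoot p ^ x * wAvg (powWeight b) n (fun y => fracRoot p ^ (-y) * f y) x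
        + cutoffError η s (powWeight b) n (fracRoot p) f x := by
    intro b p s
    have e : Complex.exp (2 * Real.pi * Complex.I * (((p.2 : ℝ) / p.1 : ℝ) : ℂ)) = fracRoot p := by
      rw [fracRoot]
      push_cast
      rw [mul_div_assoc]
    rw [hT, invFourier_hat_avgKernel hη, e, cutoffError]
    ring
  have h1 : (fun ξ => multiplier c η t n ξ * hat f ξ) = fun ξ => ∑ p ∈ fractions ⌊√t⌋₊,
      (gaussSum (1 : DirichletCharacter ℂ p.1) p.2 * T 1 (Nat.log 2 p.1) ((p.2 : ℝ) / p.1) ξ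
        - exceptionalCoeff c p.1 p.2 *
          T (β (Nat.log 2 p.1)) (Nat.log 2 p.1) ((p.2 : ℝ) / p.1) ξ) := by
    ext ξ
    simp only [multiplier, nu]
    rw [sum_fractions ⌊√t⌋₊ fun s q a => hat (approxKernel c a q (2 ^ n)) (ξ - a / q) *
      (cutoffScale η s (ξ - a / q) : ℂ), Finset.sum_mul]
    refine Finset.sum_congr rfl fun p hp => ?_
    have hb := bounds_of_mem_denominators (mem_fractions hp).2.1
    rw [hβ _ _ hb.1 hb.2, hat_sub, hat_smul, hat_smul]
    simp only [hT]
    ring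
  rw [h1, invFourier_sum _ fun p _ => ((hTint _ _ _).const_mul _).sub ((hTint _ _ _).const_mul _)]
  rw [modSum, modSum, ← Finset.sum_sub_distrib, ← Finset.sum_add_distrib]
  refine Finset.sum_congr rfl fun p _ => ?_
  rw [invFourier_mul_sub_mul _ _ (hTint _ _ _) (hTint _ _ _), hTval, hTval]
  ring

end Decomposition

end

end PrimeMultiplier

/-! ### The error of removing cutoffs, and the conclusion. -/

namespace PrimeMultiplier

noncomputable section

open MeasureTheory Filter Topology

section ErrorBound

lemma normOne_const_mul_le {c : ℂ} (hc : ‖c‖ ≤ 1) (u : ℤ → ℂ) :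
    normOne (fun x => c * u x) ≤ normOne u :=
  total_mono fun x => by
    rw [norm_mul]
    exact mul_le_of_le_one_left (norm_nonneg _) hc

lemma normOne_sub_le (u v : ℤ → ℂ) : normOne (fun x => u x - v x) ≤ normOne u + normOne v := by
  rw [normOne, normOne, normOne, ← total_add (fun _ => norm_nonneg _) fun _ => norm_nonneg _]
  exact total_mono fun x => norm_sub_le _ _

lemma normOne_sum_le {ι : Type*} (I : Finset ι) (u : ι → ℤ → ℂ) :
    normOne (fun x => ∑ i ∈ I, u i x) ≤ ∑ i ∈ I, normOne (u i) := by
  simp only [normOne]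
  rw [← total_sum I fun _ _ _ => norm_nonneg _]
  exact total_mono fun x => norm_sum_le _ _

/-- At most 2^(2S+2) fractions, each with two terms of size 4A·2^(8S-n) and coefficients of modulus
at most one. -/
lemma normOne_sum_cutoffError_le {η : ℝ → ℝ} (hη : IsCutoff η) {A : ℝ} (hA : 0 < A)
    (hk : ∀ s : ℕ, ∑' k : ℤ, ENNReal.ofReal (|(k : ℝ)| * ‖cutoffKernel η s k‖)
      ≤ ENNReal.ofReal (A * 2 ^ (8 * s))) {β : ℕ → ℝ} (hβ : ∀ j, 1 / 2 ≤ β j ∧ β j ≤ 1)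
    (c : ℝ) (S n : ℕ) (f : ℤ →₀ ℂ) :
    normOne (fun x => ∑ p ∈ fractions S, (gaussSum (1 : DirichletCharacter ℂ p.1) p.2 *
            cutoffError η (Nat.log 2 p.1) (powWeight 1) n (fracRoot p) f x
          - exceptionalCoeff c p.1 p.2 * cutoffError η (Nat.log 2 p.1)
              (powWeight (β (Nat.log 2 p.1))) n (fracRoot p) f x))
      ≤ ENNReal.ofReal (32 * A * 2 ^ (10 * S) * ((2 : ℝ) ^ n)⁻¹) * normOne f := by
  have hone : ∀ p ∈ fractions S, ∀ b : ℝ, 1 / 2 ≤ b → b ≤ 1 →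
      normOne (cutoffError η (Nat.log 2 p.1) (powWeight b) n (fracRoot p) f)
        ≤ ENNReal.ofReal (4 * A * 2 ^ (8 * S) * ((2 : ℝ) ^ n)⁻¹) * normOne f := by
    intro p hp b hb1 hb2
    refine (normOne_cutoff_error_le hη (hk _) (isDecreasingWeight_powWeight hb1 hb2) n
      (norm_fracRoot p) f).trans ?_
    rw [← mul_assoc, ← ENNReal.ofReal_mul (by positivity)]
    refine mul_le_mul_left (ENNReal.ofReal_le_ofReal ?_) _
    have h : (2 : ℝ) ^ (8 * Nat.log 2 p.1) ≤ 2 ^ (8 * S) :=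
      pow_le_pow_right₀ one_le_two (Nat.mul_le_mul_left _ (mem_fractions hp).1)
    calc A * 2 ^ (8 * Nat.log 2 p.1) * (4 * ((2 : ℝ) ^ n)⁻¹)
        ≤ A * 2 ^ (8 * S) * (4 * ((2 : ℝ) ^ n)⁻¹) := by gcongr
      _ = _ := by ring
  refine (normOne_sum_le _ _).trans ?_
  calc _ ≤ ∑ p ∈ fractions S, ENNReal.ofReal (8 * A * 2 ^ (8 * S) * ((2 : ℝ) ^ n)⁻¹) *
          normOne f := by
        refine Finset.sum_le_sum fun p hp => ?_
        have hq : 0 < p.1 := lt_of_lt_of_le (by positivity)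
          (bounds_of_mem_denominators (mem_fractions hp).2.1).1
        refine (normOne_sub_le _ _).trans ?_
        refine (add_le_add ((normOne_const_mul_le (norm_gaussSum_le_one hq _ _) _).trans
          (hone p hp 1 (by norm_num) le_rfl))
          ((normOne_const_mul_le (norm_exceptionalCoeff_le_one c hq _) _).trans
          (hone p hp _ (hβ _).1 (hβ _).2))).trans (le_of_eq ?_)
        rw [← add_mul, ← ENNReal.ofReal_add (by positivity) (by positivity)]
        congr 2
        ring
    _ = ENNReal.ofReal ((fractions S).card * (8 * A * 2 ^ (8 * S) * ((2 : ℝ) ^ n)⁻¹)) *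
          normOne f := by
        rw [Finset.sum_const, nsmul_eq_mul, ENNReal.ofReal_mul (Nat.cast_nonneg _),
          ENNReal.ofReal_natCast, ← mul_assoc ((fractions S).card : ENNReal)]
    _ ≤ _ := by
        refine mul_le_mul_left (ENNReal.ofReal_le_ofReal ?_) _
        have h : ((fractions S).card : ℝ) ≤ 2 ^ (S + 1) * 2 ^ (S + 1) := by
          exact_mod_cast card_fractions_le S
        calc ((fractions S).card : ℝ) * (8 * A * 2 ^ (8 * S) * ((2 : ℝ) ^ n)⁻¹)
            ≤ 2 ^ (S + 1) * 2 ^ (S + 1) * (8 * A * 2 ^ (8 * S) * ((2 : ℝ) ^ n)⁻¹) := by gcongr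
          _ = 32 * A * (2 ^ S * 2 ^ S * 2 ^ (8 * S)) * ((2 : ℝ) ^ n)⁻¹ := by ring
          _ = _ := by rw [← pow_add, ← pow_add]; congr 3; ring

/-- The restriction n ≥ S² makes 2^(10S-n) summable uniformly in S, as 10S ≤ S² + 25; Chebyshev at
each n then suffices. -/
lemma count_exists_lt_norm_le {E : ℕ → ℤ → ℂ} {B : ℝ} (hB : 0 ≤ B) {S : ℕ} {N : ENNReal}
    (hE : ∀ n, normOne (E n) ≤ ENNReal.ofReal (B * 2 ^ (10 * S) * ((2 : ℝ) ^ n)⁻¹) * N)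
    (lam : ℝ) :
    ENNReal.ofReal lam * Measure.count {x | ∃ n ≥ S ^ 2, lam < ‖E n x‖}
      ≤ ENNReal.ofReal (B * 2 ^ 26) * N := by
  have hsub : {x | ∃ n ≥ S ^ 2, lam < ‖E n x‖} ⊆ ⋃ j, {x | lam < ‖E (S ^ 2 + j) x‖} := by
    rintro x ⟨n, hn, hx⟩
    refine Set.mem_iUnion.2 ⟨n - S ^ 2, ?_⟩
    change lam < ‖E (S ^ 2 + (n - S ^ 2)) x‖
    rwa [Nat.add_sub_cancel' hn]
  have hpow : ∀ j, (2 : ℝ) ^ (10 * S) * ((2 : ℝ) ^ (S ^ 2 + j))⁻¹ ≤ 2 ^ 25 * (1 / 2) ^ j := by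
    intro j
    have h : 10 * S ≤ 25 + S ^ 2 := by
      zify
      nlinarith [sq_nonneg ((S : ℤ) - 5)]
    have h2 : (2 : ℝ) ^ (10 * S) ≤ 2 ^ 25 * 2 ^ S ^ 2 := by
      rw [← pow_add]
      exact pow_le_pow_right₀ one_le_two h
    rw [pow_add, one_div, inv_pow, mul_inv, ← mul_assoc]
    refine mul_le_mul_of_nonneg_right ?_ (by positivity)
    rw [← div_eq_mul_inv, div_le_iff₀ (by positivity)]
    exact h2
  calc _ ≤ ENNReal.ofReal lam * ∑' j, Measure.count {x | lam < ‖E (S ^ 2 + j) x‖} :=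
        mul_le_mul_right ((measure_mono hsub).trans (measure_iUnion_le _)) _
    _ = ∑' j, ENNReal.ofReal lam * Measure.count {x | lam < ‖E (S ^ 2 + j) x‖} :=
        ENNReal.tsum_mul_left.symm
    _ ≤ ∑' j : ℕ, ENNReal.ofReal (B * 2 ^ 25 * (1 / 2) ^ j) * N := by
        refine ENNReal.tsum_le_tsum fun j => ?_
        refine (count_le_total fun x (hx : lam < ‖E (S ^ 2 + j) x‖) => hx.le).trans ?_
        refine (hE _).trans (mul_le_mul_left (ENNReal.ofReal_le_ofReal ?_) _)
        rw [mul_assoc, mul_assoc]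
        exact mul_le_mul_of_nonneg_left (hpow j) hB
    _ = _ := by
        rw [ENNReal.tsum_mul_right, ← ENNReal.ofReal_tsum_of_nonneg (fun j => by positivity)
          (summable_geometric_two.mul_left _), tsum_mul_left, tsum_geometric_two]
        congr 2
        ring

end ErrorBound

section Final

lemma normOne_eq_ofReal_l1norm (f : ℤ →₀ ℂ) : normOne f = ENNReal.ofReal (l1norm f) := by
  rw [normOne, total, l1norm, ENNReal.ofReal_sum_of_nonneg fun _ _ => norm_nonneg _]
  refine tsum_eq_sum fun x hx => ?_
  rw [Finsupp.notMem_support_iff.1 hx, norm_zero, ENNReal.ofReal_zero]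

lemma count_exists_lt_norm_sub_add_le (U V W : ℕ → ℤ → ℂ) (n₀ : ℕ) (lam : ℝ) {a b d : ENNReal}
    (hU : ENNReal.ofReal (lam / 3) * Measure.count {x | ∃ n ≥ n₀, lam / 3 < ‖U n x‖} ≤ a)
    (hV : ENNReal.ofReal (lam / 3) * Measure.count {x | ∃ n ≥ n₀, lam / 3 < ‖V n x‖} ≤ b)
    (hW : ENNReal.ofReal (lam / 3) * Measure.count {x | ∃ n ≥ n₀, lam / 3 < ‖W n x‖} ≤ d) :
    ENNReal.ofReal lam * Measure.count {x | ∃ n ≥ n₀, lam < ‖U n x - V n x + W n x‖}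
      ≤ ENNReal.ofReal 3 * (a + b + d) := by
  have hsub : {x | ∃ n ≥ n₀, lam < ‖U n x - V n x + W n x‖}
      ⊆ ({x | ∃ n ≥ n₀, lam / 3 < ‖U n x‖} ∪ {x | ∃ n ≥ n₀, lam / 3 < ‖V n x‖})
        ∪ {x | ∃ n ≥ n₀, lam / 3 < ‖W n x‖} := by
    rintro x ⟨n, hn, hx⟩
    by_contra hcon
    simp only [Set.mem_union, Set.mem_ofPred_eq, not_or, not_exists, not_and, not_lt] at hcon
    have h1 := hcon.1.1 n hn
    have h2 := hcon.1.2 n hn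
    have h3 := hcon.2 n hn
    have h4 := norm_add_le (U n x - V n x) (W n x)
    have h5 := norm_sub_le (U n x) (V n x)
    linarith
  have hlam : ENNReal.ofReal lam = ENNReal.ofReal 3 * ENNReal.ofReal (lam / 3) := by
    rw [← ENNReal.ofReal_mul (by norm_num)]
    congr 1
    ring
  rw [hlam, mul_assoc]
  refine mul_le_mul_right (le_trans (mul_le_mul_right ((measure_mono hsub).trans
    ((measure_union_le _ _).trans (add_le_add (measure_union_le _ _) le_rfl))) _) ?_) _
  rw [mul_add, mul_add]
  exact add_le_add (add_le_add hU hV) hW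

lemma floor_sqrt_bounds {t : ℝ} (ht : 0 < t) :
    (∀ n : ℕ, t ≤ n → ⌊√t⌋₊ ^ 2 ≤ n) ∧ ((⌊√t⌋₊ : ℝ) + 1) ^ 2 ≤ 4 * max 1 t := by
  have h1 : (⌊√t⌋₊ : ℝ) ≤ √t := Nat.floor_le (Real.sqrt_nonneg t)
  have h0 : (0 : ℝ) ≤ ⌊√t⌋₊ := Nat.cast_nonneg _
  have h2 : √t * √t = t := Real.mul_self_sqrt ht.le
  have h3 : (⌊√t⌋₊ : ℝ) ^ 2 ≤ t := by nlinarith [Real.sqrt_nonneg t]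
  refine ⟨fun n hn => ?_, ?_⟩
  · have : ((⌊√t⌋₊ ^ 2 : ℕ) : ℝ) ≤ n := by push_cast; linarith
    exact_mod_cast this
  · nlinarith [le_max_left 1 t, le_max_right 1 t, sq_nonneg ((⌊√t⌋₊ : ℝ) - 1)]

theorem exists_weak_type_maximalFunction {c : ℝ} (hc : HasCommonExceptionalZero c) {η : ℝ → ℝ}
    (hη : IsCutoff η) : ∃ C : ℝ, 0 < C ∧ ∀ t : ℝ, 0 < t → ∀ f : ℤ →₀ ℂ, ∀ lam : ℝ, 0 < lam →
      ENNReal.ofReal lam * Measure.count {x | ENNReal.ofReal lam < maximalFunction c η t f x}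
        ≤ ENNReal.ofReal (C * max 1 t * l1norm f) := by
  obtain ⟨C, hC, hmain⟩ := exists_weak_type_bound 2 zero_le_two
  obtain ⟨A, hA, hk⟩ := exists_tsum_abs_mul_cutoffKernel_le hη
  obtain ⟨β, hβ, hker⟩ := exists_scale_zero hc
  -- The 4 comes from (S+1)² ≤ 4 max(1,t), the 3 from splitting λ among three terms, and 2C from the
  -- principal and exceptional sums.
  refine ⟨4 * (3 * (2 * C + 32 * A * 2 ^ 26)), by positivity, fun t ht f lam hlam => ?_⟩
  set S := ⌊√t⌋₊ with hS
  obtain ⟨hn, hSt⟩ := floor_sqrt_bounds ht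
  rw [← hS] at hn hSt
  have hfarey : IsFareyFamily (2 ^ (S + 1)) (fractions S) fracRoot := by
    refine farey_isFareyFamily (fractions S) fun p hp => ?_
    obtain ⟨h1, h2, h3⟩ := mem_fractions hp
    have hb := bounds_of_mem_denominators h2
    exact ⟨lt_of_lt_of_le (by positivity) hb.1,
      hb.2.trans_le (Nat.pow_le_pow_right two_pos (Nat.succ_le_succ h1)), h3⟩
  have hf : normOne f ≠ ⊤ := by rw [normOne_eq_ofReal_l1norm]; exact ENNReal.ofReal_ne_top
  have hU := hmain S (fractions S) fracRoot
    (fun p => gaussSum (1 : DirichletCharacter ℂ p.1) p.2) (fun _ => powWeight 1)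
    (fun p => Nat.log 2 p.1) hfarey norm_fracRoot
    (fun _ => isDecreasingWeight_powWeight (by norm_num) le_rfl)
    (fun p hp => (mem_fractions hp).1) (fun j hj => sum_norm_principal_sq_le hj) f hf (lam / 3)
    (by positivity)
  have hV := hmain S (fractions S) fracRoot
    (fun p => exceptionalCoeff c p.1 p.2) (fun j => powWeight (β j))
    (fun p => Nat.log 2 p.1) hfarey norm_fracRoot
    (fun j => isDecreasingWeight_powWeight (hβ j).1 (hβ j).2)
    (fun p hp => (mem_fractions hp).1) (fun j hj => sum_norm_exceptionalCoeff_sq_le hc hj) f hf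
    (lam / 3) (by positivity)
  have hW := count_exists_lt_norm_le (by positivity)
    (fun n => normOne_sum_cutoffError_le hη hA hk hβ c S n f) (lam / 3)
  have hsub : {x | ENNReal.ofReal lam < maximalFunction c η t f x} ⊆
      {x | ∃ n ≥ S ^ 2, lam < ‖modSum (fractions S)
          (fun p => gaussSum (1 : DirichletCharacter ℂ p.1) p.2) fracRoot
          (fun p => wAvg (powWeight 1) n fun y => fracRoot p ^ (-y) * f y) x
        - modSum (fractions S) (fun p => exceptionalCoeff c p.1 p.2) fracRoot
          (fun p => wAvg (powWeight (β (Nat.log 2 p.1))) n fun y => fracRoot p ^ (-y) * f y) x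
        + ∑ p ∈ fractions S, (gaussSum (1 : DirichletCharacter ℂ p.1) p.2 *
            cutoffError η (Nat.log 2 p.1) (powWeight 1) n (fracRoot p) f x
          - exceptionalCoeff c p.1 p.2 * cutoffError η (Nat.log 2 p.1)
              (powWeight (β (Nat.log 2 p.1))) n (fracRoot p) f x)‖} := by
    intro x (hx : ENNReal.ofReal lam < maximalFunction c η t f x)
    rw [maximalFunction, lt_iSup_iff] at hx
    obtain ⟨n, hx⟩ := hx
    obtain ⟨htn, hx⟩ := lt_iSup_iff.1 hx
    refine ⟨n, hn n htn, ?_⟩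
    rw [← ofReal_norm, ENNReal.ofReal_lt_ofReal_iff_of_nonneg hlam.le] at hx
    rwa [invFourier_multiplier hη hker t n f x] at hx
  refine (mul_le_mul_right (measure_mono hsub) _).trans
    ((count_exists_lt_norm_sub_add_le _ _ _ (S ^ 2) lam hU hV hW).trans ?_)
  have hl : 0 ≤ l1norm f := Finset.sum_nonneg fun _ _ => norm_nonneg _
  rw [normOne_eq_ofReal_l1norm, ← add_mul, ← add_mul,
    ← ENNReal.ofReal_add (by positivity) (by positivity),
    ← ENNReal.ofReal_add (by positivity) (by positivity), ← ENNReal.ofReal_mul (by positivity),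
    ← ENNReal.ofReal_mul (by norm_num)]
  refine ENNReal.ofReal_le_ofReal ?_
  rw [← mul_assoc]
  refine mul_le_mul_of_nonneg_right ?_ hl
  have hmax : 1 ≤ max 1 t := le_max_left _ _
  have h1 : C * ((S : ℝ) + 1) ^ 2 ≤ C * (4 * max 1 t) := mul_le_mul_of_nonneg_left hSt hC
  nlinarith

end Final

end

end PrimeMultiplier

open PrimeMultiplier in
theorem theorem3 :
    ∃ c₀ : ℝ, 0 < c₀ ∧ ∀ c : ℝ, 0 < c → c ≤ c₀ →
      (∀ (q : ℕ) (χ χ' : DirichletCharacter ℂ q) (β β' : ℝ),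
        IsExceptional c q χ β → IsExceptional c q χ' β' → χ = χ' ∧ β = β') ∧
      ∀ η : ℝ → ℝ, IsCutoff η →
        ∃ C : ℝ, 0 < C ∧ ∀ t : ℝ, 0 < t → ∀ f : ℤ →₀ ℂ, ∀ lam : ℝ, 0 < lam →
          {x : ℤ | ENNReal.ofReal lam < maximalFunction c η t f x}.Finite ∧
          lam * ({x : ℤ | ENNReal.ofReal lam < maximalFunction c η t f x}.ncard : ℝ)
            ≤ C * max 1 t * l1norm f := by
  obtain ⟨c₀, hc₀, h⟩ := exists_exceptional_common
  refine ⟨c₀, hc₀, fun c hc hcc => ⟨(h c hc hcc).1, fun η hη => ?_⟩⟩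
  obtain ⟨C, hC, hbound⟩ := exists_weak_type_maximalFunction (h c hc hcc).2 hη
  refine ⟨C, hC, fun t ht f lam hlam => ?_⟩
  have hb := hbound t ht f lam hlam
  set D := {x : ℤ | ENNReal.ofReal lam < maximalFunction c η t f x}
  have hl : 0 ≤ l1norm f := Finset.sum_nonneg fun _ _ => norm_nonneg _
  -- An infinite level set would have infinite counting measure, against the finite bound.
  have hfin : D.Finite := by
    rw [← MeasureTheory.Measure.count_apply_lt_top]
    by_contra hcon
    rw [not_lt, top_le_iff] at hcon
    rw [hcon, ENNReal.mul_top (by simpa using hlam)] at hb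
    exact absurd hb (not_le.2 ENNReal.ofReal_lt_top)
  refine ⟨hfin, ?_⟩
  rw [MeasureTheory.Measure.count_apply_finite D hfin, ← Set.ncard_eq_toFinset_card D hfin,
    ← ENNReal.ofReal_natCast, ← ENNReal.ofReal_mul hlam.le] at hb
  exact (ENNReal.ofReal_le_ofReal_iff (by positivity)).1 hb
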